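/- **Setting.** $\mathcal C_p^\infty$ is the space of functions $\mathbb R\to\mathbb C$ that are smooth off a finite set, at whose points all derivatives have finite lateral limits; $\mathcal A\subset\mathcal D'(\mathbb R)$ consists of the functions in $\mathcal C_p^\infty$, regarded as distributions, and all their distributional derivatives. For $F,G\in\mathcal A$ let $F*G=\lim_{\varepsilon\downarrow0}F(x)\cdot G(x+\varepsilon)$ (limit in $\mathcal D'$), where $\cdot$ is the Hörmander product of distributions with disjoint singular supports (near each point one factor is a smooth function, and the other is multiplied by it). The order $\operatorname{ord}F$ is the least $k$ such that $F$ is the $k$-th distributional derivative of a locally integrable function. $H$ is the Heaviside function and $H_-=1-H$. Let $n\ge 0$ and, for $0\le i\le n$, $$a_i=H_-a_{i-}+Ha_{i+}+A_i,\qquad b_i=H_-b_{i-}+Hb_{i+}+B_i,$$ where $a_{i\pm},b_{i\pm}\in C^\infty(\mathbb R,\mathbb C)$ and $A_i=\sum_kA_{ik}\delta^{(k)}$, $B_i=\sum_kB_{ik}\delta^{(k)}$ are finite sums with complex coefficients, and let $M=\max_i\{\operatorname{ord}A_i,\operatorname{ord}B_i\}$. For $f\in C^\infty(\mathbb R,\mathbb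 C)$, a solution of $$L\psi:=\sum_{i=0}^n\bigl(a_i*\psi^{(i)}+\psi^{(i)}*b_i\bigr)=f\tag{1}$$ is a $\psi\in\mathcal A$ that satisfies (1) in $\mathcal D'$. Equation (1) is *sectionally regular* if for every nonempty open interval $\Omega$ on which all $a_i,b_i$ are smooth functions, with smooth extensions $a_{i\overline\Omega},b_{i\overline\Omega}$ to $\overline\Omega$, every $x_0\in\overline\Omega$ and every $C\in\mathbb C^n$, the problem $\sum_{i=0}^n(a_{i\overline\Omega}+b_{i\overline\Omega})\varphi^{(i)}=f$ on $\overline\Omega$, $\varphi^{(i)}(x_0)=C_{i+1}$ $(0\le i<n)$, has a unique solution $\varphi\in C^\infty(\overline\Omega)$. For smooth $u$ write $\overline{u(0)}=(u(0),u'(0),\dots,u^{(n-1)}(0))^T$. Consider the equations $$\sum_{i=0}^n(a_{i-}+b_{i-})\psi_-^{(i)}=f\ \text{ on }(-\infty,0],\qquad \sum_{i=0}^n(a_{i+}+b_{i+})\psi_+^{(i)}=f\ \text{ on }[0,\infty).\tag{2}$$ **Theorem.** Assume that $a_{n-}(0)+b_{n+}(0)\ne0$, $a_{n-}(0)+b_{n-}(0)\neq0$,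 $a_{n+}(0)+b_{n+}(0)\ne0$ and $M\le n$. Assume also that for each $x<0$ the numbers $a_{i-}(x)+b_{i-}(x)$, $0\le i\le n$, are not all zero, and that for each $x>0$ the numbers $a_{i+}(x)+b_{i+}(x)$, $0\le i\le n$, are not all zero. Then there are linear maps $f_i:\mathbb C^{n}\times\mathbb C^n\to\mathbb C$ $(0\le i<n)$, a linear map $g=(g_0,\dots,g_{n-1}):\mathbb C^n\to\mathbb C^n$ and $n\times n$ complex matrices $\mathbf A,\mathbf B$ with $f_i(X,Y)=(\mathbf BY-\mathbf AX)_i$ such that the following holds for every smooth $f$ for which (1) is sectionally regular. For $\psi=H_-\psi_-+H\psi_+$ with smooth $\psi_\pm$ that satisfy (2), put $$\widehat F\psi=\sum_{i=0}^{n-1}\delta^{(i)}\Bigl[f_i\bigl(\overline{\psi_-(0)},\overline{\psi_+(0)}\bigr)+g_i\bigl(\overline{f(0)}\bigr)\Bigr].$$ 1. Every solution $\psi$ of (1) is of the form $\psi=H_-\psi_-+H\psi_+$ with $\psi_\pm\in C^\infty(\mathbb R)$ that satisfy (2), and it satisfies the interface condition $\widehat F\psi=0$, equivalently $$\mathbf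 A\,\overline{\psi_-(0)}=\mathbf B\,\overline{\psi_+(0)}+g\bigl(\overline{f(0)}\bigr).$$ 2. For all $\psi_\pm\in C^\infty(\mathbb R)$ that satisfy (2), the distribution $\psi=H_-\psi_-+H\psi_+$ satisfies $L\psi-f=\widehat F\psi$. Hence $\psi$ is a solution of (1) if and only if $\widehat F\psi=0$, if and only if $\mathbf A\,\overline{\psi_-(0)}=\mathbf B\,\overline{\psi_+(0)}+g(\overline{f(0)})$. In particular, if $f=0$, or more generally if $f^{(k)}(0)=0$ for $0\le k<n$, then the interface condition is $\mathbf A\,\overline{\psi_-(0)}=\mathbf B\,\overline{\psi_+(0)}$. -/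

import Mathlib

namespace SingODE

open TopologicalSpace MeasureTheory Filter Topology
open scoped Distributions ContDiff LineDeriv

/-- Real-valued test functions on the real line. -/
abbrev Test : Type := TestFunction (⊤ : Opens ℝ) ℝ ⊤

/-- Complex-valued test functions on the real line. -/
abbrev CTest : Type := TestFunction (⊤ : Opens ℝ) ℂ ⊤

/-- Complex Schwartz distributions on the real line. -/
abbrev Dist : Type := Distribution (⊤ : Opens ℝ) ℂ ⊤

/-- The distribution `t ↦ ∫ t g`, for a locally integrable function `g`. -/
noncomputable def regular (g : ℝ → ℂ) : Dist :=
  ContinuousLinearMap.toUniformConvergenceCLM _ _ _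
    (TestFunction.integralAgainstBilinCLM (ContinuousLinearMap.lsmul ℝ ℝ) volume g)

theorem regular_apply {g : ℝ → ℂ} (hg : LocallyIntegrable g) (t : Test) :
    regular g t = ∫ x, (t x : ℂ) * g x := by
  have h : LocallyIntegrableOn g ((⊤ : Opens ℝ) : Set ℝ) volume := by
    simpa [locallyIntegrableOn_univ] using hg
  change TestFunction.integralAgainstBilinCLM (ContinuousLinearMap.lsmul ℝ ℝ) volume g t = _
  rw [TestFunction.integralAgainstBilinCLM_eq_integral h]
  simp

/-- The distributional derivative. -/
noncomputable def D (F : Dist) : Dist := ∂_{(1 : ℝ)} F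

theorem D_apply (F : Dist) (t : Test) : D F t = -F (∂_{(1 : ℝ)} t) := rfl

/-- The Dirac measure at `0`. -/
noncomputable def dirac : Dist := Distribution.mapCLM Complex.ofRealCLM (Distribution.delta 0)

theorem dirac_apply (t : Test) : dirac t = (t 0 : ℂ) := rfl

/-- The test function `x ↦ t (x - c)`, continuously in `t`. -/
noncomputable def shiftTest (c : ℝ) : Test →L[ℝ] Test :=
  TestFunction.limitCLM ℝ
    (fun t : Test =>
      (⟨fun x => t (x - c), t.contDiff.comp (contDiff_id.sub contDiff_const),
        t.hasCompactSupport.comp_homeomorph (Homeomorph.subRight c), by simp⟩ : Test))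
    (fun K _ =>
      (TestFunction.ofSupportedInCLM ℝ (Ω := (⊤ : Opens ℝ))
          (K := K.map (fun x => x + c) (continuous_id.add continuous_const)) (by simp)) ∘L
        (ContDiffMapSupportedIn.mkCLM ℝ (fun t x => t (x - c))
          (fun _ _ _ => rfl) (fun _ _ _ => rfl)
          (fun t => t.contDiff.comp (contDiff_id.sub contDiff_const))
          (fun t x hx => t.zero_on_compl (fun h => hx ⟨x - c, h, by simp⟩))
          (fun i hi => ⟨{i}, 1, zero_le_one, fun t x _ => by
            rw [iteratedFDeriv_comp_sub]
            simpa using ContDiffMapSupportedIn.norm_iteratedFDeriv_apply_le_seminorm ℝ hi⟩)))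
    (fun _ _ _ => rfl)

theorem shiftTest_apply (c : ℝ) (t : Test) (x : ℝ) : shiftTest c t x = t (x - c) := rfl

/-- The translate `F(x + c)` of a distribution `F(x)`. -/
noncomputable def translate (c : ℝ) (F : Dist) : Dist :=
  (shiftTest c).precompCompactConvergenceCLM ℂ F

theorem translate_apply (c : ℝ) (F : Dist) (t : Test) : translate c F t = F (shiftTest c t) := rfl

/-- The complex-linear extension of `F` to complex-valued test functions. -/
noncomputable def pair (F : Dist) (w : CTest) : ℂ :=
  F (TestFunction.postcompCLM Complex.reCLM w) +
    Complex.I * F (TestFunction.postcompCLM Complex.imCLM w)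

/-- On the open set `U`, the distribution `F` is the (locally integrable) function `g`. -/
def EqFunOn (F : Dist) (g : ℝ → ℂ) (U : Set ℝ) : Prop :=
  ∀ t : Test, tsupport t ⊆ U → F t = ∫ x, (t x : ℂ) * g x

/-- On the open set `U`, where `g` is smooth, `P` is the dual product `F · g`, that is
`⟨P, t⟩ = ⟨F, g t⟩` for the test functions `t` with support in `U`. -/
def IsDualProductOn (F : Dist) (g : ℝ → ℂ) (P : Dist) (U : Set ℝ) : Prop :=
  ∀ t : Test, tsupport t ⊆ U → ∀ w : CTest, (∀ x, w x = g x * (t x : ℂ)) → P t = pair F w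

/-- `P` is the Hörmander product `F · G`: near every point, one of the two factors is a smooth
function and `P` is the dual product of the other factor by that function. -/
def IsHormanderProduct (F G P : Dist) : Prop :=
  ∀ x : ℝ, ∃ U : Set ℝ, IsOpen U ∧ x ∈ U ∧ ∃ g : ℝ → ℂ, ContDiffOn ℝ ∞ g U ∧
    ((EqFunOn G g U ∧ IsDualProductOn F g P U) ∨ (EqFunOn F g U ∧ IsDualProductOn G g P U))

/-- `P` is the product `F * G`, the distributional limit of the Hörmander products
`F(x) · G(x + ε)` as `ε ↓ 0`. -/
def IsStarProduct (F G P : Dist) : Prop :=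
  ∃ Q : ℝ → Dist, (∀ᶠ ε in 𝓝[>] (0 : ℝ), IsHormanderProduct F (translate ε G) (Q ε)) ∧
    ∀ t : Test, Tendsto (fun ε => Q ε t) (𝓝[>] 0) (𝓝 (P t))

open Classical in
/-- The product `F * G` (and `0` if the limit that defines it does not exist). -/
noncomputable def star (F G : Dist) : Dist :=
  if h : ∃ P, IsStarProduct F G P then h.choose else 0

/-- Piecewise smooth functions on the real line: smooth off a finite set, at whose points all
derivatives have finite lateral limits. -/
def PiecewiseSmooth (φ : ℝ → ℂ) : Prop :=
  ∃ I : Set ℝ, I.Finite ∧ ContDiffOn ℝ ∞ φ Iᶜ ∧ ∀ p ∈ I, ∀ j : ℕ,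
    (∃ l, Tendsto (iteratedDeriv j φ) (𝓝[<] p) (𝓝 l)) ∧
    (∃ l, Tendsto (iteratedDeriv j φ) (𝓝[>] p) (𝓝 l))

/-- The space `𝒜` of the piecewise smooth functions and all their distributional derivatives. -/
def spaceA : Set Dist :=
  {F | ∃ φ : ℝ → ℂ, PiecewiseSmooth φ ∧ ∃ k : ℕ, F = D^[k] (regular φ)}

/-- The order of a distribution: the least `k` such that it is the `k`-th distributional
derivative of a regular distribution (`⊤` if there is none). -/
noncomputable def ord (F : Dist) : ℕ∞ :=
  sInf {k : ℕ∞ | ∃ m : ℕ, k = m ∧ ∃ g : ℝ → ℂ, LocallyIntegrable g ∧ F = D^[m] (regular g)}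

/-- The function `H₋ u + H v`. -/
noncomputable def glue (u v : ℝ → ℂ) (x : ℝ) : ℂ := if x < 0 then u x else v x

/-- The distribution `∑ₖ cₖ δ⁽ᵏ⁾`. -/
noncomputable def deltaSum (c : ℕ →₀ ℂ) : Dist := c.sum fun k z => z • D^[k] dirac

/-- `ψ̄(0) = (ψ(0), ψ'(0), …, ψ⁽ⁿ⁻¹⁾(0))`. -/
noncomputable def jet (n : ℕ) (u : ℝ → ℂ) : Fin n → ℂ := fun k => iteratedDeriv k u 0

/-- The coefficients of an equation of order `n`,
`aᵢ = H₋ aᵢ₋ + H aᵢ₊ + Aᵢ` and `bᵢ = H₋ bᵢ₋ + H bᵢ₊ + Bᵢ`, where `aᵢ±`, `bᵢ±` are smooth on the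
real line and `Aᵢ = ∑ₖ Aᵢₖ δ⁽ᵏ⁾`, `Bᵢ = ∑ₖ Bᵢₖ δ⁽ᵏ⁾` are finite sums. -/
structure Coeffs (n : ℕ) where
  aNeg : Fin (n + 1) → ℝ → ℂ
  aPos : Fin (n + 1) → ℝ → ℂ
  bNeg : Fin (n + 1) → ℝ → ℂ
  bPos : Fin (n + 1) → ℝ → ℂ
  A : Fin (n + 1) → ℕ →₀ ℂ
  B : Fin (n + 1) → ℕ →₀ ℂ
  smooth_aNeg : ∀ i, ContDiff ℝ ∞ (aNeg i)
  smooth_aPos : ∀ i, ContDiff ℝ ∞ (aPos i)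
  smooth_bNeg : ∀ i, ContDiff ℝ ∞ (bNeg i)
  smooth_bPos : ∀ i, ContDiff ℝ ∞ (bPos i)

namespace Coeffs

variable {n : ℕ} (E : Coeffs n)

/-- The left coefficients `aᵢ`. -/
noncomputable def a (i : Fin (n + 1)) : Dist :=
  regular (glue (E.aNeg i) (E.aPos i)) + deltaSum (E.A i)

/-- The right coefficients `bᵢ`. -/
noncomputable def b (i : Fin (n + 1)) : Dist :=
  regular (glue (E.bNeg i) (E.bPos i)) + deltaSum (E.B i)

/-- `M = max {ord Aᵢ, ord Bᵢ}`. -/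
noncomputable def M : ℕ∞ := ⨆ i, max (ord (deltaSum (E.A i))) (ord (deltaSum (E.B i)))

/-- `L ψ = ∑ᵢ (aᵢ * ψ⁽ⁱ⁾ + ψ⁽ⁱ⁾ * bᵢ)`. -/
noncomputable def L (ψ : Dist) : Dist :=
  ∑ i : Fin (n + 1), (star (E.a i) (D^[i] ψ) + star (D^[i] ψ) (E.b i))

/-- `ψ ∈ 𝒜` is a solution of `L ψ = f`. -/
def IsSolution (f : ℝ → ℂ) (ψ : Dist) : Prop := ψ ∈ spaceA ∧ E.L ψ = regular f

/-- `∑ᵢ (aᵢ₋ + bᵢ₋) u⁽ⁱ⁾ = f` on `(-∞, 0]`. -/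
def SolvesNeg (f u : ℝ → ℂ) : Prop :=
  ∀ x ≤ 0, ∑ i : Fin (n + 1), (E.aNeg i x + E.bNeg i x) * iteratedDeriv i u x = f x

/-- `∑ᵢ (aᵢ₊ + bᵢ₊) v⁽ⁱ⁾ = f` on `[0, ∞)`. -/
def SolvesPos (f v : ℝ → ℂ) : Prop :=
  ∀ x ≥ 0, ∑ i : Fin (n + 1), (E.aPos i x + E.bPos i x) * iteratedDeriv i v x = f x

/-- `φ` is smooth on the closed interval `S` and solves there the initial value problem
`∑ᵢ (αᵢ + βᵢ) φ⁽ⁱ⁾ = f`, `φ⁽ⁱ⁾(x₀) = Cᵢ` for `i < n`. -/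
def IsIVPSolution (S : Set ℝ) (α β : Fin (n + 1) → ℝ → ℂ) (f : ℝ → ℂ) (x₀ : ℝ) (C : Fin n → ℂ)
    (φ : ℝ → ℂ) : Prop :=
  ContDiffOn ℝ ∞ φ S ∧
  (∀ x ∈ S, ∑ i : Fin (n + 1), (α i x + β i x) * iteratedDerivWithin i φ S x = f x) ∧
  ∀ i : Fin n, iteratedDerivWithin i φ S x₀ = C i

/-- `L ψ = f` is sectionally regular: on every nonempty open interval `U` on which all the
coefficients are smooth functions, with smooth extensions `αᵢ`, `βᵢ` to the closure of `U`, every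
initial value problem with data at a point of the closure has a unique smooth solution on it. -/
def SectionallyRegular (f : ℝ → ℂ) : Prop :=
  ∀ U : Set ℝ, IsOpen U → U.OrdConnected → U.Nonempty →
  ∀ α β : Fin (n + 1) → ℝ → ℂ,
    (∀ i, ContDiffOn ℝ ∞ (α i) (closure U) ∧ EqFunOn (E.a i) (α i) U) →
    (∀ i, ContDiffOn ℝ ∞ (β i) (closure U) ∧ EqFunOn (E.b i) (β i) U) →
  ∀ x₀ ∈ closure U, ∀ C : Fin n → ℂ,
    (∃ φ, IsIVPSolution (closure U) α β f x₀ C φ) ∧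
    ∀ φ₁ φ₂, IsIVPSolution (closure U) α β f x₀ C φ₁ → IsIVPSolution (closure U) α β f x₀ C φ₂ →
      Set.EqOn φ₁ φ₂ (closure U)

end Coeffs

/-- `∑_{i<n} δ⁽ⁱ⁾ zᵢ`. -/
noncomputable def deltaComb {n : ℕ} (z : Fin n → ℂ) : Dist := ∑ i : Fin n, z i • D^[i] dirac

end SingODE

namespace SingODE

open TopologicalSpace MeasureTheory Filter Topology
open scoped Distributions ContDiff LineDeriv

/-! Everything rests on which branch each factor of the product meets near `0`. In `F(x) · G(x + ε)`
a singularity of `G` at `0` sits at `-ε`. So a singularity of `F` at `0` meets the right-hand branch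
of `G`, and one of `G` at `0` meets the left-hand branch of `F`. Hence in `aᵢ * ψ⁽ⁱ⁾` the deltas of
`aᵢ` multiply `ψ₊⁽ⁱ⁾` and those of `ψ⁽ⁱ⁾` multiply `aᵢ₋`; in `ψ⁽ⁱ⁾ * bᵢ` the deltas of `bᵢ` multiply
`ψ₋⁽ⁱ⁾` and those of `ψ⁽ⁱ⁾` multiply `bᵢ₊`. This is made precise by closed formulas for the products
(`isStarProduct_of_left_singular`, `isStarProduct_of_right_singular`), which determine `star`
because the limit is unique (`IsStarProduct.star_eq`).

For `ψ = H₋ψ₋ + Hψ₊` with branches that solve (2), the function part of `Lψ` is `f`, and the rest is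
a combination of `δ⁽ʲ⁾` with `j < n` (`Coeffs.ev_L_glue`): derivatives of order at most `n` turn
jumps into such deltas only, and `M ≤ n` bounds the deltas in the coefficients
(`coeff_eq_zero_of_ord_le`). The coefficients of the combination involve derivatives of the branches
at `0` up to order `2n - 1`. Since both one-sided leading coefficients are nonzero at `0`, the
equations express those of order at least `n` linearly through the jets of length `n` of the branch
and of `f` (`exists_jet_recursion`). This yields `F`, `g` and the matrices
(`Coeffs.exists_interface`); independence of the `δ⁽ⁱ⁾` turns the vanishing of the combination into
the matrix condition.

Conversely, an element `ψ` of `𝒜` is near each point the `k`-th derivative of a function glued from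
two smooth ones, by Borel's lemma. If `ψ` is a solution, then near `0` the deltas of its derivatives
enter `Lψ` through the mixed coefficients `aᵢ₋ + bᵢ₊`, and all other terms have delta order below
`n`. A lowest nonzero jump, of order `m < k`, would produce `δ⁽ᵏ⁺ⁿ⁻¹⁻ᵐ⁾` with the nonzero factor
`aₙ₋(0) + bₙ₊(0)`, and nothing could cancel it (`jump_eq_zero`). So `ψ` has no deltas at `0`. At
other points the same comparison, now with a smooth right-hand side, shows that `ψ` is smooth
(`exists_agreeOn_smooth`). It needs a nonzero leading coefficient there, which sectional regularity
provides: at a zero, the equation would be a linear relation between freely prescribed initial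
values. -/

/-! ### Complex test functions and multiplication by smooth functions. -/

/-- Smooth and compactly supported complex-valued functions on the line. -/
def IsTest (w : ℝ → ℂ) : Prop := ContDiff ℝ ∞ w ∧ HasCompactSupport w

/-- The bundled test function with underlying function `w`. -/
def IsTest.toCTest {w : ℝ → ℂ} (h : IsTest w) : CTest := ⟨w, h.1, h.2, by simp⟩

theorem CTest.isTest (w : CTest) : IsTest w := ⟨w.contDiff, w.hasCompactSupport⟩

theorem Test.isTest (t : Test) : IsTest (fun x => (t x : ℂ)) :=
  ⟨Complex.ofRealCLM.contDiff.comp t.contDiff, t.hasCompactSupport.comp_left Complex.ofReal_zero⟩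

theorem IsTest.add {w z : ℝ → ℂ} (hw : IsTest w) (hz : IsTest z) : IsTest (fun x => w x + z x) :=
  ⟨hw.1.add hz.1, hw.2.add hz.2⟩

theorem IsTest.mul_left {w : ℝ → ℂ} (hw : IsTest w) {g : ℝ → ℂ} (hg : ContDiff ℝ ∞ g) :
    IsTest (fun x => g x * w x) := ⟨hg.mul hw.1, hw.2.mul_left⟩

theorem IsTest.const_mul {w : ℝ → ℂ} (hw : IsTest w) (c : ℂ) : IsTest (fun x => c * w x) :=
  hw.mul_left contDiff_const

theorem IsTest.deriv {w : ℝ → ℂ} (hw : IsTest w) : IsTest (deriv w) :=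
  ⟨(contDiff_infty_iff_deriv.1 hw.1).2, hw.2.deriv⟩

theorem IsTest.iteratedDeriv {w : ℝ → ℂ} (hw : IsTest w) (k : ℕ) :
    IsTest (iteratedDeriv k w) := by
  induction k with
  | zero => simpa using hw
  | succ k ih => rw [iteratedDeriv_succ]; exact ih.deriv

theorem IsTest.comp_sub_const {w : ℝ → ℂ} (hw : IsTest w) (c : ℝ) :
    IsTest (fun x => w (x - c)) :=
  ⟨hw.1.comp (contDiff_id.sub contDiff_const), hw.2.comp_homeomorph (Homeomorph.subRight c)⟩

theorem IsTest.integrable_mul {w : ℝ → ℂ} (hw : IsTest w) {g : ℝ → ℂ}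
    (hg : LocallyIntegrable g) : Integrable (fun x => w x * g x) := by
  simpa using hg.integrable_smul_left_of_hasCompactSupport hw.1.continuous hw.2

open Classical in
/-- The complex-linear extension of `F` as a function on all functions, zero off the test
functions. -/
noncomputable def ev (F : Dist) (w : ℝ → ℂ) : ℂ := if h : IsTest w then pair F h.toCTest else 0

theorem ev_eq_pair (F : Dist) {w : ℝ → ℂ} (h : IsTest w) : ev F w = pair F h.toCTest := dif_pos h

theorem ev_coe (F : Dist) (w : CTest) : ev F w = pair F w := ev_eq_pair F w.isTest

theorem pair_real (F : Dist) (t : Test) (w : CTest) (h : ∀ x, w x = t x) : pair F w = F t := by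
  have h1 : TestFunction.postcompCLM Complex.reCLM w = t := by
    ext x; simp [h]
  have h2 : TestFunction.postcompCLM Complex.imCLM w = (0 : Test) := by
    ext x; simp [h]
  simp [pair, h1, h2]

theorem ev_real (F : Dist) (t : Test) : ev F (fun x => (t x : ℂ)) = F t := by
  rw [ev_eq_pair F t.isTest]
  exact pair_real F t _ fun x => rfl

/-- Real part of a test function. -/
noncomputable def IsTest.re {w : ℝ → ℂ} (h : IsTest w) : Test :=
  TestFunction.postcompCLM Complex.reCLM h.toCTest

/-- Imaginary part of a test function. -/
noncomputable def IsTest.im {w : ℝ → ℂ} (h : IsTest w) : Test :=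
  TestFunction.postcompCLM Complex.imCLM h.toCTest

theorem IsTest.re_apply {w : ℝ → ℂ} (h : IsTest w) (x : ℝ) : h.re x = (w x).re := rfl

theorem IsTest.im_apply {w : ℝ → ℂ} (h : IsTest w) (x : ℝ) : h.im x = (w x).im := rfl

theorem ev_eq (F : Dist) {w : ℝ → ℂ} (h : IsTest w) :
    ev F w = F h.re + Complex.I * F h.im := ev_eq_pair F h

theorem IsTest.tsupport_re {w : ℝ → ℂ} (h : IsTest w) : tsupport h.re ⊆ tsupport w :=
  closure_mono fun x hx hw => hx (by simp [h.re_apply, hw])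

theorem IsTest.tsupport_im {w : ℝ → ℂ} (h : IsTest w) : tsupport h.im ⊆ tsupport w :=
  closure_mono fun x hx hw => hx (by simp [h.im_apply, hw])

theorem ev_add_right (F : Dist) {w z : ℝ → ℂ} (hw : IsTest w) (hz : IsTest z) :
    ev F (fun x => w x + z x) = ev F w + ev F z := by
  have h1 : (hw.add hz).re = hw.re + hz.re := by ext x; simp [IsTest.re_apply]
  have h2 : (hw.add hz).im = hw.im + hz.im := by ext x; simp [IsTest.im_apply]
  rw [ev_eq F (hw.add hz), ev_eq F hw, ev_eq F hz, h1, h2]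
  simp only [map_add]
  ring

theorem ev_const_mul (F : Dist) {w : ℝ → ℂ} (hw : IsTest w) (c : ℂ) :
    ev F (fun x => c * w x) = c * ev F w := by
  have h1 : (hw.const_mul c).re = c.re • hw.re - c.im • hw.im := by
    ext x; simp [IsTest.re_apply, IsTest.im_apply]
  have h2 : (hw.const_mul c).im = c.re • hw.im + c.im • hw.re := by
    ext x; simp [IsTest.re_apply, IsTest.im_apply]
  rw [ev_eq F (hw.const_mul c), ev_eq F hw, h1, h2]
  simp only [map_add, map_sub, map_smul, Complex.real_smul]
  have := Complex.I_mul_I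
  conv_rhs => rw [← Complex.re_add_im c]
  linear_combination (-(c.im : ℂ) * F hw.im) * this

theorem ev_add (F G : Dist) (w : ℝ → ℂ) : ev (F + G) w = ev F w + ev G w := by
  by_cases h : IsTest w
  · simp only [ev_eq _ h]
    change F _ + G _ + Complex.I * (F _ + G _) = _
    ring
  · simp [ev, h]

theorem ev_sub (F G : Dist) (w : ℝ → ℂ) : ev (F - G) w = ev F w - ev G w := by
  by_cases h : IsTest w
  · simp only [ev_eq _ h]
    change F _ - G _ + Complex.I * (F _ - G _) = _
    ring
  · simp [ev, h]

theorem ev_zero (w : ℝ → ℂ) : ev 0 w = 0 := by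
  have := ev_sub 0 0 w
  simpa using this

theorem ev_smul (z : ℂ) (F : Dist) (w : ℝ → ℂ) : ev (z • F) w = z * ev F w := by
  by_cases h : IsTest w
  · simp only [ev_eq _ h]
    change z * F _ + Complex.I * (z * F _) = _
    ring
  · simp [ev, h]

theorem ev_sum {ι : Type*} (s : Finset ι) (F : ι → Dist) (w : ℝ → ℂ) :
    ev (∑ i ∈ s, F i) w = ∑ i ∈ s, ev (F i) w := by
  classical
  induction s using Finset.induction_on with
  | empty => simp [ev_zero]
  | insert a s ha ih => simp [Finset.sum_insert ha, ev_add, ih]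

theorem dist_ext_ev {F G : Dist} (h : ∀ t : Test, ev F (fun x => (t x : ℂ)) = ev G fun x => t x) :
    F = G := by
  ext t
  simpa [ev_real] using h t

theorem lineDeriv_apply (t : Test) (x : ℝ) : (∂_{(1 : ℝ)} t : Test) x = deriv t x := by
  refine (TestFunction.lineDerivCLM_apply (𝕜 := ℝ) (f := t) (v := 1) (x := x)).trans ?_
  simp only [top_add, le_refl, if_true]
  simp [lineDeriv, deriv_comp_const_add]

theorem ev_D (F : Dist) {w : ℝ → ℂ} (hw : IsTest w) : ev (D F) w = -ev F (deriv w) := by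
  have hd : ∀ x, HasDerivAt w (deriv w x) x := fun x =>
    (hw.1.differentiable (by simp) x).hasDerivAt
  have h1 : ∂_{(1 : ℝ)} hw.re = hw.deriv.re := by
    ext x
    rw [lineDeriv_apply, IsTest.re_apply]
    exact ((Complex.reCLM.hasFDerivAt.comp_hasDerivAt x (hd x))).deriv
  have h2 : ∂_{(1 : ℝ)} hw.im = hw.deriv.im := by
    ext x
    rw [lineDeriv_apply, IsTest.im_apply]
    exact ((Complex.imCLM.hasFDerivAt.comp_hasDerivAt x (hd x))).deriv
  rw [ev_eq _ hw, ev_eq _ hw.deriv, D_apply, D_apply, h1, h2]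
  ring

theorem ev_D_iterate (F : Dist) {w : ℝ → ℂ} (hw : IsTest w) (k : ℕ) :
    ev (D^[k] F) w = (-1) ^ k * ev F (iteratedDeriv k w) := by
  induction k generalizing w with
  | zero => simp
  | succ k ih =>
    rw [Function.iterate_succ_apply', ev_D _ hw, ih hw.deriv, iteratedDeriv_succ', pow_succ]
    ring

theorem ev_regular {g : ℝ → ℂ} (hg : LocallyIntegrable g) {w : ℝ → ℂ} (hw : IsTest w) :
    ev (regular g) w = ∫ x, w x * g x := by
  rw [ev_eq _ hw, regular_apply hg, regular_apply hg, ← integral_const_mul, ← integral_add]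
  · refine integral_congr_ae (Eventually.of_forall fun x => ?_)
    simp only [IsTest.re_apply, IsTest.im_apply]
    conv_rhs => rw [← Complex.re_add_im (w x)]
    ring
  · exact (Test.isTest hw.re).integrable_mul hg
  · exact ((Test.isTest hw.im).integrable_mul hg).const_mul _

theorem ev_dirac {w : ℝ → ℂ} (hw : IsTest w) : ev dirac w = w 0 := by
  rw [ev_eq _ hw, dirac_apply, dirac_apply, IsTest.re_apply, IsTest.im_apply, mul_comm]
  exact Complex.re_add_im _

theorem ev_D_dirac {w : ℝ → ℂ} (hw : IsTest w) (k : ℕ) :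
    ev (D^[k] dirac) w = (-1) ^ k * iteratedDeriv k w 0 := by
  rw [ev_D_iterate _ hw, ev_dirac (hw.iteratedDeriv k)]

theorem ev_deltaSum (c : ℕ →₀ ℂ) {w : ℝ → ℂ} (hw : IsTest w) :
    ev (deltaSum c) w = c.sum fun k z => z * ((-1) ^ k * iteratedDeriv k w 0) := by
  simp only [deltaSum, Finsupp.sum, ev_sum, ev_smul, ev_D_dirac hw]

theorem ev_deltaComb {n : ℕ} (z : Fin n → ℂ) {w : ℝ → ℂ} (hw : IsTest w) :
    ev (deltaComb z) w = ∑ i : Fin n, z i * ((-1) ^ (i : ℕ) * iteratedDeriv i w 0) := by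
  simp only [deltaComb, ev_sum, ev_smul, ev_D_dirac hw]

theorem ev_translate (c : ℝ) (F : Dist) {w : ℝ → ℂ} (hw : IsTest w) :
    ev (translate c F) w = ev F fun x => w (x - c) := by
  rw [ev_eq _ hw, ev_eq _ (hw.comp_sub_const c), translate_apply, translate_apply]
  rfl

/-- Multiplication by a smooth function, from real to complex test functions. -/
noncomputable def mulTestCLM {g : ℝ → ℂ} (hg : ContDiff ℝ ∞ g) : Test →L[ℝ] CTest :=
  TestFunction.limitCLM ℝ
    (fun t : Test => ((Test.isTest t).mul_left hg).toCTest)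
    (fun K hK => TestFunction.ofSupportedInCLM ℝ (Ω := (⊤ : Opens ℝ)) hK ∘L
      ContDiffMapSupportedIn.bilinLeftCLM (ContinuousLinearMap.lsmul ℝ ℝ) hg)
    (fun K hK t => by
      ext x
      change g x * (t x : ℂ) = (t x) • g x
      rw [Complex.real_smul, mul_comm])

open Classical in
/-- The product of a distribution with a smooth function. -/
noncomputable def mul (g : ℝ → ℂ) (F : Dist) : Dist :=
  if hg : ContDiff ℝ ∞ g then
    ContinuousLinearMap.toUniformConvergenceCLM _ _ _
      ((F : Test →L[ℝ] ℂ) ∘L TestFunction.postcompCLM Complex.reCLM ∘L mulTestCLM hg +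
        Complex.I • ((F : Test →L[ℝ] ℂ) ∘L TestFunction.postcompCLM Complex.imCLM ∘L mulTestCLM hg))
  else 0

theorem mul_apply {g : ℝ → ℂ} (hg : ContDiff ℝ ∞ g) (F : Dist) (t : Test) :
    mul g F t = ev F fun x => g x * t x := by
  rw [mul, dif_pos hg, ev_eq_pair _ ((Test.isTest t).mul_left hg)]
  rfl

theorem ev_mul {g : ℝ → ℂ} (hg : ContDiff ℝ ∞ g) (F : Dist) {w : ℝ → ℂ} (hw : IsTest w) :
    ev (mul g F) w = ev F fun x => g x * w x := by
  rw [ev_eq _ hw, mul_apply hg, mul_apply hg, ← ev_const_mul _ ((Test.isTest hw.im).mul_left hg),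
    ← ev_add_right _ ((Test.isTest hw.re).mul_left hg)
      (((Test.isTest hw.im).mul_left hg).const_mul _)]
  congr 1
  ext x
  rw [IsTest.re_apply, IsTest.im_apply]
  conv_rhs => rw [← Complex.re_add_im (w x)]
  ring

/-! ### Localization of distributions. -/

-- The values are prescribed near the two sets and not only on them, so that products with `χ` or `1
-- - χ` have closed supports off `s` or off `t`.
open scoped Manifold in
theorem exists_cutoff {s t : Set ℝ} (hs : IsClosed s) (ht : IsClosed t) (hd : Disjoint s t) :
    ∃ χ : ℝ → ℂ, ContDiff ℝ ∞ χ ∧ (∀ x ∈ s, χ =ᶠ[𝓝 x] 0) ∧ ∀ x ∈ t, χ =ᶠ[𝓝 x] 1 := by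
  obtain ⟨f, h0, h1, -⟩ := exists_contMDiffMap_zero_one_nhds_of_isClosed 𝓘(ℝ) hs ht hd (n := ⊤)
  refine ⟨fun x => (f x : ℂ), Complex.ofRealCLM.contDiff.comp f.contMDiff.contDiff,
    fun x hx => ?_, fun x hx => ?_⟩
  · filter_upwards [(eventually_nhdsSet_iff_forall.1 h0) x hx] with y hy
    simp [hy]
  · filter_upwards [(eventually_nhdsSet_iff_forall.1 h1) x hx] with y hy
    simp [hy]

/-- `F` and `G` agree on the test functions with support in `U`. -/
def AgreeOn (F G : Dist) (U : Set ℝ) : Prop :=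
  ∀ w : ℝ → ℂ, IsTest w → tsupport w ⊆ U → ev F w = ev G w

theorem agreeOn_of_real {F G : Dist} {U : Set ℝ}
    (h : ∀ t : Test, tsupport t ⊆ U → F t = G t) : AgreeOn F G U := fun w hw hU => by
  rw [ev_eq _ hw, ev_eq _ hw, h _ (hw.tsupport_re.trans hU), h _ (hw.tsupport_im.trans hU)]

theorem Test.tsupport_ofReal (t : Test) : tsupport (fun x => (t x : ℂ)) = tsupport t := by
  unfold tsupport Function.support
  simp

theorem AgreeOn.real {F G : Dist} {U : Set ℝ} (h : AgreeOn F G U) (t : Test)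
    (ht : tsupport t ⊆ U) : F t = G t := by
  rw [← ev_real F, ← ev_real G]
  exact h _ t.isTest (by rwa [t.tsupport_ofReal])

theorem AgreeOn.mono {F G : Dist} {U V : Set ℝ} (h : AgreeOn F G V) (hU : U ⊆ V) :
    AgreeOn F G U := fun w hw hs => h w hw (hs.trans hU)

theorem AgreeOn.symm {F G : Dist} {U : Set ℝ} (h : AgreeOn F G U) : AgreeOn G F U :=
  fun w hw hs => (h w hw hs).symm

theorem AgreeOn.trans {F G H : Dist} {U : Set ℝ} (h : AgreeOn F G U) (h' : AgreeOn G H U) :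
    AgreeOn F H U := fun w hw hs => (h w hw hs).trans (h' w hw hs)

theorem AgreeOn.eq {F G : Dist} (h : AgreeOn F G Set.univ) : F = G :=
  dist_ext_ev fun t => h _ t.isTest (Set.subset_univ _)

theorem tsupport_deriv_subset {w : ℝ → ℂ} : tsupport (deriv w) ⊆ tsupport w :=
  closure_minimal (support_deriv_subset) isClosed_closure

theorem tsupport_iteratedDeriv_subset {w : ℝ → ℂ} (k : ℕ) :
    tsupport (iteratedDeriv k w) ⊆ tsupport w := by
  induction k with
  | zero => simp
  | succ k ih => rw [iteratedDeriv_succ]; exact tsupport_deriv_subset.trans ih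

theorem AgreeOn.D_iterate {F G : Dist} {U : Set ℝ} (h : AgreeOn F G U) (k : ℕ) :
    AgreeOn (D^[k] F) (D^[k] G) U := fun w hw hs => by
  rw [ev_D_iterate _ hw, ev_D_iterate _ hw,
    h _ (hw.iteratedDeriv k) ((tsupport_iteratedDeriv_subset k).trans hs)]

/-- A partition of unity: `χ` vanishes near the part of the support outside `U` and is `1` near the
part outside `V`, so `χ w` is supported in `U` and `(1 - χ) w` in `V`. -/
theorem AgreeOn.union {F G : Dist} {U V : Set ℝ} (hU : IsOpen U) (hV : IsOpen V)
    (h : AgreeOn F G U) (h' : AgreeOn F G V) : AgreeOn F G (U ∪ V) := fun w hw hs => by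
  obtain ⟨χ, hχ, h0, h1⟩ := exists_cutoff (s := tsupport w ∩ Uᶜ) (t := tsupport w ∩ Vᶜ)
    (isClosed_closure.inter hU.isClosed_compl) (isClosed_closure.inter hV.isClosed_compl)
    (Set.disjoint_left.2 fun x hx hx' => (hs hx.1).elim hx.2 hx'.2)
  have hχ' : ContDiff ℝ ∞ fun x => 1 - χ x := contDiff_const.sub hχ
  have e : w = fun x => χ x * w x + (1 - χ x) * w x := by ext x; ring
  have s1 : tsupport (fun x => χ x * w x) ⊆ U := fun x hx => by
    by_contra hxU
    refine notMem_tsupport_iff_eventuallyEq.2 ?_ hx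
    filter_upwards [h0 x ⟨tsupport_mul_subset_right hx, hxU⟩] with y hy
    simp [hy]
  have s2 : tsupport (fun x => (1 - χ x) * w x) ⊆ V := fun x hx => by
    by_contra hxU
    refine notMem_tsupport_iff_eventuallyEq.2 ?_ hx
    filter_upwards [h1 x ⟨tsupport_mul_subset_right hx, hxU⟩] with y hy
    simp [hy]
  rw [e, ev_add_right _ (hw.mul_left hχ) (hw.mul_left hχ'),
    ev_add_right _ (hw.mul_left hχ) (hw.mul_left hχ'), h _ (hw.mul_left hχ) s1,
    h' _ (hw.mul_left hχ') s2]

/-- Finitely many of the local sets cover the compact support of a test function, and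
`AgreeOn.union` merges them. -/
theorem agreeOn_of_local {F G : Dist} {U : Set ℝ}
    (h : ∀ x ∈ U, ∃ V, IsOpen V ∧ x ∈ V ∧ AgreeOn F G V) : AgreeOn F G U := fun w hw hs => by
  obtain ⟨V, -, hV, hFG⟩ : ∃ V, IsOpen V ∧ tsupport w ⊆ V ∧ AgreeOn F G V := by
    refine IsCompact.induction_on (p := fun s => ∃ V, IsOpen V ∧ s ⊆ V ∧ AgreeOn F G V) hw.2
      ⟨∅, isOpen_empty, le_rfl, fun w hw hs => ?_⟩
      (fun s t hst ⟨V, h1, h2, h3⟩ => ⟨V, h1, hst.trans h2, h3⟩)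
      (fun s t ⟨V, h1, h2, h3⟩ ⟨V', h1', h2', h3'⟩ =>
        ⟨V ∪ V', h1.union h1', Set.union_subset_union h2 h2', h3.union h1 h1' h3'⟩)
      (fun x hx => ?_)
    · have : w = fun x => 0 * w x := by
        ext x
        simpa using image_eq_zero_of_notMem_tsupport (fun hx => hs hx)
      rw [this, ev_const_mul _ hw, ev_const_mul _ hw]; simp
    · obtain ⟨V, h1, h2, h3⟩ := h x (hs hx)
      exact ⟨V, mem_nhdsWithin_of_mem_nhds (h1.mem_nhds h2), V, h1, le_rfl, h3⟩
  exact hFG w hw hV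

theorem IsTest.mul_left_of_contDiffOn {w : ℝ → ℂ} (hw : IsTest w) {g : ℝ → ℂ} {U : Set ℝ}
    (hU : IsOpen U) (hg : ContDiffOn ℝ ∞ g U) (hs : tsupport w ⊆ U) :
    IsTest (fun x => g x * w x) := by
  refine ⟨contDiff_iff_contDiffAt.2 fun x => ?_, hw.2.mul_left⟩
  by_cases hx : x ∈ tsupport w
  · exact (hg.contDiffAt (hU.mem_nhds (hs hx))).mul hw.1.contDiffAt
  · refine (contDiffAt_const (c := (0 : ℂ))).congr_of_eventuallyEq ?_
    filter_upwards [notMem_tsupport_iff_eventuallyEq.1 hx] with y hy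
    simp [hy]

theorem IsTest.integrable {w : ℝ → ℂ} (hw : IsTest w) : Integrable w :=
  hw.1.continuous.integrable_of_hasCompactSupport hw.2

theorem EqFunOn.ev_eq {F : Dist} {g : ℝ → ℂ} {U : Set ℝ} (h : EqFunOn F g U) (hU : IsOpen U)
    (hg : ContDiffOn ℝ ∞ g U) {w : ℝ → ℂ} (hw : IsTest w) (hs : tsupport w ⊆ U) :
    ev F w = ∫ x, g x * w x := by
  have s1 := hw.tsupport_re.trans hs
  have s2 := hw.tsupport_im.trans hs
  rw [SingODE.ev_eq _ hw, h _ s1, h _ s2, ← integral_const_mul, ← integral_add]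
  · refine integral_congr_ae (Eventually.of_forall fun x => ?_)
    simp only [IsTest.re_apply, IsTest.im_apply]
    conv_rhs => rw [← Complex.re_add_im (w x)]
    ring
  · simpa [mul_comm] using ((Test.isTest hw.re).mul_left_of_contDiffOn hU hg
      (by rwa [Test.tsupport_ofReal])).integrable
  · simpa [mul_comm] using (((Test.isTest hw.im).mul_left_of_contDiffOn hU hg
      (by rwa [Test.tsupport_ofReal])).integrable).const_mul Complex.I

theorem eqFunOn_iff_agreeOn {F : Dist} {g : ℝ → ℂ} (hg : LocallyIntegrable g) {U : Set ℝ} :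
    EqFunOn F g U ↔ AgreeOn F (regular g) U := by
  constructor
  · exact fun h => agreeOn_of_real fun t ht => by rw [regular_apply hg, h t ht]
  · exact fun h t ht => by rw [h.real t ht, regular_apply hg]

/-- The fundamental lemma of the calculus of variations gives equality almost everywhere on `U`, and
continuity removes the null set. -/
theorem eqOn_of_eqFunOn {F : Dist} {g g' : ℝ → ℂ} {U : Set ℝ} (hU : IsOpen U)
    (h : EqFunOn F g U) (h' : EqFunOn F g' U) (hg : ContinuousOn g U) (hg' : ContinuousOn g' U) :
    Set.EqOn g g' U := by
  have hi : ∀ f : ℝ → ℂ, ContinuousOn f U → ∀ t : ℝ → ℝ, ContDiff ℝ ∞ t → HasCompactSupport t →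
      tsupport t ⊆ U → Integrable fun x => (t x : ℂ) * f x := by
    intro f hf t ht hc hs
    refine Continuous.integrable_of_hasCompactSupport (continuous_iff_continuousAt.2 fun x => ?_) ?_
    · by_cases hx : x ∈ tsupport t
      · exact (Complex.continuous_ofReal.comp ht.continuous).continuousAt.mul
          (hf.continuousAt (hU.mem_nhds (hs hx)))
      · refine (continuousAt_const (y := (0 : ℂ))).congr ?_
        filter_upwards [notMem_tsupport_iff_eventuallyEq.1 hx] with y hy
        simp [hy]
    · exact (hc.comp_left Complex.ofReal_zero).mul_right
  have key := hU.ae_eq_zero_of_integral_contDiff_smul_eq_zero (f := fun x => g x - g' x)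
    (μ := volume) ((hg.sub hg').locallyIntegrableOn hU.measurableSet) (fun t ht hc hs => by
      have a := h ⟨t, ht, hc, by simp⟩ hs
      have b := h' ⟨t, ht, hc, by simp⟩ hs
      have : ∫ x, (t x : ℂ) * g x = ∫ x, (t x : ℂ) * g' x := a.symm.trans b
      simp only [Complex.real_smul, mul_sub]
      rw [integral_sub (hi g hg t ht hc hs) (hi g' hg' t ht hc hs), this, sub_self])
  have := Measure.eqOn_open_of_ae_eq (μ := volume) (f := g) (g := g') (U := U)
    ((ae_restrict_iff' hU.measurableSet).2 (key.mono fun x hx hxU => sub_eq_zero.1 (hx hxU)))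
    hU hg hg'
  exact this

/-! ### Uniqueness of the Hörmander product and of its limit. -/

theorem IsDualProductOn.ev_eq {F P : Dist} {g : ℝ → ℂ} {U : Set ℝ} (h : IsDualProductOn F g P U)
    (hU : IsOpen U) (hg : ContDiffOn ℝ ∞ g U) {w : ℝ → ℂ} (hw : IsTest w) (hs : tsupport w ⊆ U) :
    ev P w = ev F fun x => g x * w x := by
  have key : ∀ t : Test, tsupport t ⊆ U → P t = ev F fun x => g x * t x := fun t ht => by
    have := t.isTest.mul_left_of_contDiffOn hU hg (by rwa [Test.tsupport_ofReal])
    rw [SingODE.ev_eq_pair _ this]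
    exact h t ht _ fun x => rfl
  have s1 := hw.tsupport_re.trans hs
  have s2 := hw.tsupport_im.trans hs
  have t1 := (Test.isTest hw.re).mul_left_of_contDiffOn hU hg (by rwa [Test.tsupport_ofReal])
  have t2 := (Test.isTest hw.im).mul_left_of_contDiffOn hU hg (by rwa [Test.tsupport_ofReal])
  rw [SingODE.ev_eq _ hw, key _ s1, key _ s2, ← ev_const_mul _ t2,
    ← ev_add_right _ t1 (t2.const_mul _)]
  congr 1
  ext x
  rw [IsTest.re_apply, IsTest.im_apply]
  conv_rhs => rw [← Complex.re_add_im (w x)]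
  ring

theorem isDualProductOn_of_ev {F P : Dist} {g : ℝ → ℂ} {U : Set ℝ}
    (h : ∀ w, IsTest w → tsupport w ⊆ U → ev P w = ev F fun x => g x * w x) :
    IsDualProductOn F g P U := fun t ht w hw => by
  rw [← ev_real, h _ t.isTest (by rwa [Test.tsupport_ofReal]), ← ev_coe]
  congr 1
  ext x
  exact (hw x).symm

theorem tsupport_mul_subset_of {g w : ℝ → ℂ} {U : Set ℝ} (h : tsupport w ⊆ U) :
    tsupport (fun x => g x * w x) ⊆ U := tsupport_mul_subset_right.trans h

/-- The definition leaves open which factor is the smooth one near a point. If both products use the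
same factor, its smooth representatives coincide; if not, both factors are functions there and both
products are integration against `g g'`. -/
theorem IsHormanderProduct.unique {F G P P' : Dist} (h : IsHormanderProduct F G P)
    (h' : IsHormanderProduct F G P') : P = P' := by
  refine AgreeOn.eq (agreeOn_of_local fun x _ => ?_)
  obtain ⟨U, hU, hxU, g, hg, H⟩ := h x
  obtain ⟨U', hU', hxU', g', hg', H'⟩ := h' x
  refine ⟨U ∩ U', hU.inter hU', ⟨hxU, hxU'⟩, fun w hw hs => ?_⟩
  have s1 := hs.trans Set.inter_subset_left
  have s2 := hs.trans Set.inter_subset_right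
  have m1 := hw.mul_left_of_contDiffOn hU hg s1
  have m2 := hw.mul_left_of_contDiffOn hU' hg' s2
  have same : ∀ F : Dist, EqFunOn F g U → EqFunOn F g' U' →
      (fun x => g x * w x) = fun x => g' x * w x := fun F e e' => by
    have := eqOn_of_eqFunOn (hU.inter hU') (fun t ht => e t (ht.trans Set.inter_subset_left))
      (fun t ht => e' t (ht.trans Set.inter_subset_right))
      (hg.continuousOn.mono Set.inter_subset_left) (hg'.continuousOn.mono Set.inter_subset_right)
    ext x
    by_cases hx : x ∈ tsupport w
    · rw [this (hs hx)]
    · simp [image_eq_zero_of_notMem_tsupport hx]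
  rcases H with ⟨e, d⟩ | ⟨e, d⟩ <;> rcases H' with ⟨e', d'⟩ | ⟨e', d'⟩ <;>
    rw [d.ev_eq hU hg hw s1, d'.ev_eq hU' hg' hw s2]
  · rw [same G e e']
  · rw [e'.ev_eq hU' hg' m1 (tsupport_mul_subset_of s2), e.ev_eq hU hg m2 (tsupport_mul_subset_of s1)]
    congr 1; ext x; ring
  · rw [e.ev_eq hU hg m2 (tsupport_mul_subset_of s1), e'.ev_eq hU' hg' m1 (tsupport_mul_subset_of s2)]
    congr 1; ext x; ring
  · rw [same F e e']

theorem IsStarProduct.unique {F G P P' : Dist} (h : IsStarProduct F G P)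
    (h' : IsStarProduct F G P') : P = P' := by
  obtain ⟨Q, hQ, hP⟩ := h
  obtain ⟨Q', hQ', hP'⟩ := h'
  ext t
  refine tendsto_nhds_unique ((hP t).congr' ?_) (hP' t)
  filter_upwards [hQ, hQ'] with ε a b
  rw [a.unique b]

theorem IsStarProduct.star_eq {F G P : Dist} (h : IsStarProduct F G P) : star F G = P := by
  have : ∃ P, IsStarProduct F G P := ⟨P, h⟩
  rw [star, dif_pos this]
  exact this.choose_spec.unique h

theorem IsHormanderProduct.symm {F G P : Dist} (h : IsHormanderProduct F G P) :
    IsHormanderProduct G F P := fun x => by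
  obtain ⟨U, hU, hx, g, hg, H⟩ := h x
  exact ⟨U, hU, hx, g, hg, H.symm⟩

/-! ### Closed formulas for the products. -/

theorem locallyIntegrable_of_contDiff {g : ℝ → ℂ} (hg : ContDiff ℝ ∞ g) : LocallyIntegrable g :=
  hg.continuous.locallyIntegrable

/-- On `U₁`, `F = f₁` cancels the last two terms and `G₂ = 0`, which leaves `f₁ G₁`. On `U₂`, `f₁
G₁` cancels against `g f₁`, which leaves `f₂ (G₁ + G₂)`. On `U₃` only `g F` survives. A formula
without a partition allows a limit term by term. -/
theorem isHormanderProduct_of_cover {F G₁ G₂ : Dist} {f₁ f₂ g : ℝ → ℂ} (hf₁ : ContDiff ℝ ∞ f₁)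
    (hf₂ : ContDiff ℝ ∞ f₂) (hg : ContDiff ℝ ∞ g) {U₁ U₂ U₃ : Set ℝ} (h₁ : IsOpen U₁)
    (h₂ : IsOpen U₂) (h₃ : IsOpen U₃) (hU : ∀ x, x ∈ U₁ ∨ x ∈ U₂ ∨ x ∈ U₃)
    (hF₁ : AgreeOn F (regular f₁) U₁) (hF₂ : AgreeOn F (regular f₂) U₂)
    (hG₁ : AgreeOn G₁ (regular g) (U₂ ∪ U₃)) (hG₂ : AgreeOn G₂ 0 (U₁ ∪ U₃)) :
    IsHormanderProduct F (G₁ + G₂)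
      (mul f₁ G₁ + mul f₂ G₂ + mul g F - mul g (regular f₁)) := fun x => by
  have i₁ := locallyIntegrable_of_contDiff hf₁
  have i₂ := locallyIntegrable_of_contDiff hf₂
  have ig := locallyIntegrable_of_contDiff hg
  have ev_P : ∀ w, IsTest w →
      ev (mul f₁ G₁ + mul f₂ G₂ + mul g F - mul g (regular f₁)) w =
        ev G₁ (fun x => f₁ x * w x) + ev G₂ (fun x => f₂ x * w x) + ev F (fun x => g x * w x)
          - ev (regular f₁) (fun x => g x * w x) := fun w hw => by
    rw [ev_sub, ev_add, ev_add, ev_mul hf₁ _ hw, ev_mul hf₂ _ hw, ev_mul hg _ hw, ev_mul hg _ hw]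
  rcases hU x with hx | hx | hx
  · refine ⟨U₁, h₁, hx, f₁, hf₁.contDiffOn, Or.inr ⟨(eqFunOn_iff_agreeOn i₁).2 hF₁,
      isDualProductOn_of_ev fun w hw hs => ?_⟩⟩
    rw [ev_P w hw, hF₁ _ (hw.mul_left hg) (tsupport_mul_subset_of hs), ev_add,
      hG₂ _ (hw.mul_left hf₂) ((tsupport_mul_subset_of hs).trans Set.subset_union_left),
      hG₂ _ (hw.mul_left hf₁) ((tsupport_mul_subset_of hs).trans Set.subset_union_left),
      ev_zero, ev_zero]
    ring
  · refine ⟨U₂, h₂, hx, f₂, hf₂.contDiffOn, Or.inr ⟨(eqFunOn_iff_agreeOn i₂).2 hF₂,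
      isDualProductOn_of_ev fun w hw hs => ?_⟩⟩
    have hs' := hs.trans (Set.subset_union_left (t := U₃))
    rw [ev_P w hw, hF₂ _ (hw.mul_left hg) (tsupport_mul_subset_of hs), ev_add,
      hG₁ _ (hw.mul_left hf₁) (tsupport_mul_subset_of hs'),
      hG₁ _ (hw.mul_left hf₂) (tsupport_mul_subset_of hs'), ev_regular i₁ (hw.mul_left hg),
      ev_regular ig (hw.mul_left hf₁), ev_regular ig (hw.mul_left hf₂),
      ev_regular i₂ (hw.mul_left hg)]
    have e : ∀ f : ℝ → ℂ, ∫ x, g x * w x * f x = ∫ x, f x * w x * g x := fun f => by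
      congr 1; ext x; ring
    rw [e, e]; ring
  · refine ⟨U₃, h₃, hx, g, hg.contDiffOn, Or.inl ⟨(eqFunOn_iff_agreeOn ig).2 fun w hw hs => ?_,
      isDualProductOn_of_ev fun w hw hs => ?_⟩⟩
    · have hs₁ := hs.trans (Set.subset_union_right (s := U₁))
      have hs₂ := hs.trans (Set.subset_union_right (s := U₂))
      rw [ev_add, hG₁ _ hw hs₂, hG₂ _ hw hs₁, ev_zero, add_zero]
    · have hs₁ := hs.trans (Set.subset_union_right (s := U₁))
      have hs₂ := hs.trans (Set.subset_union_right (s := U₂))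
      rw [ev_P w hw, hG₁ _ (hw.mul_left hf₁) (tsupport_mul_subset_of hs₂),
        hG₂ _ (hw.mul_left hf₂) (tsupport_mul_subset_of hs₁), ev_zero,
        ev_regular i₁ (hw.mul_left hg), ev_regular ig (hw.mul_left hf₁)]
      have e : ∀ f : ℝ → ℂ, ∫ x, g x * w x * f x = ∫ x, f x * w x * g x := fun f => by
        congr 1; ext x; ring
      rw [e]; ring

/-- The iterated partial derivatives in the second variable of a smooth function are smooth. -/
theorem exists_contDiff_iteratedDeriv_snd {W : ℝ × ℝ → ℝ} (hW : ContDiff ℝ ∞ W) (i : ℕ) :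
    ∃ V : ℝ × ℝ → ℝ, ContDiff ℝ ∞ V ∧ ∀ ε x, iteratedDeriv i (fun y => W (ε, y)) x = V (ε, x) := by
  induction i with
  | zero => exact ⟨W, hW, fun ε x => by simp⟩
  | succ i ih =>
    obtain ⟨V, hV, h⟩ := ih
    refine ⟨fun p => fderiv ℝ V p (0, 1), (hV.fderiv_right (m := ∞) (by simp)).clm_apply
      contDiff_const, fun ε x => ?_⟩
    have : iteratedDeriv i (fun y => W (ε, y)) = fun y => V (ε, y) := funext fun y => h ε y
    rw [iteratedDeriv_succ, this]
    have h1 : HasDerivAt (fun y : ℝ => (ε, y)) ((0 : ℝ), (1 : ℝ)) x :=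
      (hasDerivAt_const x ε).prodMk (hasDerivAt_id x)
    exact ((hV.differentiable (by simp) (ε, x)).hasFDerivAt.comp_hasDerivAt x h1).deriv

/-- Joint smoothness makes every derivative in `x` converge uniformly on `K`; with the common
compact support this is convergence of test functions. -/
theorem tendsto_apply_of_contDiff (F : Dist) {W : ℝ × ℝ → ℝ} (hW : ContDiff ℝ ∞ W) {K : Set ℝ}
    (hK : IsCompact K) (hWK : ∀ᶠ ε in 𝓝 (0 : ℝ), ∀ x ∉ K, W (ε, x) = 0) {T : ℝ → Test}
    (hT : ∀ᶠ ε in 𝓝 (0 : ℝ), ∀ x, T ε x = W (ε, x)) :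
    Tendsto (fun ε => F (T ε)) (𝓝 0) (𝓝 (F (T 0))) := by
  classical
  let K' : Compacts ℝ := ⟨K, hK⟩
  have hs : ∀ ε, ContDiff ℝ ∞ fun x => W (ε, x) := fun ε =>
    hW.comp (contDiff_const.prodMk contDiff_id)
  -- Only for `ε` near `0` is the slice known to vanish off `K`; the default `0` elsewhere does not
  -- affect the limit.
  let S : ℝ → ContDiffMapSupportedIn ℝ ℝ ⊤ K' := fun ε =>
    if h : ∀ x ∉ K, W (ε, x) = 0 then ⟨fun x => W (ε, x), hs ε, fun x hx => h x hx⟩ else 0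
  have hS : ∀ᶠ ε in 𝓝 (0 : ℝ), ⇑(S ε) = fun x => W (ε, x) := by
    filter_upwards [hWK] with ε h
    simp only [S, dif_pos h]
    rfl
  have hK' : (K' : Set ℝ) ⊆ (⊤ : Opens ℝ) := by simp
  have hTS : ∀ᶠ ε in 𝓝 (0 : ℝ), T ε = TestFunction.ofSupportedIn hK' (S ε) := by
    filter_upwards [hS, hT] with ε h1 h2
    ext x
    rw [h2]
    exact (congrFun h1 x).symm
  have hlim : Tendsto S (𝓝 0) (𝓝 (S 0)) := by
    rw [(ContDiffMapSupportedIn.withSeminorms ℝ ℝ ℝ ⊤ K').tendsto_nhds]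
    intro i r hr
    obtain ⟨V, hV, hVi⟩ := exists_contDiff_iteratedDeriv_snd hW i
    have hev : ∀ᶠ ε in 𝓝 (0 : ℝ), ∀ x ∈ K, ‖V (ε, x) - V (0, x)‖ < r / 2 := by
      refine hK.eventually_forall_of_forall_eventually fun x _ => ?_
      have hc : Continuous fun p : ℝ × ℝ => ‖V (p.1, p.2) - V (0, p.2)‖ :=
        ((hV.continuous.comp (continuous_fst.prodMk continuous_snd)).sub
          (hV.continuous.comp (continuous_const.prodMk continuous_snd))).norm
      exact hc.continuousAt.eventually_lt continuousAt_const (by simpa using half_pos hr)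
    filter_upwards [hS, hev] with ε h1 h2
    refine lt_of_le_of_lt ((ContDiffMapSupportedIn.seminorm_top_le_iff ℝ (half_pos hr).le i _).2
      fun x hx => ?_) (half_lt_self hr)
    rw [norm_iteratedFDeriv_eq_norm_iteratedDeriv]
    have e : ⇑(S ε - S 0) = (fun x => W (ε, x)) - fun x => W (0, x) := by
      rw [← h1, ← hS.self_of_nhds]; rfl
    rw [e, iteratedDeriv_sub ((hs ε).contDiffAt.of_le (mod_cast le_top))
      ((hs 0).contDiffAt.of_le (mod_cast le_top)), hVi, hVi]
    exact (h2 x hx).le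
  have hc : Continuous fun s : ContDiffMapSupportedIn ℝ ℝ ⊤ K' => F (TestFunction.ofSupportedIn hK' s) :=
    (F : Test →L[ℝ] ℂ).continuous.comp (TestFunction.continuous_ofSupportedIn hK')
  rw [hTS.self_of_nhds]
  refine ((hc.tendsto _).comp hlim).congr' ?_
  filter_upwards [hTS] with ε h
  rw [h]
  rfl

theorem tendsto_ev_of_contDiff (F : Dist) {W : ℝ × ℝ → ℂ} (hW : ContDiff ℝ ∞ W) {K : Set ℝ}
    (hK : IsCompact K) (hWK : ∀ᶠ ε in 𝓝 (0 : ℝ), ∀ x ∉ K, W (ε, x) = 0) :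
    Tendsto (fun ε => ev F fun x => W (ε, x)) (𝓝 0) (𝓝 (ev F fun x => W (0, x))) := by
  classical
  have hs : ∀ ε, ContDiff ℝ ∞ fun x => W (ε, x) := fun ε =>
    hW.comp (contDiff_const.prodMk contDiff_id)
  have ht : ∀ᶠ ε in 𝓝 (0 : ℝ), IsTest fun x => W (ε, x) := by
    filter_upwards [hWK] with ε h
    exact ⟨hs ε, HasCompactSupport.intro hK h⟩
  let R : ℝ → Test := fun ε => if h : IsTest fun x => W (ε, x) then h.re else 0
  let J : ℝ → Test := fun ε => if h : IsTest fun x => W (ε, x) then h.im else 0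
  have h1 := tendsto_apply_of_contDiff F (W := fun p => (W p).re) (T := R)
    (Complex.reCLM.contDiff.comp hW) hK (hWK.mono fun ε h x hx => by simp [h x hx])
    (ht.mono fun ε h x => by simp only [R, dif_pos h]; rfl)
  have h2 := tendsto_apply_of_contDiff F (W := fun p => (W p).im) (T := J)
    (Complex.imCLM.contDiff.comp hW) hK (hWK.mono fun ε h x hx => by simp [h x hx])
    (ht.mono fun ε h x => by simp only [J, dif_pos h]; rfl)
  have e : ∀ ε, IsTest (fun x => W (ε, x)) →
      F (R ε) + Complex.I * F (J ε) = ev F fun x => W (ε, x) := fun ε h => by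
    rw [ev_eq _ h]; simp only [R, J, dif_pos h]
  rw [← e 0 ht.self_of_nhds]
  exact (h1.add (h2.const_mul _)).congr' (ht.mono fun ε h => e ε h)

theorem eventually_shift_support {t : ℝ → ℂ} (ht : HasCompactSupport t) :
    ∃ K : Set ℝ, IsCompact K ∧ ∀ᶠ ε in 𝓝 (0 : ℝ), ∀ x ∉ K, t (x - ε) = 0 := by
  refine ⟨Metric.cthickening 1 (tsupport t), ht.isCompact.cthickening, ?_⟩
  filter_upwards [Metric.ball_mem_nhds (0 : ℝ) one_pos] with ε hε x hx
  by_contra h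
  refine hx (Metric.mem_cthickening_of_dist_le x (x - ε) 1 _ (subset_tsupport t h) ?_)
  rw [Metric.mem_ball, dist_zero_right] at hε
  rw [Real.dist_eq]
  simpa using hε.le

theorem tendsto_ev_mul_translate {f : ℝ → ℂ} (hf : ContDiff ℝ ∞ f) (G : Dist) {w : ℝ → ℂ}
    (hw : IsTest w) :
    Tendsto (fun ε => ev (mul f (translate ε G)) w) (𝓝 0) (𝓝 (ev (mul f G) w)) := by
  obtain ⟨K, hK, h⟩ := eventually_shift_support hw.2
  have hc : ContDiff ℝ ∞ fun p : ℝ × ℝ => p.2 - p.1 := contDiff_snd.sub contDiff_fst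
  have := tendsto_ev_of_contDiff G (W := fun p => f (p.2 - p.1) * w (p.2 - p.1))
    ((hf.comp hc).mul (hw.1.comp hc)) hK (h.mono fun ε h x hx => by simp [h x hx])
  simpa [ev_mul hf _ hw, ev_translate _ _ (hw.mul_left hf)] using this

theorem tendsto_ev_mul_shift {g : ℝ → ℂ} (hg : ContDiff ℝ ∞ g) (F : Dist) {w : ℝ → ℂ}
    (hw : IsTest w) :
    Tendsto (fun ε => ev (mul (fun x => g (x + ε)) F) w) (𝓝 0) (𝓝 (ev (mul g F) w)) := by
  have := tendsto_ev_of_contDiff F (W := fun p => g (p.2 + p.1) * w p.2)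
    ((hg.comp (contDiff_snd.add contDiff_fst)).mul (hw.1.comp contDiff_snd)) hw.2
    (Eventually.of_forall fun ε x hx => by simp [image_eq_zero_of_notMem_tsupport hx])
  have e : ∀ ε, ev (mul (fun x => g (x + ε)) F) w = ev F fun x => g (x + ε) * w x := fun ε =>
    ev_mul (hg.comp (contDiff_id.add contDiff_const)) _ hw
  simpa [ev_mul hg _ hw, e] using this

theorem AgreeOn.translate {F G : Dist} {U : Set ℝ} (h : AgreeOn F G U) (c : ℝ) :
    AgreeOn (translate c F) (translate c G) {x | x + c ∈ U} := fun w hw hs => by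
  rw [ev_translate _ _ hw, ev_translate _ _ hw]
  refine h _ (hw.comp_sub_const c) fun x hx => ?_
  have : tsupport (fun x => w (x - c)) = (fun x => x - c) ⁻¹' tsupport w :=
    tsupport_comp_eq_preimage w (Homeomorph.subRight c)
  rw [this] at hx
  simpa using hs hx

theorem translate_add (c : ℝ) (F G : Dist) :
    translate c (F + G) = translate c F + translate c G := rfl

theorem translate_zero (c : ℝ) : translate c 0 = 0 := rfl

theorem translate_regular (c : ℝ) {g : ℝ → ℂ} (hg : ContDiff ℝ ∞ g) :
    translate c (regular g) = regular fun x => g (x + c) := by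
  refine dist_ext_ev fun t => ?_
  have hg' : ContDiff ℝ ∞ fun x => g (x + c) := hg.comp (contDiff_id.add contDiff_const)
  rw [ev_translate _ _ t.isTest, ev_regular (locallyIntegrable_of_contDiff hg)
    (t.isTest.comp_sub_const c), ev_regular (locallyIntegrable_of_contDiff hg') t.isTest,
    ← integral_add_right_eq_self _ c]
  simp

/-- For use with a coefficient `F` and a derivative `G₁ + G₂` of the unknown. `G₂` carries the
singularities at a distance to the right of `0`, which meet `f₂`; those of `G₁`, at `0` and to its
left, meet `f₁`. -/
theorem isStarProduct_of_left_singular {F G₁ G₂ : Dist} {f₁ f₂ g : ℝ → ℂ}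
    (hf₁ : ContDiff ℝ ∞ f₁) (hf₂ : ContDiff ℝ ∞ f₂) (hg : ContDiff ℝ ∞ g) {δ : ℝ} (hδ : 0 < δ)
    (hF₁ : AgreeOn F (regular f₁) (Set.Iio 0)) (hF₂ : AgreeOn F (regular f₂) (Set.Ioi 0))
    (hG₁ : AgreeOn G₁ (regular g) (Set.Ioi 0)) (hG₂ : AgreeOn G₂ 0 (Set.Iio δ)) :
    IsStarProduct F (G₁ + G₂)
      (mul f₁ G₁ + mul f₂ G₂ + mul g F - mul g (regular f₁)) := by
  refine ⟨fun ε => mul f₁ (translate ε G₁) + mul f₂ (translate ε G₂) +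
    mul (fun x => g (x + ε)) F - mul (fun x => g (x + ε)) (regular f₁), ?_, fun t => ?_⟩
  · filter_upwards [Ioo_mem_nhdsGT hδ] with ε hε
    have a₁ := hG₁.translate ε
    rw [translate_regular ε hg] at a₁
    have a₂ := hG₂.translate ε
    rw [translate_zero] at a₂
    have hg' : ContDiff ℝ ∞ fun x => g (x + ε) := hg.comp (contDiff_id.add contDiff_const)
    rw [translate_add]
    -- For `0 < ε < δ` the third set contains `0`, where `F` may be singular, and on it the
    -- translates of `G₁` and `G₂` are already `g (x + ε)` and `0`.
    refine isHormanderProduct_of_cover hf₁ hf₂ hg' isOpen_Iio isOpen_Ioi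
      (isOpen_Ioo (a := -ε) (b := δ - ε)) (fun x => ?_) hF₁ hF₂ (a₁.mono ?_) (a₂.mono ?_)
    · rcases lt_trichotomy x 0 with h | h | h
      · exact Or.inl h
      · exact Or.inr (Or.inr ⟨by linarith [hε.1], by linarith [hε.2]⟩)
      · exact Or.inr (Or.inl h)
    · rintro x (hx | hx)
      · have : 0 < x := hx
        change 0 < x + ε
        linarith [hε.1]
      · change 0 < x + ε
        linarith [hx.1]
    · rintro x (hx | hx)
      · have : x < 0 := hx
        change x + ε < δ
        linarith [hε.2]
      · change x + ε < δ
        linarith [hx.2]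
  · simp only [← ev_real _ t, ev_add, ev_sub]
    exact ((((tendsto_ev_mul_translate hf₁ G₁ t.isTest).add
      (tendsto_ev_mul_translate hf₂ G₂ t.isTest)).add (tendsto_ev_mul_shift hg F t.isTest)).sub
      (tendsto_ev_mul_shift hg (regular f₁) t.isTest)).mono_left nhdsWithin_le_nhds

/-- The same cover with the factors exchanged: the translate of `G` is singular at `-ε`, where `F₁`
is still `f`, while the singularities of `F₁` at `0` and to its right meet `g₁`. `F₂` carries those
at a distance to the left of `0`, which meet `g₂`. -/
theorem isStarProduct_of_right_singular {F₁ F₂ G : Dist} {f g₁ g₂ : ℝ → ℂ}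
    (hf : ContDiff ℝ ∞ f) (hg₁ : ContDiff ℝ ∞ g₁) (hg₂ : ContDiff ℝ ∞ g₂) {δ : ℝ} (hδ : 0 < δ)
    (hF₁ : AgreeOn F₁ (regular f) (Set.Iio 0)) (hF₂ : AgreeOn F₂ 0 (Set.Ioi (-δ)))
    (hG₁ : AgreeOn G (regular g₁) (Set.Ioi 0)) (hG₂ : AgreeOn G (regular g₂) (Set.Iio 0)) :
    IsStarProduct (F₁ + F₂) G
      (mul g₁ F₁ + mul g₂ F₂ + mul f G - mul f (regular g₁)) := by
  refine ⟨fun ε => mul (fun x => g₁ (x + ε)) F₁ + mul (fun x => g₂ (x + ε)) F₂ +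
    mul f (translate ε G) - mul f (translate ε (regular g₁)), ?_, fun t => ?_⟩
  · filter_upwards [Ioo_mem_nhdsGT hδ] with ε hε
    have a₁ := hG₁.translate ε
    have a₂ := hG₂.translate ε
    rw [translate_regular ε hg₁] at a₁ ⊢
    rw [translate_regular ε hg₂] at a₂
    have hg₁' : ContDiff ℝ ∞ fun x => g₁ (x + ε) := hg₁.comp (contDiff_id.add contDiff_const)
    have hg₂' : ContDiff ℝ ∞ fun x => g₂ (x + ε) := hg₂.comp (contDiff_id.add contDiff_const)
    refine (isHormanderProduct_of_cover hg₁' hg₂' hf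
      (isOpen_Ioi.preimage (continuous_id.add continuous_const))
      (isOpen_Iio.preimage (continuous_id.add continuous_const))
      (isOpen_Ioo (a := -δ) (b := 0)) (fun x => ?_) a₁ a₂ (hF₁.mono ?_) (hF₂.mono ?_)).symm
    · rcases lt_trichotomy 0 (x + ε) with h | h | h
      · exact Or.inl h
      · exact Or.inr (Or.inr ⟨by linarith [hε.2], by linarith [hε.1]⟩)
      · exact Or.inr (Or.inl h)
    · rintro x (hx | hx)
      · have : x + ε < 0 := hx
        change x < 0
        linarith [hε.1]
      · exact hx.2
    · rintro x (hx | hx)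
      · have : 0 < x + ε := hx
        change -δ < x
        linarith [hε.2]
      · exact hx.1
  · simp only [← ev_real _ t, ev_add, ev_sub]
    exact ((((tendsto_ev_mul_shift hg₁ F₁ t.isTest).add
      (tendsto_ev_mul_shift hg₂ F₂ t.isTest)).add (tendsto_ev_mul_translate hf G t.isTest)).sub
      (tendsto_ev_mul_translate hf (regular g₁) t.isTest)).mono_left nhdsWithin_le_nhds

/-! ### Borel's lemma and smooth extension of one-sided branches. -/

theorem iteratedDeriv_ofReal_pow_zero (k j : ℕ) :
    iteratedDeriv j (fun x : ℝ => ((x ^ k : ℝ) : ℂ)) 0 = if j = k then (k.factorial : ℂ) else 0 := by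
  have e : (fun x : ℝ => ((x ^ k : ℝ) : ℂ)) = fun x : ℝ => (x ^ k) • (1 : ℂ) := by
    ext x; simp
  have hd : ContDiffAt ℝ j (fun x : ℝ => x ^ k) 0 := (contDiff_id.pow k).contDiffAt
  rw [e, iteratedDeriv_smul_const hd, iteratedDeriv_fun_pow_zero]
  split_ifs <;> simp_all

/-- A cut-off multiple of `x ^ k / k!`. It singles out one derivative of the Dirac measure, and its
bounded support is what rescaling shrinks to a point. -/
theorem exists_isTest_iteratedDeriv_eq (k : ℕ) :
    ∃ h : ℝ → ℂ, IsTest h ∧ tsupport h ⊆ Set.Icc (-1) 1 ∧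
      ∀ j, iteratedDeriv j h 0 = if j = k then 1 else 0 := by
  obtain ⟨χ, hχ, h0, h1⟩ := exists_cutoff (s := (Set.Ioo (-1 : ℝ) 1)ᶜ) (t := {0})
    isOpen_Ioo.isClosed_compl isClosed_singleton (by simp)
  have hm : ContDiff ℝ ∞ fun x : ℝ => (k.factorial : ℂ)⁻¹ * ((x ^ k : ℝ) : ℂ) :=
    contDiff_const.mul (Complex.ofRealCLM.contDiff.comp (contDiff_id.pow k))
  have hs : tsupport (fun x : ℝ => ((k.factorial : ℂ)⁻¹ * ((x ^ k : ℝ) : ℂ)) * χ x) ⊆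
      Set.Icc (-1) 1 := by
    refine tsupport_mul_subset_right.trans (closure_minimal (fun x hx => ?_) isClosed_Icc)
    by_contra hx'
    exact hx ((h0 x fun h => hx' (Set.Ioo_subset_Icc_self h)).self_of_nhds)
  refine ⟨_, ⟨hm.mul hχ, HasCompactSupport.of_support_subset_isCompact isCompact_Icc
    ((subset_tsupport _).trans hs)⟩, hs, fun j => ?_⟩
  have e : (fun x : ℝ => ((k.factorial : ℂ)⁻¹ * ((x ^ k : ℝ) : ℂ)) * χ x) =ᶠ[𝓝 0]
      fun x : ℝ => (k.factorial : ℂ)⁻¹ * ((x ^ k : ℝ) : ℂ) := by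
    filter_upwards [h1 0 rfl] with x hx
    simp [hx]
  have hd : ContDiffAt ℝ j (fun x : ℝ => ((x ^ k : ℝ) : ℂ)) 0 :=
    (Complex.ofRealCLM.contDiff.comp (contDiff_id.pow k)).contDiffAt
  have := iteratedDeriv_const_smul hd ((k.factorial : ℂ)⁻¹)
  rw [e.iteratedDeriv_eq]
  refine Eq.trans this ?_
  rw [iteratedDeriv_ofReal_pow_zero]
  split_ifs
  · simp [Nat.factorial_ne_zero]
  · simp

theorem IsTest.exists_bound {w : ℝ → ℂ} (hw : IsTest w) : ∃ C, 0 ≤ C ∧ ∀ x, ‖w x‖ ≤ C := by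
  obtain ⟨C, hC⟩ := hw.1.continuous.bounded_above_of_compact_support hw.2
  exact ⟨C, (norm_nonneg _).trans (hC 0), hC⟩

theorem iteratedDeriv_comp_mul_left {h : ℝ → ℂ} (hh : ContDiff ℝ ∞ h) (c : ℝ) (j : ℕ) (x : ℝ) :
    iteratedDeriv j (fun x => h (c * x)) x = (c : ℂ) ^ j * iteratedDeriv j h (c * x) := by
  rw [iteratedDeriv_comp_const_smul (hh.of_le (mod_cast le_top)) c]
  simp [Complex.real_smul]

/-- Replacing `h x` by `l ^ (-k) h (l x)` keeps the `k`-th derivative at `0` but multiplies the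
bounds of the lower ones by `l ^ (j - k) ≤ 1 / l`. These are the summands for Borel's lemma. -/
theorem exists_small_iteratedDeriv_eq (k : ℕ) (a : ℂ) :
    ∃ f : ℝ → ℂ, IsTest f ∧ (∀ j, iteratedDeriv j f 0 = if j = k then a else 0) ∧
      ∀ j < k, ∀ x, ‖iteratedDeriv j f x‖ ≤ (1 / 2 : ℝ) ^ k := by
  obtain ⟨h, hh, -, hj⟩ := exists_isTest_iteratedDeriv_eq k
  choose C hC0 hC using fun j => (hh.iteratedDeriv j).exists_bound
  set M : ℝ := ∑ j ∈ Finset.range k, C j with hM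
  have hM0 : 0 ≤ ‖a‖ * M :=
    mul_nonneg (norm_nonneg a) (Finset.sum_nonneg fun j _ => hC0 j)
  obtain ⟨l, hl1, hl⟩ : ∃ l : ℝ, 1 ≤ l ∧ ‖a‖ * M ≤ l * (1 / 2) ^ k := by
    -- Chosen so that `l (1 / 2) ^ k = 1 + ‖a‖ M`.
    refine ⟨2 ^ k * (1 + ‖a‖ * M), ?_, ?_⟩
    · refine one_le_mul_of_one_le_of_one_le (one_le_pow₀ one_le_two) ?_
      linarith
    · rw [mul_right_comm, ← mul_pow]
      norm_num
  have hl0 : 0 < l := one_pos.trans_le hl1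
  have hlC : (l : ℂ) ≠ 0 := Complex.ofReal_ne_zero.2 hl0.ne'
  have hder : ∀ j x, iteratedDeriv j (fun x => (a * ((l : ℂ) ^ k)⁻¹) * h (l * x)) x =
      (a * ((l : ℂ) ^ k)⁻¹) * ((l : ℂ) ^ j * iteratedDeriv j h (l * x)) := by
    intro j x
    have hd : ContDiffAt ℝ j (fun x => h (l * x)) x :=
      ((hh.1.comp (contDiff_const.mul contDiff_id)).of_le (mod_cast le_top)).contDiffAt
    rw [← iteratedDeriv_comp_mul_left hh.1]
    exact iteratedDeriv_const_smul hd (a * ((l : ℂ) ^ k)⁻¹)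
  refine ⟨fun x => (a * ((l : ℂ) ^ k)⁻¹) * h (l * x), IsTest.const_mul
    ⟨hh.1.comp (contDiff_const.mul contDiff_id),
      hh.2.comp_homeomorph (Homeomorph.mulLeft₀ l hl0.ne')⟩ _, fun j => ?_, fun j hjk x => ?_⟩
  · rw [hder, mul_zero, hj]
    split_ifs with h
    · subst h
      field_simp
    · simp
  · rw [hder, norm_mul, norm_mul, norm_mul, norm_inv, norm_pow, norm_pow, Complex.norm_real,
      Real.norm_of_nonneg hl0.le]
    have h1 : (l ^ k)⁻¹ * l ^ j ≤ l⁻¹ := by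
      rw [inv_mul_le_iff₀ (pow_pos hl0 _), ← div_eq_mul_inv, le_div_iff₀ hl0, ← pow_succ]
      exact pow_le_pow_right₀ hl1 hjk
    have h2 : ‖iteratedDeriv j h (l * x)‖ ≤ M := (hC j _).trans
      (Finset.single_le_sum (f := C) (fun i _ => hC0 i) (Finset.mem_range.2 hjk))
    calc ‖a‖ * (l ^ k)⁻¹ * (l ^ j * ‖iteratedDeriv j h (l * x)‖)
        = ‖a‖ * ‖iteratedDeriv j h (l * x)‖ * ((l ^ k)⁻¹ * l ^ j) := by ring
      _ ≤ ‖a‖ * M * l⁻¹ := by gcongr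
      _ ≤ (1 / 2 : ℝ) ^ k := by
        rw [← div_eq_mul_inv, div_le_iff₀ hl0, mul_comm _ l]
        exact hl

/-- Borel's lemma. -/
theorem exists_contDiff_iteratedDeriv_zero_eq (a : ℕ → ℂ) :
    ∃ f : ℝ → ℂ, ContDiff ℝ ∞ f ∧ ∀ j, iteratedDeriv j f 0 = a j := by
  choose f hf hf0 hfb using fun k => exists_small_iteratedDeriv_eq k (a k)
  choose B hB0 hB using fun k j => ((hf k).iteratedDeriv j).exists_bound
  -- For derivatives of order `j` the geometric bound is available only for `k > j`; the finitely
  -- many terms `k ≤ j` receive their individual bounds.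
  set v : ℕ → ℕ → ℝ := fun j k =>
    (1 / 2 : ℝ) ^ k + if k ∈ Finset.range (j + 1) then B k j else 0 with hv_def
  have hv : ∀ j, Summable (v j) := fun j =>
    summable_geometric_two.add (summable_of_ne_finset_zero (s := Finset.range (j + 1))
      fun k hk => if_neg hk)
  have hbound : ∀ j k x, ‖iteratedFDeriv ℝ j (f k) x‖ ≤ v j k := fun j k x => by
    rw [norm_iteratedFDeriv_eq_norm_iteratedDeriv]
    simp only [hv_def, Finset.mem_range]
    split_ifs with hk
    · have : (0 : ℝ) ≤ (1 / 2) ^ k := by positivity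
      linarith [hB k j x]
    · simpa using hfb k j (by omega) x
  have hsmooth : ContDiff ℝ ∞ fun x => ∑' k, f k x :=
    contDiff_tsum (N := ⊤) (v := v) (fun k => (hf k).1) (fun j _ => hv j)
      fun j k x _ => hbound j k x
  have hder : ∀ j, iteratedFDeriv ℝ j (fun x => ∑' k, f k x) 0 =
      ∑' k, iteratedFDeriv ℝ j (f k) 0 := fun j =>
    iteratedFDeriv_tsum_apply (N := ⊤) (v := v) (fun k => (hf k).1) (fun j _ => hv j)
      (fun j k x _ => hbound j k x) le_top 0
  refine ⟨fun x => ∑' k, f k x, hsmooth, fun j => ?_⟩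
  have hs : Summable fun k => iteratedFDeriv ℝ j (f k) 0 :=
    Summable.of_norm_bounded (hv j) fun k => hbound j k 0
  rw [iteratedDeriv_eq_iteratedFDeriv, hder, ContinuousMultilinearMap.tsum_eval hs]
  simp only [← iteratedDeriv_eq_iteratedFDeriv, hf0]
  rw [tsum_eq_single j fun k hk => if_neg hk.symm, if_pos rfl]

theorem exists_contDiff_iteratedDeriv_eq (p : ℝ) (a : ℕ → ℂ) :
    ∃ f : ℝ → ℂ, ContDiff ℝ ∞ f ∧ ∀ j, iteratedDeriv j f p = a j := by
  obtain ⟨f, hf, h⟩ := exists_contDiff_iteratedDeriv_zero_eq a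
  refine ⟨fun x => f (x - p), hf.comp (contDiff_id.sub contDiff_const), fun j => ?_⟩
  rw [iteratedDeriv_comp_sub_const]
  simpa using h j

/-- A function that is smooth off a point, where it vanishes, and all derivatives of which tend to
zero at that point, is smooth. -/
theorem contDiff_of_flat {G : ℝ → ℂ} {p : ℝ} (h0 : G p = 0) (hG : ContDiffOn ℝ ∞ G {p}ᶜ)
    (hl : ∀ j, Tendsto (iteratedDeriv j G) (𝓝[≠] p) (𝓝 0)) : ContDiff ℝ ∞ G := by
  have step : ∀ G : ℝ → ℂ, G p = 0 → ContDiffOn ℝ ∞ G {p}ᶜ →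
      (∀ j, Tendsto (iteratedDeriv j G) (𝓝[≠] p) (𝓝 0)) → HasDerivAt G 0 p := by
    intro G h0 hG hl
    have hc : ∀ f : ℝ → ℂ, f p = 0 → Tendsto f (𝓝[≠] p) (𝓝 0) → ContinuousAt f p :=
      fun f hf h => by
        rw [continuousAt_iff_punctured_nhds, hf]; exact h
    have hu : Function.update (deriv G) p 0 p = 0 := by simp
    have h1 : ContinuousAt (Function.update (deriv G) p 0) p := by
      refine hc _ hu ((hl 1).congr' ?_)
      filter_upwards [self_mem_nhdsWithin] with x hx
      rw [iteratedDeriv_one, Function.update_of_ne hx]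
    have h2 := hasDerivAt_of_hasDerivAt_of_ne (f := G) (g := Function.update (deriv G) p 0) (x := p)
      (fun y hy => by
        rw [Function.update_of_ne hy]
        exact (((hG.contDiffAt (isOpen_compl_singleton.mem_nhds hy)).differentiableAt
          (by simp))).hasDerivAt) (hc G h0 (by simpa using hl 0)) h1
    rwa [hu] at h2
  -- The induction is over all `G` at once, because `deriv G` is again flat at `p`.
  have main : ∀ m : ℕ, ∀ G : ℝ → ℂ, G p = 0 → ContDiffOn ℝ ∞ G {p}ᶜ →
      (∀ j, Tendsto (iteratedDeriv j G) (𝓝[≠] p) (𝓝 0)) → ContDiff ℝ m G := by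
    intro m
    induction m with
    | zero =>
      intro G h0 hG hl
      rw [Nat.cast_zero, contDiff_zero, continuous_iff_continuousAt]
      intro x
      by_cases hx : x = p
      · exact hx ▸ (step G h0 hG hl).continuousAt
      · exact (hG.contDiffAt (isOpen_compl_singleton.mem_nhds hx)).continuousAt
    | succ m ih =>
      intro G h0 hG hl
      rw [Nat.cast_succ, contDiff_succ_iff_deriv]
      refine ⟨fun x => ?_, by simp, ih _ (step G h0 hG hl).deriv
        (hG.deriv_of_isOpen isOpen_compl_singleton (by simp)) fun j => ?_⟩
      · by_cases hx : x = p
        · exact hx ▸ (step G h0 hG hl).differentiableAt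
        · exact (hG.contDiffAt (isOpen_compl_singleton.mem_nhds hx)).differentiableAt (by simp)
      · simpa only [iteratedDeriv_succ'] using hl (j + 1)
  exact contDiff_infty.2 fun m => main m G h0 hG hl

theorem tendsto_punctured {f : ℝ → ℂ} {p : ℝ} {l : Filter ℂ} (h : Tendsto f (𝓝[<] p) l)
    (h' : Tendsto f (𝓝[>] p) l) : Tendsto f (𝓝[≠] p) l := by
  rw [← nhdsLT_sup_nhdsGT]
  exact h.sup h'

/-- Let `B` be smooth with the lateral limits as its jet at `p`, by Borel's lemma. Then `φ - B`,
extended by zero to the left, is flat at `p` and hence smooth there. -/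
theorem exists_extension_right {φ : ℝ → ℂ} {p η : ℝ} (hη : 0 < η)
    (hφ : ContDiffOn ℝ ∞ φ (Set.Ioo p (p + η)))
    (hl : ∀ j, ∃ l, Tendsto (iteratedDeriv j φ) (𝓝[>] p) (𝓝 l)) :
    ∃ v : ℝ → ℂ, ContDiff ℝ ∞ v ∧ ∃ δ > 0, ∀ x ∈ Set.Ioo p (p + δ), φ x = v x := by
  choose l hl using hl
  obtain ⟨B, hB, hBl⟩ := exists_contDiff_iteratedDeriv_eq p l
  obtain ⟨χ, hχ, h0, h1⟩ := exists_cutoff (s := Set.Ici (p + η)) (t := Set.Iic (p + η / 2))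
    isClosed_Ici isClosed_Iic (Set.disjoint_left.2 fun x hx hx' => by
      have h1 : p + η ≤ x := hx
      have h2 : x ≤ p + η / 2 := hx'
      linarith)
  -- The cut-off removes `φ` from `p + η` on, where nothing is assumed about it.
  let G : ℝ → ℂ := fun x => if p < x then χ x * (φ x - B x) else 0
  have g1 : ∀ x < p, G =ᶠ[𝓝 x] fun _ => 0 := fun x hx => by
    filter_upwards [Iio_mem_nhds hx] with y hy
    exact if_neg (not_lt.2 (le_of_lt hy))
  have g2 : ∀ x, p < x → G =ᶠ[𝓝 x] fun x => χ x * (φ x - B x) := fun x hx => by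
    filter_upwards [Ioi_mem_nhds hx] with y hy
    exact if_pos hy
  have g3 : ∀ x ∈ Set.Ioo p (p + η / 2), G =ᶠ[𝓝 x] φ - B := fun x hx => by
    filter_upwards [g2 x hx.1, h1 x hx.2.le] with y hy hy'
    simp [hy, hy']
  have hG : ContDiff ℝ ∞ G := by
    refine contDiff_of_flat (p := p) (if_neg (lt_irrefl p)) (fun x hx => ?_) fun j => ?_
    · refine ContDiffAt.contDiffWithinAt ?_
      rcases lt_trichotomy x p with h | h | h
      · exact contDiffAt_const.congr_of_eventuallyEq (g1 x h)
      · exact absurd h hx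
      · rcases lt_or_ge x (p + η) with h' | h'
        · exact (hχ.contDiffAt.mul ((hφ.contDiffAt (Ioo_mem_nhds h h')).sub
            hB.contDiffAt)).congr_of_eventuallyEq (g2 x h)
        · refine (contDiffAt_const (c := (0 : ℂ))).congr_of_eventuallyEq ?_
          filter_upwards [g2 x h, h0 x h'] with y hy hy'
          simp [hy, hy']
    · refine tendsto_punctured (tendsto_const_nhds.congr' ?_) ?_
      · filter_upwards [self_mem_nhdsWithin] with x hx
        rw [(g1 x hx).iteratedDeriv_eq]
        simp
      · have := (hl j).sub ((hB.continuous_iteratedDeriv j (mod_cast le_top)).tendsto p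
          |>.mono_left (nhdsWithin_le_nhds (s := Set.Ioi p)))
        rw [hBl, sub_self] at this
        refine this.congr' ?_
        filter_upwards [Ioo_mem_nhdsGT (show p < p + η / 2 by linarith)] with x hx
        rw [(g3 x hx).iteratedDeriv_eq, iteratedDeriv_sub _ (hB.contDiffAt.of_le (mod_cast le_top))]
        exact (hφ.contDiffAt (Ioo_mem_nhds hx.1 (by linarith [hx.2]))).of_le (mod_cast le_top)
  refine ⟨fun x => B x + G x, hB.add hG, η / 2, by positivity, fun x hx => ?_⟩
  simp [(g3 x hx).self_of_nhds]

theorem exists_extension_left {φ : ℝ → ℂ} {p η : ℝ} (hη : 0 < η)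
    (hφ : ContDiffOn ℝ ∞ φ (Set.Ioo (p - η) p))
    (hl : ∀ j, ∃ l, Tendsto (iteratedDeriv j φ) (𝓝[<] p) (𝓝 l)) :
    ∃ u : ℝ → ℂ, ContDiff ℝ ∞ u ∧ ∃ δ > 0, ∀ x ∈ Set.Ioo (p - δ) p, φ x = u x := by
  obtain ⟨v, hv, δ, hδ, h⟩ := exists_extension_right (φ := fun x => φ (-x)) (p := -p) hη
    (hφ.comp contDiff_neg.contDiffOn fun x hx => ⟨by linarith [hx.2], by linarith [hx.1]⟩)
    (fun j => by
      obtain ⟨l, hl⟩ := hl j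
      refine ⟨(-1 : ℝ) ^ j • l, ?_⟩
      have : iteratedDeriv j (fun x => φ (-x)) = fun x => (-1 : ℝ) ^ j • iteratedDeriv j φ (-x) :=
        funext fun x => iteratedDeriv_comp_neg j φ x
      rw [this]
      refine (hl.comp ?_).const_smul _
      have := (continuous_neg.tendsto (-p)).inf
        (tendsto_principal_principal.2 fun x (hx : x ∈ Set.Ioi (-p)) =>
          (show -x ∈ Set.Iio p by
            have : -p < x := hx
            change -x < p
            linarith))
      rwa [neg_neg] at this)
  refine ⟨fun x => v (-x), hv.comp contDiff_neg, δ, hδ, fun x hx => ?_⟩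
  have := h (-x) ⟨by linarith [hx.2], by linarith [hx.1]⟩
  rwa [neg_neg] at this

/-- The exceptional set is finite, so both sides of `p` are free of it for a while and the one-sided
extensions apply. Taking branches that are smooth on the whole line keeps domains out of the later
formulas. -/
theorem PiecewiseSmooth.exists_local {φ : ℝ → ℂ} (h : PiecewiseSmooth φ) (p : ℝ) :
    ∃ u v : ℝ → ℂ, ContDiff ℝ ∞ u ∧ ContDiff ℝ ∞ v ∧ ∃ η > 0,
      (∀ x ∈ Set.Ioo (p - η) p, φ x = u x) ∧ ∀ x ∈ Set.Ioo p (p + η), φ x = v x := by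
  obtain ⟨I, hI, hφ, hl⟩ := h
  obtain ⟨r, hr, hrI⟩ := Metric.isOpen_iff.1 ((hI.subset Set.sdiff_subset : (I \ {p}).Finite)
    |>.isClosed.isOpen_compl) p (by simp)
  have hsub : ∀ x, x ∈ Set.Ioo (p - r) (p + r) → x ≠ p → x ∈ Iᶜ := fun x hx hxp hxI =>
    hrI (by rw [Real.ball_eq_Ioo]; exact hx) ⟨hxI, hxp⟩
  have hlim : ∀ j, (∃ l, Tendsto (iteratedDeriv j φ) (𝓝[<] p) (𝓝 l)) ∧
      ∃ l, Tendsto (iteratedDeriv j φ) (𝓝[>] p) (𝓝 l) := fun j => by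
    by_cases hp : p ∈ I
    · exact hl p hp j
    · have hI' : IsOpen Iᶜ := hI.isClosed.isOpen_compl
      have hc : ContinuousAt (iteratedDeriv j φ) p := by
        have := hφ.continuousOn_iteratedDerivWithin (m := j) (mod_cast le_top)
          hI'.uniqueDiffOn
        exact ((this.congr fun x hx => (iteratedDerivWithin_of_isOpen hI' hx).symm)).continuousAt
          (hI'.mem_nhds hp)
      exact ⟨⟨_, hc.mono_left nhdsWithin_le_nhds⟩, ⟨_, hc.mono_left nhdsWithin_le_nhds⟩⟩
  obtain ⟨u, hu, δ, hδ, hu'⟩ := exists_extension_left hr (hφ.mono fun x hx =>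
    hsub x ⟨hx.1, by linarith [hx.2]⟩ hx.2.ne) fun j => (hlim j).1
  obtain ⟨v, hv, δ', hδ', hv'⟩ := exists_extension_right hr (hφ.mono fun x hx =>
    hsub x ⟨by linarith [hx.1], hx.2⟩ hx.1.ne') fun j => (hlim j).2
  refine ⟨u, v, hu, hv, min δ δ', lt_min hδ hδ', fun x hx => hu' x ⟨?_, hx.2⟩,
    fun x hx => hv' x ⟨hx.1, ?_⟩⟩
  · linarith [hx.1, min_le_left δ δ']
  · linarith [hx.2, min_le_right δ δ']

/-! ### Functions with a jump and their distributional derivatives. -/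

/-- The function `u` to the left of `p` and `v` to the right. -/
noncomputable def glueAt (p : ℝ) (u v : ℝ → ℂ) (x : ℝ) : ℂ := if x < p then u x else v x

theorem glueAt_zero (u v : ℝ → ℂ) : glueAt 0 u v = glue u v := rfl

theorem locallyIntegrable_glueAt (p : ℝ) {u v : ℝ → ℂ} (hu : Continuous u) (hv : Continuous v) :
    LocallyIntegrable (glueAt p u v) := by
  have : glueAt p u v = fun x => (Set.Iio p).indicator u x + (Set.Ici p).indicator v x := by
    ext x
    by_cases hx : x < p
    · simp [glueAt, hx]
    · simp [glueAt, hx, not_lt.1 hx]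
  rw [this]
  exact (hu.locallyIntegrable.indicator measurableSet_Iio).add
    (hv.locallyIntegrable.indicator measurableSet_Ici)

theorem PiecewiseSmooth.exists_ae_eq {φ : ℝ → ℂ} (h : PiecewiseSmooth φ) (p : ℝ) :
    ∃ u v : ℝ → ℂ, ContDiff ℝ ∞ u ∧ ContDiff ℝ ∞ v ∧ ∃ η > 0,
      ∀ᵐ x, x ∈ Set.Ioo (p - η) (p + η) → φ x = glueAt p u v x := by
  obtain ⟨u, v, hu, hv, η, hη, h1, h2⟩ := h.exists_local p
  refine ⟨u, v, hu, hv, η, hη, ?_⟩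
  filter_upwards [compl_mem_ae_iff.2 (measure_singleton (μ := volume) p)] with x hx hxη
  rcases lt_or_gt_of_ne (show x ≠ p from hx) with h | h
  · rw [glueAt, if_pos h, h1 x ⟨hxη.1, h⟩]
  · rw [glueAt, if_neg h.not_gt, h2 x ⟨h, hxη.2⟩]

theorem PiecewiseSmooth.locallyIntegrable {φ : ℝ → ℂ} (h : PiecewiseSmooth φ) :
    LocallyIntegrable φ := fun p => by
  obtain ⟨u, v, hu, hv, η, hη, he⟩ := h.exists_ae_eq p
  obtain ⟨s, hs, hi⟩ := locallyIntegrable_glueAt p hu.continuous hv.continuous p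
  refine ⟨s ∩ Set.Ioo (p - η) (p + η), inter_mem hs (Ioo_mem_nhds (by linarith) (by linarith)), ?_⟩
  refine (hi.mono_set Set.inter_subset_left).congr ?_
  have := ae_restrict_of_ae (s := s ∩ Set.Ioo (p - η) (p + η)) he
  have h2 := (ae_restrict_mem measurableSet_Ioo).filter_mono
    (ae_mono (Measure.restrict_mono (μ := volume)
      (Set.inter_subset_right (s := s) (t := Set.Ioo (p - η) (p + η))) le_rfl))
  filter_upwards [this, h2] with x hx hx'
  exact (hx hx').symm

/-- The number `k` comes from the global representation of `ψ` and serves every point; only the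
branches depend on `p`. -/
theorem exists_agreeOn_of_mem_spaceA {ψ : Dist} (h : ψ ∈ spaceA) :
    ∃ k : ℕ, ∀ p : ℝ, ∃ u v : ℝ → ℂ, ContDiff ℝ ∞ u ∧ ContDiff ℝ ∞ v ∧ ∃ η > 0,
      AgreeOn ψ (D^[k] (regular (glueAt p u v))) (Set.Ioo (p - η) (p + η)) := by
  obtain ⟨φ, hφ, k, rfl⟩ := h
  refine ⟨k, fun p => ?_⟩
  obtain ⟨u, v, hu, hv, η, hη, he⟩ := hφ.exists_ae_eq p
  refine ⟨u, v, hu, hv, η, hη, AgreeOn.D_iterate (fun w hw hs => ?_) k⟩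
  rw [ev_regular hφ.locallyIntegrable hw,
    ev_regular (locallyIntegrable_glueAt p hu.continuous hv.continuous) hw]
  refine integral_congr_ae (he.mono fun x hx => ?_)
  by_cases hxw : x ∈ tsupport w
  · simp only [hx (hs hxw)]
  · simp [image_eq_zero_of_notMem_tsupport hxw]

theorem IsTest.mul_right {w : ℝ → ℂ} (hw : IsTest w) {g : ℝ → ℂ} (hg : ContDiff ℝ ∞ g) :
    IsTest (fun x => w x * g x) := ⟨hw.1.mul hg, hw.2.mul_right⟩

theorem IsTest.integral_mul_glueAt {w : ℝ → ℂ} (hw : IsTest w) (p : ℝ) {u v : ℝ → ℂ}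
    (hu : ContDiff ℝ ∞ u) (hv : ContDiff ℝ ∞ v) :
    ∫ x, w x * glueAt p u v x = (∫ x in Set.Iic p, w x * u x) + ∫ x in Set.Ioi p, w x * v x := by
  rw [← intervalIntegral.integral_Iic_add_Ioi (f := fun x => w x * glueAt p u v x) (b := p)
    ((hw.integrable_mul (locallyIntegrable_glueAt p hu.continuous hv.continuous)).integrableOn)
    ((hw.integrable_mul (locallyIntegrable_glueAt p hu.continuous hv.continuous)).integrableOn)]
  congr 1
  · rw [integral_Iic_eq_integral_Iio, integral_Iic_eq_integral_Iio]
    refine setIntegral_congr_fun measurableSet_Iio fun x hx => ?_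
    have : x < p := hx
    simp [glueAt, this]
  · refine setIntegral_congr_fun measurableSet_Ioi fun x hx => ?_
    have : ¬ x < p := not_lt.2 (le_of_lt hx)
    simp [glueAt, this]

theorem contDiff_deriv {g : ℝ → ℂ} (hg : ContDiff ℝ ∞ g) : ContDiff ℝ ∞ (deriv g) :=
  (contDiff_infty_iff_deriv.1 hg).2

theorem contDiff_iteratedDeriv {g : ℝ → ℂ} (hg : ContDiff ℝ ∞ g) (k : ℕ) :
    ContDiff ℝ ∞ (iteratedDeriv k g) := by
  induction k with
  | zero => simpa using hg
  | succ k ih => rw [iteratedDeriv_succ]; exact contDiff_deriv ih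

/-- Integration by parts on each half-line; the two boundary terms at `p` combine to the jump. -/
theorem integral_deriv_mul_glueAt (p : ℝ) {u v : ℝ → ℂ} (hu : ContDiff ℝ ∞ u)
    (hv : ContDiff ℝ ∞ v) {w : ℝ → ℂ} (hw : IsTest w) :
    ∫ x, deriv w x * glueAt p u v x =
      -((∫ x, w x * glueAt p (deriv u) (deriv v) x) + (v p - u p) * w p) := by
  have d : ∀ g : ℝ → ℂ, ContDiff ℝ ∞ g → deriv (fun x => w x * g x) =
      fun x => deriv w x * g x + w x * deriv g x := fun g hg => by
    ext x
    exact ((hw.1.differentiable (by simp) x).hasDerivAt.mul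
      (hg.differentiable (by simp) x).hasDerivAt).deriv
  have i1 : ∀ g : ℝ → ℂ, ContDiff ℝ ∞ g → Integrable fun x => deriv w x * g x :=
    fun g hg => (hw.deriv.mul_right hg).integrable
  have i2 : ∀ g : ℝ → ℂ, ContDiff ℝ ∞ g → Integrable fun x => w x * deriv g x :=
    fun g hg => (hw.mul_right (contDiff_deriv hg)).integrable
  have e1 := HasCompactSupport.integral_Iic_deriv_eq
    ((hw.mul_right hu).1.of_le (by simp)) (hw.mul_right hu).2 p
  have e2 := HasCompactSupport.integral_Ioi_deriv_eq
    ((hw.mul_right hv).1.of_le (by simp)) (hw.mul_right hv).2 p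
  rw [d u hu, integral_add (i1 u hu).integrableOn (i2 u hu).integrableOn] at e1
  rw [d v hv, integral_add (i1 v hv).integrableOn (i2 v hv).integrableOn] at e2
  rw [hw.deriv.integral_mul_glueAt p hu hv,
    hw.integral_mul_glueAt p (contDiff_deriv hu) (contDiff_deriv hv)]
  linear_combination e1 + e2

theorem integral_iteratedDeriv_mul_glueAt (p : ℝ) {u v : ℝ → ℂ} (hu : ContDiff ℝ ∞ u)
    (hv : ContDiff ℝ ∞ v) {w : ℝ → ℂ} (hw : IsTest w) (N : ℕ) :
    ∫ x, iteratedDeriv N w x * glueAt p u v x =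
      (-1) ^ N * ((∫ x, w x * glueAt p (iteratedDeriv N u) (iteratedDeriv N v) x) +
        ∑ j ∈ Finset.range N, (-1) ^ j *
          (iteratedDeriv (N - 1 - j) v p - iteratedDeriv (N - 1 - j) u p) *
            iteratedDeriv j w p) := by
  induction N generalizing w with
  | zero => simp
  | succ N ih =>
    rw [iteratedDeriv_succ', ih hw.deriv, integral_deriv_mul_glueAt p (contDiff_iteratedDeriv hu N)
      (contDiff_iteratedDeriv hv N) hw, Finset.sum_range_succ']
    have e : ∀ j, N - 1 - j = N - (j + 1) := fun j => by omega
    simp only [Nat.add_sub_cancel, e, Nat.sub_zero, iteratedDeriv_zero, ← iteratedDeriv_succ,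
      ← iteratedDeriv_succ', pow_succ, pow_zero, mul_neg, mul_one, neg_mul, one_mul,
      Finset.sum_neg_distrib]
    ring

/-- The jump of order `N - 1 - j` is the coefficient of the `j`-th derivative of the Dirac measure
at `p`, whose action on `w` supplies the sign `(-1) ^ j`. -/
theorem ev_D_regular_glueAt (p : ℝ) {u v : ℝ → ℂ} (hu : ContDiff ℝ ∞ u)
    (hv : ContDiff ℝ ∞ v) {w : ℝ → ℂ} (hw : IsTest w) (N : ℕ) :
    ev (D^[N] (regular (glueAt p u v))) w =
      (∫ x, w x * glueAt p (iteratedDeriv N u) (iteratedDeriv N v) x) +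
        ∑ j ∈ Finset.range N, (-1) ^ j *
          (iteratedDeriv (N - 1 - j) v p - iteratedDeriv (N - 1 - j) u p) *
            iteratedDeriv j w p := by
  rw [ev_D_iterate _ hw, ev_regular (locallyIntegrable_glueAt p hu.continuous hv.continuous)
    (hw.iteratedDeriv N), integral_iteratedDeriv_mul_glueAt p hu hv hw, ← mul_assoc, ← mul_pow]
  simp

theorem glueAt_self (p : ℝ) (u : ℝ → ℂ) : glueAt p u u = u := by
  ext x; simp [glueAt]

theorem D_iterate_regular {g : ℝ → ℂ} (hg : ContDiff ℝ ∞ g) (N : ℕ) :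
    D^[N] (regular g) = regular (iteratedDeriv N g) := by
  refine dist_ext_ev fun t => ?_
  have := ev_D_regular_glueAt 0 hg hg t.isTest N
  simp only [glueAt_self, sub_self, mul_zero, zero_mul, Finset.sum_const_zero, add_zero] at this
  rw [this, ev_regular (contDiff_iteratedDeriv hg N).continuous.locallyIntegrable t.isTest]

/-! ### Independence of the derivatives of the Dirac measure. -/

/-- Scaling: take `w s x = s ^ (-l) τ (s (x - p))`, where the jet of `τ` at `0` is the `l`-th unit
jet. The left-hand side equals `e l` for all large `s`. On the right, the `m`-th derivative stays
bounded because `m ≤ l`, and its support shrinks to `p`, so the integral tends to `0`. -/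
theorem coeff_eq_zero_of_integral {p η : ℝ} (hη : 0 < η) {e : ℕ → ℂ} {N m : ℕ} {c : ℂ} {g : ℝ → ℂ}
    (hg : LocallyIntegrable g)
    (h : ∀ w, IsTest w → tsupport w ⊆ Set.Ioo (p - η) (p + η) →
      ∑ l ∈ Finset.range N, e l * iteratedDeriv l w p = c * ∫ x, iteratedDeriv m w x * g x)
    {l : ℕ} (hlN : l < N) (hml : m ≤ l) : e l = 0 := by
  obtain ⟨τ, hτ, hsupp, hjet⟩ := exists_isTest_iteratedDeriv_eq l
  obtain ⟨C, hC0, hC⟩ := (hτ.iteratedDeriv m).exists_bound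
  let w : ℝ → ℝ → ℂ := fun s x => ((s : ℂ) ^ l)⁻¹ * τ (s * (x - p))
  have hder : ∀ s j x, iteratedDeriv j (w s) x =
      ((s : ℂ) ^ l)⁻¹ * ((s : ℂ) ^ j * iteratedDeriv j τ (s * (x - p))) := by
    intro s j x
    have h1 : ContDiff ℝ ∞ fun x => τ (s * x) := hτ.1.comp (contDiff_const.mul contDiff_id)
    have h2 : ContDiff ℝ ∞ fun x => τ (s * (x - p)) := h1.comp (contDiff_id.sub contDiff_const)
    refine (iteratedDeriv_const_smul (h2.contDiffAt.of_le (mod_cast le_top))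
      ((s : ℂ) ^ l)⁻¹).trans ?_
    have := iteratedDeriv_comp_sub_const (f := fun x => τ (s * x)) (n := j) (s := p)
    rw [this]
    beta_reduce
    rw [iteratedDeriv_comp_mul_left hτ.1, smul_eq_mul]
  have hsmall : ∀ s : ℝ, 0 < s → ∀ x, s⁻¹ < |x - p| → s * (x - p) ∉ tsupport τ := by
    intro s hs x hx hmem
    have := abs_le.2 (hsupp hmem)
    rw [abs_mul, abs_of_pos hs] at this
    rw [inv_lt_iff_one_lt_mul₀ hs] at hx
    linarith
  have hw : ∀ s : ℝ, 0 < s → IsTest (w s) := fun s hs =>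
    ⟨contDiff_const.mul (hτ.1.comp (contDiff_const.mul (contDiff_id.sub contDiff_const))),
      (hτ.2.comp_homeomorph ((Homeomorph.subRight p).trans
        (Homeomorph.mulLeft₀ s hs.ne'))).mul_left⟩
  have hws : ∀ s : ℝ, 0 < s → tsupport (w s) ⊆ Set.Icc (p - s⁻¹) (p + s⁻¹) := fun s hs => by
    refine closure_minimal (fun x hx => ?_) isClosed_Icc
    by_contra hx'
    refine hx ?_
    have : s * (x - p) ∉ tsupport τ := hsmall s hs x (by
      by_contra hle
      have := abs_le.1 (not_lt.1 hle)
      exact hx' ⟨by linarith, by linarith⟩)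
    simp [w, image_eq_zero_of_notMem_tsupport this]
  have hlim : Tendsto (fun s : ℝ => c * ∫ x, iteratedDeriv m (w s) x * g x) atTop (𝓝 0) := by
    rw [show (0 : ℂ) = c * ∫ x : ℝ, (0 : ℂ) by simp]
    refine Tendsto.const_mul c ?_
    refine tendsto_integral_filter_of_dominated_convergence
      (fun x => C * ‖(Set.Icc (p - 1) (p + 1)).indicator g x‖) ?_ ?_ ?_ ?_
    · filter_upwards [eventually_gt_atTop 0] with s hs
      exact (((hw s hs).iteratedDeriv m).integrable_mul hg).aestronglyMeasurable
    · filter_upwards [eventually_ge_atTop 1] with s hs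
      refine Eventually.of_forall fun x => ?_
      have hs0 : 0 < s := one_pos.trans_le hs
      rw [norm_mul]
      by_cases hx : x ∈ Set.Icc (p - 1) (p + 1)
      · rw [Set.indicator_of_mem hx]
        refine mul_le_mul_of_nonneg_right ?_ (norm_nonneg _)
        rw [hder, norm_mul, norm_mul, norm_inv, norm_pow, norm_pow, Complex.norm_real,
          Real.norm_of_nonneg hs0.le, ← mul_assoc]
        have : (s ^ l)⁻¹ * s ^ m ≤ 1 := by
          rw [inv_mul_le_iff₀ (pow_pos hs0 _), mul_one]
          exact pow_le_pow_right₀ hs hml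
        calc (s ^ l)⁻¹ * s ^ m * ‖iteratedDeriv m τ (s * (x - p))‖ ≤ 1 * C :=
              mul_le_mul this (hC _) (norm_nonneg _) zero_le_one
          _ = C := one_mul C
      · have hxs : x ∉ tsupport (iteratedDeriv m (w s)) := fun hmem => by
          have := hws s hs0 (tsupport_iteratedDeriv_subset m hmem)
          have h1 : s⁻¹ ≤ 1 := inv_le_one_of_one_le₀ hs
          exact hx ⟨by linarith [this.1], by linarith [this.2]⟩
        rw [image_eq_zero_of_notMem_tsupport hxs]
        simp [Set.indicator_of_notMem hx]
    · exact (((hg.integrableOn_isCompact isCompact_Icc).integrable_indicator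
        measurableSet_Icc).norm).const_mul C
    -- At every `x ≠ p` the integrand is zero as soon as `s⁻¹ < |x - p|`.
    · filter_upwards [compl_mem_ae_iff.2 (measure_singleton (μ := volume) p)] with x hx
      refine tendsto_const_nhds.congr' ?_
      have hxp : 0 < |x - p| := abs_pos.2 (sub_ne_zero.2 hx)
      filter_upwards [tendsto_inv_atTop_zero.eventually (gt_mem_nhds hxp),
        eventually_gt_atTop (0 : ℝ)] with s hs hs0
      have hxs : x ∉ tsupport (iteratedDeriv m (w s)) := fun hmem => by
        have := hws s hs0 (tsupport_iteratedDeriv_subset m hmem)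
        have : |x - p| ≤ s⁻¹ := abs_le.2 ⟨by linarith [this.1], by linarith [this.2]⟩
        linarith
      rw [image_eq_zero_of_notMem_tsupport hxs, zero_mul]
  refine tendsto_nhds_unique (tendsto_const_nhds.congr' ?_) hlim
  filter_upwards [tendsto_inv_atTop_zero.eventually (gt_mem_nhds hη),
    eventually_gt_atTop (0 : ℝ)] with s hs hs0
  rw [← h (w s) (hw s hs0) ((hws s hs0).trans fun x hx =>
    ⟨by linarith [hx.1], by linarith [hx.2]⟩), Finset.sum_eq_single_of_mem l (Finset.mem_range.2 hlN)]
  · have : (s : ℂ) ≠ 0 := Complex.ofReal_ne_zero.2 hs0.ne'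
    rw [hder, sub_self, mul_zero, hjet, if_pos rfl]
    field_simp
  · intro j _ hj
    rw [hder, sub_self, mul_zero, hjet, if_neg hj]
    simp

/-- The order is attained: the sum is an `m`-th derivative of a locally integrable function with `m
≤ n`, and scaling then excludes every coefficient of index at least `m`. -/
theorem coeff_eq_zero_of_ord_le {c : ℕ →₀ ℂ} {n : ℕ} (h : ord (deltaSum c) ≤ n) {k : ℕ}
    (hk : n ≤ k) : c k = 0 := by
  have hne : {k : ℕ∞ | ∃ m : ℕ, k = m ∧ ∃ g : ℝ → ℂ, LocallyIntegrable g ∧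
      deltaSum c = D^[m] (regular g)}.Nonempty := by
    by_contra hne
    rw [ord, Set.not_nonempty_iff_eq_empty.1 hne, sInf_empty] at h
    exact absurd h (by simp)
  obtain ⟨m, hm, g, hg, he⟩ := csInf_mem hne
  have hmn : m ≤ n := by
    change sInf _ ≤ _ at h
    rw [hm] at h
    exact_mod_cast h
  obtain ⟨N, hN⟩ : ∃ N, c.support ⊆ Finset.range N :=
    ⟨c.support.sup id + 1, fun x hx => Finset.mem_range.2 (Nat.lt_succ_of_le
      (Finset.le_sup (f := id) hx))⟩
  -- The range is enlarged so that the index `k` occurs in the sum even if it lies outside the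
  -- support.
  have hN' : c.support ⊆ Finset.range (max N (k + 1)) :=
    hN.trans (Finset.range_mono (le_max_left _ _))
  have := coeff_eq_zero_of_integral (p := 0) (η := 1) one_pos (e := fun l => c l * (-1) ^ l)
    (N := max N (k + 1)) (m := m) (c := (-1) ^ m) hg (fun w hw _ => by
      rw [← ev_regular hg (hw.iteratedDeriv m), ← ev_D_iterate _ hw, ← he, ev_deltaSum c hw,
        Finsupp.sum_of_support_subset c hN' _ (by simp)]
      exact Finset.sum_congr rfl fun l _ => by ring)
    (l := k) (lt_of_lt_of_le (Nat.lt_succ_self k) (le_max_right _ _)) (hmn.trans hk)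
  simpa using this

theorem Coeffs.A_eq_zero {n : ℕ} {E : Coeffs n} (hM : E.M ≤ n) (i : Fin (n + 1)) {k : ℕ}
    (hk : n ≤ k) : E.A i k = 0 :=
  coeff_eq_zero_of_ord_le (((le_max_left _ _).trans (le_iSup (fun i => max (ord (deltaSum (E.A i)))
    (ord (deltaSum (E.B i)))) i)).trans hM) hk

theorem Coeffs.B_eq_zero {n : ℕ} {E : Coeffs n} (hM : E.M ≤ n) (i : Fin (n + 1)) {k : ℕ}
    (hk : n ≤ k) : E.B i k = 0 :=
  coeff_eq_zero_of_ord_le (((le_max_right _ _).trans (le_iSup (fun i => max (ord (deltaSum (E.A i)))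
    (ord (deltaSum (E.B i)))) i)).trans hM) hk

theorem ev_deltaSum_eq_sum_range {c : ℕ →₀ ℂ} {n : ℕ} (h : ∀ k, n ≤ k → c k = 0) {w : ℝ → ℂ}
    (hw : IsTest w) :
    ev (deltaSum c) w = ∑ k ∈ Finset.range n, c k * ((-1) ^ k * iteratedDeriv k w 0) := by
  rw [ev_deltaSum c hw, Finsupp.sum_of_support_subset c (fun k hk => ?_) _ (by simp)]
  by_contra hkn
  exact (Finsupp.mem_support_iff.1 hk) (h k (by simpa using hkn))

/-- The scaling lemma with zero right-hand side. -/
theorem deltaComb_eq_zero_iff {n : ℕ} (z : Fin n → ℂ) : deltaComb z = 0 ↔ ∀ i, z i = 0 := by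
  constructor
  · intro h i
    have := coeff_eq_zero_of_integral (p := 0) (η := 1) one_pos
      (e := fun l => if hl : l < n then z ⟨l, hl⟩ * (-1) ^ l else 0) (N := n) (m := 0) (c := 0)
      (g := fun _ => 0) continuous_const.locallyIntegrable (fun w hw _ => by
        have := ev_deltaComb z hw
        rw [h, ev_zero] at this
        rw [zero_mul, Finset.sum_range, this]
        exact Finset.sum_congr rfl fun l _ => by simp [mul_assoc])
      i.2 (Nat.zero_le _)
    simpa using this
  · intro h
    refine dist_ext_ev fun t => ?_
    rw [ev_deltaComb z t.isTest, ev_zero]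
    simp [h]

/-! ### Jets of solutions of a linear equation. -/

theorem iteratedDeriv_fun_mul {f g : ℝ → ℂ} (hf : ContDiff ℝ ∞ f) (hg : ContDiff ℝ ∞ g) (m : ℕ)
    (p : ℝ) : iteratedDeriv m (fun x => f x * g x) p =
      ∑ q ∈ Finset.range (m + 1), (m.choose q : ℂ) * iteratedDeriv q f p *
        iteratedDeriv (m - q) g p :=
  iteratedDeriv_mul (hf.contDiffAt.of_le (mod_cast le_top)) (hg.contDiffAt.of_le (mod_cast le_top))

theorem iteratedDeriv_iteratedDeriv (k m : ℕ) (u : ℝ → ℂ) :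
    iteratedDeriv k (iteratedDeriv m u) = iteratedDeriv (k + m) u := by
  rw [iteratedDeriv_eq_iterate, iteratedDeriv_eq_iterate, iteratedDeriv_eq_iterate,
    Function.iterate_add_apply]

theorem iteratedDeriv_diffOp {ι : Type*} (s : Finset ι) {c : ι → ℝ → ℂ}
    (hc : ∀ i, ContDiff ℝ ∞ (c i)) (e : ι → ℕ) {u : ℝ → ℂ} (hu : ContDiff ℝ ∞ u) (m : ℕ) (p : ℝ) :
    iteratedDeriv m (fun x => ∑ i ∈ s, c i x * iteratedDeriv (e i) u x) p =
      ∑ i ∈ s, ∑ q ∈ Finset.range (m + 1), (m.choose q : ℂ) * iteratedDeriv q (c i) p *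
        iteratedDeriv (m - q + e i) u p := by
  rw [iteratedDeriv_fun_sum fun i _ => (((hc i).mul
    (contDiff_iteratedDeriv hu (e i))).contDiffAt.of_le (mod_cast le_top))]
  refine Finset.sum_congr rfl fun i _ => ?_
  rw [iteratedDeriv_fun_mul (hc i) (contDiff_iteratedDeriv hu (e i))]
  simp only [iteratedDeriv_iteratedDeriv]

/-- The derivatives at a point of a solution of a linear equation whose leading coefficient does
not vanish there are linear functions of the first derivatives of the solution and of the
right-hand side. -/
theorem exists_jet_recursion {n : ℕ} {c : Fin (n + 1) → ℝ → ℂ} (hc : ∀ i, ContDiff ℝ ∞ (c i))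
    {p : ℝ} (hp : c (Fin.last n) p ≠ 0) (N m : ℕ) :
    ∃ R : ((Fin n → ℂ) × (Fin N → ℂ)) →ₗ[ℂ] ℂ, m < n + N → ∀ u f : ℝ → ℂ, ContDiff ℝ ∞ u →
      (∀ q, iteratedDeriv q (fun x => ∑ i, c i x * iteratedDeriv (i : ℕ) u x) p =
        iteratedDeriv q f p) →
      iteratedDeriv m u p =
        R (fun k => iteratedDeriv (k : ℕ) u p, fun k => iteratedDeriv (k : ℕ) f p) := by
  induction m using Nat.strong_induction_on with
  | _ m ih =>
    rcases lt_or_ge m n with hm | hm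
    · exact ⟨LinearMap.proj ⟨m, hm⟩ ∘ₗ LinearMap.fst ℂ _ _, fun _ u f _ _ => rfl⟩
    by_cases hN : m < n + N
    swap
    -- From order `n + N` on, more derivatives of `f` would be needed than `R` receives; a dummy
    -- value keeps `R` defined for every `m`.
    · exact ⟨0, fun h => absurd h hN⟩
    obtain ⟨q, rfl⟩ := Nat.exists_eq_add_of_le hm
    have hq : q < N := by omega
    choose! R hR using ih
    let a : Fin (n + 1) → ℕ → ℂ := fun i s => (q.choose s : ℂ) * iteratedDeriv s (c i) p
    -- The equation differentiated `q` times is solved for the derivative of order `n + q`. It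
    -- occurs only in the term `i = n`, `s = 0`, with factor `c (Fin.last n) p`; all other terms
    -- have lower order.
    refine ⟨(c (Fin.last n) p)⁻¹ • (LinearMap.proj ⟨q, hq⟩ ∘ₗ LinearMap.snd ℂ _ _ -
      ∑ i : Fin (n + 1), ∑ s ∈ Finset.range (q + 1),
        if i = Fin.last n ∧ s = 0 then 0 else a i s • R (q - s + i)), fun _ u f hu hf => ?_⟩
    have key := hf q
    rw [iteratedDeriv_diffOp _ hc (fun i => (i : ℕ)) hu] at key
    have split : ∀ (i : Fin (n + 1)), ∀ s ∈ Finset.range (q + 1),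
        a i s * iteratedDeriv (q - s + i) u p =
        (if i = Fin.last n ∧ s = 0 then c (Fin.last n) p * iteratedDeriv (n + q) u p else 0) +
        (if i = Fin.last n ∧ s = 0 then 0 else a i s • R (q - s + i))
          (fun k => iteratedDeriv (k : ℕ) u p, fun k => iteratedDeriv (k : ℕ) f p) := by
      intro i s hs
      split_ifs with h
      · obtain ⟨rfl, rfl⟩ := h
        simp [a, add_comm]
      · have hlt : q - s + (i : ℕ) < n + q := by
          have h1 := i.2
          have h2 := Finset.mem_range.1 hs
          rcases eq_or_ne s 0 with h0 | h0
          · have : (i : ℕ) ≠ n := fun hi => h ⟨Fin.ext hi, h0⟩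
            omega
          · omega
        rw [hR _ hlt (by omega) u f hu hf]
        simp
    rw [Finset.sum_congr rfl fun i _ => Finset.sum_congr rfl (split i)] at key
    simp only [Finset.sum_add_distrib] at key
    have hsum : ∑ i : Fin (n + 1), ∑ s ∈ Finset.range (q + 1),
        (if i = Fin.last n ∧ s = 0 then c (Fin.last n) p * iteratedDeriv (n + q) u p else 0) =
        c (Fin.last n) p * iteratedDeriv (n + q) u p := by
      rw [Finset.sum_eq_single_of_mem (Fin.last n) (Finset.mem_univ _),
        Finset.sum_eq_single_of_mem 0 (by simp)]
      · simp
      · intro s _ hs; simp [hs]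
      · intro i _ hi; simp [hi]
    rw [hsum] at key
    simp only [LinearMap.smul_apply, LinearMap.sub_apply, LinearMap.sum_apply]
    rw [eq_comm, smul_eq_mul, inv_mul_eq_iff_eq_mul₀ hp]
    change iteratedDeriv q f p - _ = _
    rw [← key]
    ring

/-- Continuity carries the equality to the closure, so that an equation on an open half-line can be
differentiated at its end point. -/
theorem iteratedDeriv_eq_of_eqOn {f g : ℝ → ℂ} (hf : ContDiff ℝ ∞ f) (hg : ContDiff ℝ ∞ g)
    {S : Set ℝ} (hS : IsOpen S) (h : Set.EqOn f g S) (q : ℕ) :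
    Set.EqOn (iteratedDeriv q f) (iteratedDeriv q g) (closure S) :=
  (h.iteratedDeriv_of_isOpen hS q).closure (contDiff_iteratedDeriv hf q).continuous
    (contDiff_iteratedDeriv hg q).continuous

theorem contDiff_diffOp {ι : Type*} (s : Finset ι) {c : ι → ℝ → ℂ} (hc : ∀ i, ContDiff ℝ ∞ (c i))
    (e : ι → ℕ) {u : ℝ → ℂ} (hu : ContDiff ℝ ∞ u) :
    ContDiff ℝ ∞ fun x => ∑ i ∈ s, c i x * iteratedDeriv (e i) u x :=
  ContDiff.sum fun i _ => (hc i).mul (contDiff_iteratedDeriv hu (e i))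

/-! ### The action of `L` on glued functions. -/

theorem iteratedDeriv_eq_zero_of_notMem {w : ℝ → ℂ} {x : ℝ} (hx : x ∉ tsupport w) (k : ℕ) :
    iteratedDeriv k w x = 0 :=
  image_eq_zero_of_notMem_tsupport fun h => hx (tsupport_iteratedDeriv_subset k h)

theorem integral_mul_congr_on {w f g : ℝ → ℂ} {U : Set ℝ} (hs : tsupport w ⊆ U)
    (h : Set.EqOn f g U) : ∫ x, w x * f x = ∫ x, w x * g x := by
  congr 1
  ext x
  by_cases hx : x ∈ tsupport w
  · rw [h (hs hx)]
  · simp [image_eq_zero_of_notMem_tsupport hx]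

theorem agreeOn_coeff {f g : ℝ → ℂ} (hf : ContDiff ℝ ∞ f) (hg : ContDiff ℝ ∞ g) (c : ℕ →₀ ℂ) :
    AgreeOn (regular (glue f g) + deltaSum c) (regular f) (Set.Iio 0) ∧
      AgreeOn (regular (glue f g) + deltaSum c) (regular g) (Set.Ioi 0) := by
  have hi : LocallyIntegrable (glue f g) := locallyIntegrable_glueAt 0 hf.continuous hg.continuous
  have hz : ∀ w, IsTest w → 0 ∉ tsupport w → ev (deltaSum c) w = 0 := fun w hw h0 => by
    rw [ev_deltaSum c hw]
    exact Finset.sum_eq_zero fun k _ => by simp [iteratedDeriv_eq_zero_of_notMem h0]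
  constructor
  · intro w hw hs
    rw [ev_add, hz w hw fun h => lt_irrefl (0 : ℝ) (hs h), add_zero, ev_regular hi hw,
      ev_regular hf.continuous.locallyIntegrable hw]
    exact integral_mul_congr_on hs fun x hx => if_pos hx
  · intro w hw hs
    rw [ev_add, hz w hw fun h => lt_irrefl (0 : ℝ) (hs h), add_zero, ev_regular hi hw,
      ev_regular hg.continuous.locallyIntegrable hw]
    exact integral_mul_congr_on hs fun x hx => if_neg (not_lt.2 (le_of_lt hx))

theorem agreeOn_D_glueAt {p : ℝ} {u v : ℝ → ℂ} (hu : ContDiff ℝ ∞ u) (hv : ContDiff ℝ ∞ v) (k : ℕ) :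
    AgreeOn (D^[k] (regular (glueAt p u v))) (regular (iteratedDeriv k u)) (Set.Iio p) ∧
      AgreeOn (D^[k] (regular (glueAt p u v))) (regular (iteratedDeriv k v)) (Set.Ioi p) := by
  have hi : LocallyIntegrable (glueAt p u v) :=
    locallyIntegrable_glueAt p hu.continuous hv.continuous
  rw [← D_iterate_regular hu, ← D_iterate_regular hv]
  constructor
  · refine AgreeOn.D_iterate (fun w hw hs => ?_) k
    rw [ev_regular hi hw, ev_regular hu.continuous.locallyIntegrable hw]
    exact integral_mul_congr_on hs fun x hx => if_pos hx
  · refine AgreeOn.D_iterate (fun w hw hs => ?_) k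
    rw [ev_regular hi hw, ev_regular hv.continuous.locallyIntegrable hw]
    exact integral_mul_congr_on hs fun x hx => if_neg (not_lt.2 (le_of_lt hx))

namespace Coeffs

variable {n : ℕ} (E : Coeffs n)

theorem agreeOn_a_neg (i : Fin (n + 1)) : AgreeOn (E.a i) (regular (E.aNeg i)) (Set.Iio 0) :=
  (agreeOn_coeff (E.smooth_aNeg i) (E.smooth_aPos i) (E.A i)).1

theorem agreeOn_a_pos (i : Fin (n + 1)) : AgreeOn (E.a i) (regular (E.aPos i)) (Set.Ioi 0) :=
  (agreeOn_coeff (E.smooth_aNeg i) (E.smooth_aPos i) (E.A i)).2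

theorem agreeOn_b_neg (i : Fin (n + 1)) : AgreeOn (E.b i) (regular (E.bNeg i)) (Set.Iio 0) :=
  (agreeOn_coeff (E.smooth_bNeg i) (E.smooth_bPos i) (E.B i)).1

theorem agreeOn_b_pos (i : Fin (n + 1)) : AgreeOn (E.b i) (regular (E.bPos i)) (Set.Ioi 0) :=
  (agreeOn_coeff (E.smooth_bNeg i) (E.smooth_bPos i) (E.B i)).2

end Coeffs

theorem ev_coeff {f g : ℝ → ℂ} (hf : ContDiff ℝ ∞ f) (hg : ContDiff ℝ ∞ g) {c : ℕ →₀ ℂ} {n : ℕ}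
    (hc : ∀ k, n ≤ k → c k = 0) {w : ℝ → ℂ} (hw : IsTest w) :
    ev (regular (glue f g) + deltaSum c) w = (∫ x, w x * glue f g x) +
      ∑ k ∈ Finset.range n, c k * ((-1) ^ k * iteratedDeriv k w 0) := by
  rw [ev_add, ev_regular (show LocallyIntegrable (glue f g) volume from
      locallyIntegrable_glueAt 0 hf.continuous hg.continuous) hw,
    ev_deltaSum_eq_sum_range hc hw]

theorem agreeOn_zero_zero (U : Set ℝ) : AgreeOn 0 0 U := fun _ _ _ => rfl

/-- The function part of the products of the coefficients with a glued function. -/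
theorem integral_glue_product {f₁ f₂ u v w : ℝ → ℂ} (hf₁ : ContDiff ℝ ∞ f₁)
    (hf₂ : ContDiff ℝ ∞ f₂) (hu : ContDiff ℝ ∞ u) (hv : ContDiff ℝ ∞ v) (hw : IsTest w) :
    (∫ x, (f₁ x * w x) * glue u v x) + (∫ x, (v x * w x) * glue f₁ f₂ x) -
      (∫ x, (v x * w x) * f₁ x) =
      ∫ x, w x * glue (fun x => f₁ x * u x) (fun x => f₂ x * v x) x := by
  have i1 := (hw.mul_left hf₁).integrable_mul
    (locallyIntegrable_glueAt 0 hu.continuous hv.continuous)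
  have i2 := (hw.mul_left hv).integrable_mul
    (locallyIntegrable_glueAt 0 hf₁.continuous hf₂.continuous)
  have i3 := (hw.mul_left hv).integrable_mul hf₁.continuous.locallyIntegrable
  rw [glueAt_zero] at i1 i2
  have i12 : Integrable fun x => f₁ x * w x * glue u v x + v x * w x * glue f₁ f₂ x := i1.add i2
  rw [← integral_add i1 i2, ← integral_sub i12 i3]
  congr 1
  ext x
  simp only [glue]
  split_ifs <;> ring

theorem glue_product_symm {f₁ f₂ u v w : ℝ → ℂ} (hf₁ : ContDiff ℝ ∞ f₁)
    (hf₂ : ContDiff ℝ ∞ f₂) (hu : ContDiff ℝ ∞ u) (hv : ContDiff ℝ ∞ v) (hw : IsTest w) :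
    (∫ x, (f₂ x * w x) * glue u v x) + (∫ x, (u x * w x) * glue f₁ f₂ x) -
      (∫ x, (u x * w x) * f₂ x) =
      ∫ x, w x * glue (fun x => f₁ x * u x) (fun x => f₂ x * v x) x := by
  have i1 := (hw.mul_left hf₂).integrable_mul
    (locallyIntegrable_glueAt 0 hu.continuous hv.continuous)
  have i2 := (hw.mul_left hu).integrable_mul
    (locallyIntegrable_glueAt 0 hf₁.continuous hf₂.continuous)
  have i3 := (hw.mul_left hu).integrable_mul hf₂.continuous.locallyIntegrable
  rw [glueAt_zero] at i1 i2
  have i12 : Integrable fun x => f₂ x * w x * glue u v x + u x * w x * glue f₁ f₂ x := i1.add i2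
  rw [← integral_add i1 i2, ← integral_sub i12 i3]
  congr 1
  ext x
  simp only [glue]
  split_ifs <;> ring

/-- The values at `0` of the derivatives of the jumps, tested against `w`. -/
noncomputable def jumpSum (N : ℕ) (u v w : ℝ → ℂ) : ℂ :=
  ∑ j ∈ Finset.range N, (-1) ^ j *
    (iteratedDeriv (N - 1 - j) v 0 - iteratedDeriv (N - 1 - j) u 0) * iteratedDeriv j w 0

theorem ev_D_glue {u v : ℝ → ℂ} (hu : ContDiff ℝ ∞ u) (hv : ContDiff ℝ ∞ v) {w : ℝ → ℂ}
    (hw : IsTest w) (N : ℕ) :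
    ev (D^[N] (regular (glue u v))) w =
      (∫ x, w x * glue (iteratedDeriv N u) (iteratedDeriv N v) x) + jumpSum N u v w :=
  ev_D_regular_glueAt 0 hu hv hw N

/-- The delta part of `L (H₋ u + H v)`, tested against `w`. -/
noncomputable def Coeffs.interfaceSum {n : ℕ} (E : Coeffs n) (u v w : ℝ → ℂ) : ℂ :=
  ∑ i : Fin (n + 1), (jumpSum i u v (fun x => E.aNeg i x * w x) +
    (∑ k ∈ Finset.range n, E.A i k *
      ((-1) ^ k * iteratedDeriv k (fun x => iteratedDeriv i v x * w x) 0)) +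
    (jumpSum i u v (fun x => E.bPos i x * w x) +
    ∑ k ∈ Finset.range n, E.B i k *
      ((-1) ^ k * iteratedDeriv k (fun x => iteratedDeriv i u x * w x) 0)))

namespace Coeffs

variable {n : ℕ} {E : Coeffs n}

/-- The unknown is the translated factor: its deltas sit to the left of `0` and meet `aNeg`, while
those of the coefficient stay at `0` and meet the right branch `v`. -/
theorem ev_star_a (hM : E.M ≤ n) (i : Fin (n + 1)) {u v : ℝ → ℂ} (hu : ContDiff ℝ ∞ u)
    (hv : ContDiff ℝ ∞ v) {w : ℝ → ℂ} (hw : IsTest w) :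
    ev (star (E.a i) (D^[i] (regular (glue u v)))) w =
      (∫ x, w x * glue (fun x => E.aNeg i x * iteratedDeriv i u x)
        (fun x => E.aPos i x * iteratedDeriv i v x) x) +
      (jumpSum i u v (fun x => E.aNeg i x * w x) +
        ∑ k ∈ Finset.range n, E.A i k *
          ((-1) ^ k * iteratedDeriv k (fun x => iteratedDeriv i v x * w x) 0)) := by
  have hui := contDiff_iteratedDeriv hu i
  have hvi := contDiff_iteratedDeriv hv i
  have hs := (isStarProduct_of_left_singular (E.smooth_aNeg i) (E.smooth_aPos i) hvi one_pos
    (E.agreeOn_a_neg i) (E.agreeOn_a_pos i) (agreeOn_D_glueAt (p := 0) hu hv i).2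
    (agreeOn_zero_zero _)).star_eq
  rw [add_zero, glueAt_zero] at hs
  rw [hs, ev_sub, ev_add, ev_add, ev_mul (E.smooth_aNeg i) _ hw, ev_mul (E.smooth_aPos i) _ hw,
    ev_mul hvi _ hw, ev_mul hvi _ hw, ev_zero, ev_D_glue hu hv (hw.mul_left (E.smooth_aNeg i)),
    ev_regular (E.smooth_aNeg i).continuous.locallyIntegrable (hw.mul_left hvi), Coeffs.a,
    ev_coeff (E.smooth_aNeg i) (E.smooth_aPos i) (fun k => A_eq_zero hM i) (hw.mul_left hvi),
    ← integral_glue_product (E.smooth_aNeg i) (E.smooth_aPos i) hui hvi hw]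
  ring

/-- Now the coefficient is translated: its deltas meet the left branch `u`, and those of the
unknown, at `0`, meet `bPos`. -/
theorem ev_star_b (hM : E.M ≤ n) (i : Fin (n + 1)) {u v : ℝ → ℂ} (hu : ContDiff ℝ ∞ u)
    (hv : ContDiff ℝ ∞ v) {w : ℝ → ℂ} (hw : IsTest w) :
    ev (star (D^[i] (regular (glue u v))) (E.b i)) w =
      (∫ x, w x * glue (fun x => E.bNeg i x * iteratedDeriv i u x)
        (fun x => E.bPos i x * iteratedDeriv i v x) x) +
      (jumpSum i u v (fun x => E.bPos i x * w x) +
        ∑ k ∈ Finset.range n, E.B i k *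
          ((-1) ^ k * iteratedDeriv k (fun x => iteratedDeriv i u x * w x) 0)) := by
  have hui := contDiff_iteratedDeriv hu i
  have hvi := contDiff_iteratedDeriv hv i
  have hs := (isStarProduct_of_right_singular hui (E.smooth_bPos i) (E.smooth_bNeg i) one_pos
    (agreeOn_D_glueAt (p := 0) hu hv i).1 (agreeOn_zero_zero _) (E.agreeOn_b_pos i)
    (E.agreeOn_b_neg i)).star_eq
  rw [add_zero, glueAt_zero] at hs
  rw [hs, ev_sub, ev_add, ev_add, ev_mul (E.smooth_bPos i) _ hw, ev_mul (E.smooth_bNeg i) _ hw,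
    ev_mul hui _ hw, ev_mul hui _ hw, ev_zero, ev_D_glue hu hv (hw.mul_left (E.smooth_bPos i)),
    ev_regular (E.smooth_bPos i).continuous.locallyIntegrable (hw.mul_left hui), Coeffs.b,
    ev_coeff (E.smooth_bNeg i) (E.smooth_bPos i) (fun k => B_eq_zero hM i) (hw.mul_left hui),
    ← glue_product_symm (E.smooth_bNeg i) (E.smooth_bPos i) hui hvi hw]
  ring

/-- The function parts of the products add up to `f` on each side by the two equations, which leaves
the delta parts. -/
theorem ev_L_glue (hM : E.M ≤ n) {f u v : ℝ → ℂ} (hf : ContDiff ℝ ∞ f) (hu : ContDiff ℝ ∞ u)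
    (hv : ContDiff ℝ ∞ v) (hu' : E.SolvesNeg f u) (hv' : E.SolvesPos f v) {w : ℝ → ℂ}
    (hw : IsTest w) :
    ev (E.L (regular (glue u v))) w = ev (regular f) w + E.interfaceSum u v w := by
  have hi : ∀ f g : ℝ → ℂ, ContDiff ℝ ∞ f → ContDiff ℝ ∞ g →
      Integrable fun x => w x * glue f g x := fun f g hf hg =>
    hw.integrable_mul (locallyIntegrable_glueAt 0 hf.continuous hg.continuous)
  have ha := fun i : Fin (n + 1) => hi _ _
    ((E.smooth_aNeg i).mul (contDiff_iteratedDeriv hu i))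
    ((E.smooth_aPos i).mul (contDiff_iteratedDeriv hv i))
  have hb := fun i : Fin (n + 1) => hi _ _
    ((E.smooth_bNeg i).mul (contDiff_iteratedDeriv hu i))
    ((E.smooth_bPos i).mul (contDiff_iteratedDeriv hv i))
  have hab : ∀ i : Fin (n + 1), Integrable fun x =>
      w x * glue (fun x => E.aNeg i x * iteratedDeriv i u x)
        (fun x => E.aPos i x * iteratedDeriv i v x) x +
      w x * glue (fun x => E.bNeg i x * iteratedDeriv i u x)
        (fun x => E.bPos i x * iteratedDeriv i v x) x := fun i => (ha i).add (hb i)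
  have hfun : ∑ i : Fin (n + 1),
      ((∫ x, w x * glue (fun x => E.aNeg i x * iteratedDeriv i u x)
        (fun x => E.aPos i x * iteratedDeriv i v x) x) +
      (∫ x, w x * glue (fun x => E.bNeg i x * iteratedDeriv i u x)
        (fun x => E.bPos i x * iteratedDeriv i v x) x)) = ∫ x, w x * f x := by
    rw [Finset.sum_congr rfl fun i _ => (integral_add (ha i) (hb i)).symm,
      ← integral_finsetSum _ fun i _ => hab i]
    congr 1
    ext x
    simp only [glue]
    split_ifs with hx
    · rw [← hu' x hx.le, Finset.mul_sum]
      exact Finset.sum_congr rfl fun i _ => by ring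
    · rw [← hv' x (not_lt.1 hx), Finset.mul_sum]
      exact Finset.sum_congr rfl fun i _ => by ring
  rw [Coeffs.L, ev_sum, ev_regular hf.continuous.locallyIntegrable hw, ← hfun, interfaceSum,
    ← Finset.sum_add_distrib]
  refine Finset.sum_congr rfl fun i _ => ?_
  rw [ev_add, ev_star_a hM i hu hv hw, ev_star_b hM i hu hv hw]
  ring

end Coeffs

/-! ### Reduction of the interface terms to jets. -/

/-- `β u v w` is a linear function of the jets of `u`, `v` of length `2 n`, and of the jet of `w`
of length `n`. -/
def IsJetForm (n : ℕ) (β : (ℝ → ℂ) → (ℝ → ℂ) → (ℝ → ℂ) → ℂ) : Prop :=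
  ∃ Φ : ((Fin (2 * n) → ℂ) × (Fin (2 * n) → ℂ)) →ₗ[ℂ] (Fin n → ℂ) →ₗ[ℂ] ℂ,
    ∀ u v w, ContDiff ℝ ∞ u → ContDiff ℝ ∞ v → ContDiff ℝ ∞ w →
      β u v w = Φ (jet (2 * n) u, jet (2 * n) v) (jet n w)

namespace IsJetForm

variable {n : ℕ} {β γ : (ℝ → ℂ) → (ℝ → ℂ) → (ℝ → ℂ) → ℂ}

theorem congr (h : IsJetForm n β) (e : ∀ u v w, ContDiff ℝ ∞ u → ContDiff ℝ ∞ v →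
    ContDiff ℝ ∞ w → γ u v w = β u v w) : IsJetForm n γ := by
  obtain ⟨Φ, h⟩ := h
  exact ⟨Φ, fun u v w hu hv hw => (e u v w hu hv hw).trans (h u v w hu hv hw)⟩

theorem add (h : IsJetForm n β) (h' : IsJetForm n γ) :
    IsJetForm n fun u v w => β u v w + γ u v w := by
  obtain ⟨Φ, h⟩ := h
  obtain ⟨Φ', h'⟩ := h'
  exact ⟨Φ + Φ', fun u v w hu hv hw => by
    beta_reduce; rw [h u v w hu hv hw, h' u v w hu hv hw]; simp⟩

theorem const_mul (h : IsJetForm n β) (c : ℂ) : IsJetForm n fun u v w => c * β u v w := by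
  obtain ⟨Φ, h⟩ := h
  exact ⟨c • Φ, fun u v w hu hv hw => by beta_reduce; rw [h u v w hu hv hw]; simp⟩

theorem sum {ι : Type*} (s : Finset ι) {β : ι → (ℝ → ℂ) → (ℝ → ℂ) → (ℝ → ℂ) → ℂ}
    (h : ∀ i ∈ s, IsJetForm n (β i)) : IsJetForm n fun u v w => ∑ i ∈ s, β i u v w := by
  classical
  induction s using Finset.induction_on with
  | empty => exact ⟨0, fun u v w _ _ _ => by simp⟩
  | insert a s ha ih =>
    simp only [Finset.sum_insert ha]
    exact (h a (by simp)).add (ih fun i hi => h i (Finset.mem_insert_of_mem hi))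

theorem left {a b : ℕ} (ha : a < 2 * n) (hb : b < n) :
    IsJetForm n fun u _ w => iteratedDeriv a u 0 * iteratedDeriv b w 0 :=
  ⟨(LinearMap.proj ⟨a, ha⟩ ∘ₗ LinearMap.fst ℂ _ _).smulRight (LinearMap.proj ⟨b, hb⟩),
    fun _ _ _ _ _ _ => rfl⟩

theorem right {a b : ℕ} (ha : a < 2 * n) (hb : b < n) :
    IsJetForm n fun _ v w => iteratedDeriv a v 0 * iteratedDeriv b w 0 :=
  ⟨(LinearMap.proj ⟨a, ha⟩ ∘ₗ LinearMap.snd ℂ _ _).smulRight (LinearMap.proj ⟨b, hb⟩),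
    fun _ _ _ _ _ _ => rfl⟩

/-- In the Leibniz formula the orders at `u` are `q + i ≤ k + n < 2 n`; this fixes the length `2 n`
of the jets. -/
theorem left_mul {i k : ℕ} (hi : i ≤ n) (hk : k < n) :
    IsJetForm n fun u _ w => iteratedDeriv k (fun x => iteratedDeriv i u x * w x) 0 := by
  refine (IsJetForm.sum (Finset.range (k + 1)) (β := fun q u _ w => (k.choose q : ℂ) *
    (iteratedDeriv (q + i) u 0 * iteratedDeriv (k - q) w 0)) fun q hq =>
      (IsJetForm.left ?_ ?_).const_mul _).congr fun u v w hu hv hw => ?_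
  · have := Finset.mem_range.1 hq
    omega
  · omega
  · rw [iteratedDeriv_fun_mul (contDiff_iteratedDeriv hu i) hw]
    exact Finset.sum_congr rfl fun q _ => by rw [iteratedDeriv_iteratedDeriv, mul_assoc]

theorem right_mul {i k : ℕ} (hi : i ≤ n) (hk : k < n) :
    IsJetForm n fun _ v w => iteratedDeriv k (fun x => iteratedDeriv i v x * w x) 0 := by
  refine (IsJetForm.sum (Finset.range (k + 1)) (β := fun q _ v w => (k.choose q : ℂ) *
    (iteratedDeriv (q + i) v 0 * iteratedDeriv (k - q) w 0)) fun q hq =>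
      (IsJetForm.right ?_ ?_).const_mul _).congr fun u v w hu hv hw => ?_
  · have := Finset.mem_range.1 hq
    omega
  · omega
  · rw [iteratedDeriv_fun_mul (contDiff_iteratedDeriv hv i) hw]
    exact Finset.sum_congr rfl fun q _ => by rw [iteratedDeriv_iteratedDeriv, mul_assoc]

/-- With `j < i ≤ n`, the jumps have order `i - 1 - j < n`, and `w` is differentiated at most `j <
n` times. -/
theorem jumpSum {i : ℕ} (hi : i ≤ n) {c : ℝ → ℂ} (hc : ContDiff ℝ ∞ c) :
    IsJetForm n fun u v w => jumpSum i u v fun x => c x * w x := by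
  refine IsJetForm.sum _ fun j hj => ?_
  have hj := Finset.mem_range.1 hj
  refine (IsJetForm.sum (Finset.range (j + 1)) (β := fun q u v w =>
    ((-1) ^ j * ((j.choose q : ℂ) * iteratedDeriv q c 0)) *
      (iteratedDeriv (i - 1 - j) v 0 * iteratedDeriv (j - q) w 0 +
        (-1) * (iteratedDeriv (i - 1 - j) u 0 * iteratedDeriv (j - q) w 0))) fun q hq =>
      ((IsJetForm.right ?_ ?_).add ((IsJetForm.left ?_ ?_).const_mul _)).const_mul _).congr
        fun u v w hu hv hw => ?_
  · omega
  · omega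
  · omega
  · omega
  · rw [iteratedDeriv_fun_mul hc hw, Finset.mul_sum]
    exact Finset.sum_congr rfl fun q _ => by ring

theorem interfaceSum (E : Coeffs n) : IsJetForm n E.interfaceSum := by
  refine IsJetForm.sum _ fun i _ => ((jumpSum (Nat.lt_succ_iff.1 i.2) (E.smooth_aNeg i)).add
    (IsJetForm.sum _ fun k hk => ?_)).add ((jumpSum (Nat.lt_succ_iff.1 i.2) (E.smooth_bPos i)).add
    (IsJetForm.sum _ fun k hk => ?_))
  · exact ((right_mul (Nat.lt_succ_iff.1 i.2) (Finset.mem_range.1 hk)).const_mul _).const_mul _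
  · exact ((left_mul (Nat.lt_succ_iff.1 i.2) (Finset.mem_range.1 hk)).const_mul _).const_mul _

end IsJetForm

theorem piecewiseSmooth_glue {u v : ℝ → ℂ} (hu : ContDiff ℝ ∞ u) (hv : ContDiff ℝ ∞ v) :
    PiecewiseSmooth (glue u v) := by
  have hl : Set.EqOn (glue u v) u (Set.Iio 0) := fun x hx => if_pos hx
  have hr : Set.EqOn (glue u v) v (Set.Ioi 0) := fun x hx => if_neg (not_lt.2 (le_of_lt hx))
  refine ⟨{0}, Set.finite_singleton 0, fun x hx => ?_, ?_⟩
  · rcases lt_or_gt_of_ne hx with h | h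
    · exact (hu.contDiffAt.congr_of_eventuallyEq
        (hl.eventuallyEq_of_mem (isOpen_Iio.mem_nhds h))).contDiffWithinAt
    · exact (hv.contDiffAt.congr_of_eventuallyEq
        (hr.eventuallyEq_of_mem (isOpen_Ioi.mem_nhds h))).contDiffWithinAt
  · rintro p rfl j
    refine ⟨⟨iteratedDeriv j u 0, ?_⟩, ⟨iteratedDeriv j v 0, ?_⟩⟩
    · exact (((contDiff_iteratedDeriv hu j).continuous.tendsto 0).mono_left
        nhdsWithin_le_nhds).congr' ((hl.iteratedDeriv_of_isOpen isOpen_Iio j).symm.eventuallyEq_of_mem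
          self_mem_nhdsWithin)
    · exact (((contDiff_iteratedDeriv hv j).continuous.tendsto 0).mono_left
        nhdsWithin_le_nhds).congr' ((hr.iteratedDeriv_of_isOpen isOpen_Ioi j).symm.eventuallyEq_of_mem
          self_mem_nhdsWithin)

theorem regular_glue_mem_spaceA {u v : ℝ → ℂ} (hu : ContDiff ℝ ∞ u) (hv : ContDiff ℝ ∞ v) :
    regular (glue u v) ∈ spaceA :=
  ⟨_, piecewiseSmooth_glue hu hv, 0, rfl⟩

/-- The jets of length `2 n` of the solutions of a differential equation of order `n` are linear
functions of the initial values and of the right-hand side. -/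
theorem exists_jet_extension {n : ℕ} {c : Fin (n + 1) → ℝ → ℂ} (hc : ∀ i, ContDiff ℝ ∞ (c i))
    (hp : c (Fin.last n) 0 ≠ 0) {S : Set ℝ} (hS : IsOpen S) (h0 : (0 : ℝ) ∈ closure S) :
    ∃ ρ : ((Fin n → ℂ) × (Fin n → ℂ)) →ₗ[ℂ] (Fin (2 * n) → ℂ), ∀ u f : ℝ → ℂ, ContDiff ℝ ∞ u →
      ContDiff ℝ ∞ f → Set.EqOn (fun x => ∑ i, c i x * iteratedDeriv (i : ℕ) u x) f S →
      jet (2 * n) u = ρ (jet n u, jet n f) := by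
  -- Derivatives of `f` of order below `n` suffice, since `2 n = n + n`.
  choose R hR using fun m : Fin (2 * n) => exists_jet_recursion hc hp n m
  refine ⟨LinearMap.pi R, fun u f hu hf h => funext fun m => ?_⟩
  exact hR m (by have := m.2; omega) u f hu fun q =>
    iteratedDeriv_eq_of_eqOn (contDiff_diffOp _ hc _ hu) hf hS h q h0

namespace Coeffs

variable {n : ℕ} {E : Coeffs n}

/-- The delta part of `Lψ - f` is linear in the jets of length `2 n` of the branches. The one-sided
equations replace these by jets of length `n` of the branches and of `f`, and linearity separates
the two contributions. -/
theorem exists_interface (hM : E.M ≤ n)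
    (hneg : E.aNeg (Fin.last n) 0 + E.bNeg (Fin.last n) 0 ≠ 0)
    (hpos : E.aPos (Fin.last n) 0 + E.bPos (Fin.last n) 0 ≠ 0) :
    ∃ (F : ((Fin n → ℂ) × (Fin n → ℂ)) →ₗ[ℂ] (Fin n → ℂ)) (g : (Fin n → ℂ) →ₗ[ℂ] (Fin n → ℂ)),
      ∀ f u v : ℝ → ℂ, ContDiff ℝ ∞ f → ContDiff ℝ ∞ u → ContDiff ℝ ∞ v →
        E.SolvesNeg f u → E.SolvesPos f v →
        E.L (regular (glue u v)) - regular f =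
          deltaComb (fun i => F (jet n u, jet n v) i + g (jet n f) i) := by
  obtain ⟨Φ, hΦ⟩ := IsJetForm.interfaceSum E
  obtain ⟨ρ, hρ⟩ := exists_jet_extension (c := fun i x => E.aNeg i x + E.bNeg i x)
    (fun i => (E.smooth_aNeg i).add (E.smooth_bNeg i)) hneg (isOpen_Iio (a := (0 : ℝ))) (by simp)
  obtain ⟨σ, hσ⟩ := exists_jet_extension (c := fun i x => E.aPos i x + E.bPos i x)
    (fun i => (E.smooth_aPos i).add (E.smooth_bPos i)) hpos (isOpen_Ioi (a := (0 : ℝ))) (by simp)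
  -- Reads off the coefficient of the `l`-th derivative of the Dirac measure: evaluate at the `l`-th
  -- unit jet and undo the sign `(-1) ^ l`.
  let coeff : ((Fin n → ℂ) →ₗ[ℂ] ℂ) →ₗ[ℂ] (Fin n → ℂ) :=
    LinearMap.pi fun l => ((-1) ^ (l : ℕ) : ℂ) • LinearMap.applyₗ (Pi.single l 1)
  let X : ((Fin n → ℂ) × (Fin n → ℂ)) →ₗ[ℂ] (Fin n → ℂ) := LinearMap.fst ℂ _ _
  let Y : ((Fin n → ℂ) × (Fin n → ℂ)) →ₗ[ℂ] (Fin n → ℂ) := LinearMap.snd ℂ _ _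
  -- `F` arises with the jet of `f` set to zero, `g` with the jets of both branches set to zero.
  refine ⟨coeff ∘ₗ Φ ∘ₗ (ρ ∘ₗ X.prod 0).prod (σ ∘ₗ Y.prod 0),
    coeff ∘ₗ Φ ∘ₗ (ρ ∘ₗ LinearMap.prod 0 LinearMap.id).prod
      (σ ∘ₗ LinearMap.prod 0 LinearMap.id), fun f u v hf hu hv hu' hv' => ?_⟩
  refine dist_ext_ev fun t => ?_
  have hw := t.isTest
  set w : ℝ → ℂ := fun x => (t x : ℂ)
  rw [ev_sub, ev_L_glue hM hf hu hv hu' hv' hw, add_sub_cancel_left, ev_deltaComb _ hw,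
    hΦ u v w hu hv hw.1, hρ u f hu hf fun x hx => hu' x (le_of_lt hx),
    hσ v f hv hf fun x hx => hv' x (le_of_lt hx), LinearMap.pi_apply_eq_sum_univ]
  have split : ∀ τ : ((Fin n → ℂ) × (Fin n → ℂ)) →ₗ[ℂ] (Fin (2 * n) → ℂ), ∀ x y,
      τ (x, y) = τ (x, 0) + τ (0, y) := fun τ x y => by rw [← map_add]; simp
  refine Finset.sum_congr rfl fun l _ => ?_
  rw [split ρ, split σ, ← Prod.mk_add_mk, map_add]
  have h1 : ((-1 : ℂ) ^ (l : ℕ)) * (-1) ^ (l : ℕ) = 1 := by rw [← mul_pow]; simp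
  have hs : (fun j : Fin n => if l = j then (1 : ℂ) else 0) = Pi.single l 1 := by
    ext j
    simp [Pi.single_apply, eq_comm]
  rw [hs]
  change iteratedDeriv l w 0 * _ =
    ((-1) ^ (l : ℕ) * Φ (ρ (jet n u, 0), σ (jet n v, 0)) (Pi.single l 1) +
      (-1) ^ (l : ℕ) * Φ (ρ (0, jet n f), σ (0, jet n f)) (Pi.single l 1)) *
      ((-1) ^ (l : ℕ) * iteratedDeriv l w 0)
  rw [LinearMap.add_apply]
  linear_combination -(iteratedDeriv l w 0 * (Φ (ρ (jet n u, 0), σ (jet n v, 0)) (Pi.single l 1) +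
    Φ (ρ (0, jet n f), σ (0, jet n f)) (Pi.single l 1))) * h1

theorem isSolution_iff {f u v : ℝ → ℂ} (hu : ContDiff ℝ ∞ u) (hv : ContDiff ℝ ∞ v) {R : Dist}
    (h : E.L (regular (glue u v)) - regular f = R) :
    E.IsSolution f (regular (glue u v)) ↔ R = 0 := by
  rw [← h, sub_eq_zero]
  exact ⟨fun h => h.2, fun h => ⟨regular_glue_mem_spaceA hu hv, h⟩⟩

end Coeffs

/-- The matrices of the two components of a linear map on pairs. -/
theorem exists_matrices {n : ℕ} (F : ((Fin n → ℂ) × (Fin n → ℂ)) →ₗ[ℂ] (Fin n → ℂ)) :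
    ∃ A B : Matrix (Fin n) (Fin n) ℂ, ∀ X Y, F (X, Y) = B.mulVec Y - A.mulVec X := by
  refine ⟨-LinearMap.toMatrix' (F ∘ₗ LinearMap.inl ℂ _ _),
    LinearMap.toMatrix' (F ∘ₗ LinearMap.inr ℂ _ _), fun X Y => ?_⟩
  rw [Matrix.neg_mulVec, LinearMap.toMatrix'_mulVec, LinearMap.toMatrix'_mulVec, sub_neg_eq_add]
  simp only [LinearMap.coe_comp, Function.comp_apply, LinearMap.inl_apply, LinearMap.inr_apply]
  rw [← map_add]
  simp

/-! ### Products with an arbitrary element of `𝒜`. -/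

theorem agreeOn_regular_of_eqOn {f g : ℝ → ℂ} (hf : LocallyIntegrable f) (hg : LocallyIntegrable g)
    {U : Set ℝ} (h : Set.EqOn f g U) : AgreeOn (regular f) (regular g) U := fun w hw hs => by
  rw [ev_regular hf hw, ev_regular hg hw, integral_mul_congr_on hs h]

theorem eqOn_of_agreeOn {F : Dist} {f g : ℝ → ℂ} {U : Set ℝ} (hU : IsOpen U) (hf : Continuous f)
    (hg : Continuous g) (h : AgreeOn F (regular f) U) (h' : AgreeOn F (regular g) U) :
    Set.EqOn f g U :=
  eqOn_of_eqFunOn hU ((eqFunOn_iff_agreeOn hf.locallyIntegrable).2 h)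
    ((eqFunOn_iff_agreeOn hg.locallyIntegrable).2 h') hf.continuousOn hg.continuousOn

theorem ev_eq_zero (F : Dist) {w : ℝ → ℂ} (h : ∀ x, w x = 0) : ev F w = 0 := by
  have e : w = fun x => (0 : ℂ) * 0 := by ext x; simp [h x]
  have h0 : IsTest fun _ : ℝ => (0 : ℂ) := ⟨contDiff_const, HasCompactSupport.zero⟩
  have := ev_const_mul F (w := fun _ => 0) h0 (0 : ℂ)
  rw [e, this, zero_mul]

theorem agreeOn_mul_regular {G : Dist} {g κ : ℝ → ℂ} (hg : ContDiff ℝ ∞ g) (hκ : ContDiff ℝ ∞ κ)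
    {U V : Set ℝ} (hG : AgreeOn G (regular g) (U ∩ V)) (hκV : ∀ x ∉ V, κ =ᶠ[𝓝 x] 0) :
    AgreeOn (mul κ G) (regular fun x => κ x * g x) U := fun w hw hs => by
  have hs' : tsupport (fun x => κ x * w x) ⊆ U ∩ V := fun x hx =>
    ⟨tsupport_mul_subset_of hs hx, by_contra fun h =>
      (notMem_tsupport_iff_eventuallyEq.2 (hκV x h)) (tsupport_mul_subset_left hx)⟩
  rw [ev_mul hκ _ hw, hG _ (hw.mul_left hκ) hs', ev_regular hg.continuous.locallyIntegrable
    (hw.mul_left hκ), ev_regular (hκ.mul hg).continuous.locallyIntegrable hw]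
  congr 1
  ext x
  ring

/-- How the product of `F` and `G` acts on test functions supported in `U₁`, in `U₂`, and in a
set `W` on which the second part of `G` vanishes. -/
theorem ev_localized_product {F G : Dist} {f₁ f₂ g κ : ℝ → ℂ} (hf₁ : ContDiff ℝ ∞ f₁)
    (hf₂ : ContDiff ℝ ∞ f₂) (hg : ContDiff ℝ ∞ g) (hκ : ContDiff ℝ ∞ κ) {U₁ U₂ W : Set ℝ}
    (hF₁ : AgreeOn F (regular f₁) U₁) (hF₂ : AgreeOn F (regular f₂) U₂)
    (hG : AgreeOn (mul (fun x => 1 - κ x) G) (regular fun x => (1 - κ x) * g x) U₂)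
    (hW : ∀ x ∈ W, κ x = 0) (hU : U₁ ⊆ W) {P : Dist}
    (hP : P = mul f₁ (mul (fun x => 1 - κ x) G) + mul f₂ (mul κ G) +
      mul (fun x => (1 - κ x) * g x) F - mul (fun x => (1 - κ x) * g x) (regular f₁))
    {w : ℝ → ℂ} (hw : IsTest w) :
    (tsupport w ⊆ U₁ → ev P w = ev G fun x => f₁ x * w x) ∧
    (tsupport w ⊆ U₂ → ev P w = ev G fun x => f₂ x * w x) ∧
    (tsupport w ⊆ W → ev P w = (ev G fun x => f₁ x * w x) +
      ((ev F fun x => g x * w x) - ∫ x, w x * (g x * f₁ x))) := by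
  have hκ' : ContDiff ℝ ∞ fun x => 1 - κ x := contDiff_const.sub hκ
  have hg' : ContDiff ℝ ∞ fun x => (1 - κ x) * g x := hκ'.mul hg
  have hPw : ev P w = ev G (fun x => (1 - κ x) * (f₁ x * w x)) +
      ev G (fun x => κ x * (f₂ x * w x)) + ev F (fun x => (1 - κ x) * g x * w x) -
      ev (regular f₁) (fun x => (1 - κ x) * g x * w x) := by
    rw [hP, ev_sub, ev_add, ev_add, ev_mul hf₁ _ hw, ev_mul hf₂ _ hw, ev_mul hg' _ hw,
      ev_mul hg' _ hw, ev_mul hκ' _ (hw.mul_left hf₁), ev_mul hκ _ (hw.mul_left hf₂)]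
  have hz : tsupport w ⊆ W → ∀ x, κ x * w x = 0 := fun hs x => by
    by_cases hx : x ∈ tsupport w
    · rw [hW x (hs hx), zero_mul]
    · rw [image_eq_zero_of_notMem_tsupport hx, mul_zero]
  -- On `W` the cut-off drops out, which leaves `f₁ G` and the correction `g F - g f₁`; the
  -- correction vanishes where `F = f₁`.
  have h3 : tsupport w ⊆ W → ev P w = (ev G fun x => f₁ x * w x) +
      ((ev F fun x => g x * w x) - ev (regular f₁) fun x => g x * w x) := fun hs => by
    have e1 : (fun x => (1 - κ x) * (f₁ x * w x)) = fun x => f₁ x * w x :=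
      funext fun x => by linear_combination -f₁ x * hz hs x
    have e2 : (fun x => (1 - κ x) * g x * w x) = fun x => g x * w x :=
      funext fun x => by linear_combination -g x * hz hs x
    rw [hPw, e1, e2, ev_eq_zero (w := fun x => κ x * (f₂ x * w x)) G fun x => by
      linear_combination f₂ x * hz hs x]
    ring
  refine ⟨fun hs => ?_, fun hs => ?_, fun hs => ?_⟩
  · rw [h3 (hs.trans hU), hF₁ _ (hw.mul_left hg) (tsupport_mul_subset_of hs), sub_self, add_zero]
  -- On `U₂` the part `(1 - κ) G` is a function, so its product with `f₁` cancels against the last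
  -- term of `P`.
  · have hG' : ∀ {z : ℝ → ℂ}, IsTest z → tsupport z ⊆ U₂ →
        ev G (fun x => (1 - κ x) * z x) = ∫ x, z x * ((1 - κ x) * g x) := fun hz hs => by
      rw [← ev_mul hκ' _ hz, hG _ hz hs, ev_regular hg'.continuous.locallyIntegrable hz]
    have e : (fun x => f₂ x * w x) = fun x => (1 - κ x) * (f₂ x * w x) + κ x * (f₂ x * w x) :=
      funext fun x => by ring
    rw [hPw, hF₂ _ (hw.mul_left hg') (tsupport_mul_subset_of hs), e,
      ev_add_right _ ((hw.mul_left hf₂).mul_left hκ') ((hw.mul_left hf₂).mul_left hκ),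
      hG' (hw.mul_left hf₁) (tsupport_mul_subset_of hs),
      hG' (hw.mul_left hf₂) (tsupport_mul_subset_of hs),
      ev_regular hf₁.continuous.locallyIntegrable (hw.mul_left hg'),
      ev_regular hf₂.continuous.locallyIntegrable (hw.mul_left hg')]
    have i1 : ∫ x, f₁ x * w x * ((1 - κ x) * g x) = ∫ x, (1 - κ x) * g x * w x * f₁ x :=
      congrArg _ (funext fun x => by ring)
    have i2 : ∫ x, f₂ x * w x * ((1 - κ x) * g x) = ∫ x, (1 - κ x) * g x * w x * f₂ x :=
      congrArg _ (funext fun x => by ring)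
    rw [i1, i2]
    ring
  · rw [h3 hs, ev_regular hf₁.continuous.locallyIntegrable (hw.mul_left hg)]
    have i1 : ∫ x, g x * w x * f₁ x = ∫ x, w x * (g x * f₁ x) :=
      congrArg _ (funext fun x => by ring)
    rw [i1]

theorem mul_add_mul_one_sub {κ : ℝ → ℂ} (hκ : ContDiff ℝ ∞ κ) (G : Dist) :
    mul (fun x => 1 - κ x) G + mul κ G = G := by
  have hκ' : ContDiff ℝ ∞ fun x => 1 - κ x := contDiff_const.sub hκ
  refine dist_ext_ev fun t => ?_
  rw [ev_add, ev_mul hκ' _ t.isTest, ev_mul hκ _ t.isTest,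
    ← ev_add_right _ (t.isTest.mul_left hκ') (t.isTest.mul_left hκ)]
  congr 1
  ext x
  ring

/-- A solution may a priori have further singularities to the right of `0`, and these meet `f₂`. The
cut-off splits `G` into a part that is smooth on the whole right half-line and a part that vanishes
to the left of `η / 3`, as the product formula demands. -/
theorem ev_star_left {F G : Dist} {f₁ f₂ g : ℝ → ℂ} (hf₁ : ContDiff ℝ ∞ f₁)
    (hf₂ : ContDiff ℝ ∞ f₂) (hg : ContDiff ℝ ∞ g) {η : ℝ} (hη : 0 < η)
    (hF₁ : AgreeOn F (regular f₁) (Set.Iio 0)) (hF₂ : AgreeOn F (regular f₂) (Set.Ioi 0))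
    (hG : AgreeOn G (regular g) (Set.Ioo 0 η)) {w : ℝ → ℂ} (hw : IsTest w) :
    (tsupport w ⊆ Set.Iio 0 → ev (star F G) w = ev G fun x => f₁ x * w x) ∧
    (tsupport w ⊆ Set.Ioi 0 → ev (star F G) w = ev G fun x => f₂ x * w x) ∧
    (tsupport w ⊆ Set.Iio (η / 3) → ev (star F G) w = (ev G fun x => f₁ x * w x) +
      ((ev F fun x => g x * w x) - ∫ x, w x * (g x * f₁ x))) := by
  obtain ⟨κ, hκ, h0, h1⟩ := exists_cutoff (isClosed_Iic (a := η / 3))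
    (isClosed_Ici (a := 2 * η / 3))
    (Set.disjoint_left.2 fun x hx hx' => by
      rw [Set.mem_Iic] at hx; rw [Set.mem_Ici] at hx'; linarith)
  have hκ' : ContDiff ℝ ∞ fun x => 1 - κ x := contDiff_const.sub hκ
  have hκ0 : ∀ x ∈ Set.Iio (η / 3), κ x = 0 := fun x hx =>
    (h0 x (Set.mem_Iic.2 (le_of_lt (Set.mem_Iio.1 hx)))).self_of_nhds
  have hG₁ : AgreeOn (mul (fun x => 1 - κ x) G) (regular fun x => (1 - κ x) * g x) (Set.Ioi 0) :=
    agreeOn_mul_regular hg hκ' (V := Set.Iio η) hG fun x hx => by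
      filter_upwards [h1 x (by
        rw [Set.mem_Ici]; rw [Set.mem_Iio, not_lt] at hx; linarith)] with y hy
      simp [hy]
  have hG₂ : AgreeOn (mul κ G) 0 (Set.Iio (η / 3)) := fun w hw hs => by
    rw [ev_mul hκ _ hw, ev_zero, ev_eq_zero]
    intro x
    by_cases hx : x ∈ tsupport w
    · rw [hκ0 x (hs hx), zero_mul]
    · rw [image_eq_zero_of_notMem_tsupport hx, mul_zero]
  have hs := (isStarProduct_of_left_singular hf₁ hf₂ (hκ'.mul hg) (by positivity) hF₁ hF₂ hG₁
    hG₂).star_eq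
  rw [mul_add_mul_one_sub hκ] at hs
  exact ev_localized_product hf₁ hf₂ hg hκ hF₁ hF₂ hG₁ hκ0
    (Set.Iio_subset_Iio (by positivity)) hs hw

/-- The mirror image: here the singularities of `F` at a distance to the left of `0` have to be
split off. -/
theorem ev_star_right {F G : Dist} {f g₁ g₂ : ℝ → ℂ} (hf : ContDiff ℝ ∞ f)
    (hg₁ : ContDiff ℝ ∞ g₁) (hg₂ : ContDiff ℝ ∞ g₂) {η : ℝ} (hη : 0 < η)
    (hG₁ : AgreeOn G (regular g₁) (Set.Ioi 0)) (hG₂ : AgreeOn G (regular g₂) (Set.Iio 0))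
    (hF : AgreeOn F (regular f) (Set.Ioo (-η) 0)) {w : ℝ → ℂ} (hw : IsTest w) :
    (tsupport w ⊆ Set.Ioi 0 → ev (star F G) w = ev F fun x => g₁ x * w x) ∧
    (tsupport w ⊆ Set.Iio 0 → ev (star F G) w = ev F fun x => g₂ x * w x) ∧
    (tsupport w ⊆ Set.Ioi (-(η / 3)) → ev (star F G) w = (ev F fun x => g₁ x * w x) +
      ((ev G fun x => f x * w x) - ∫ x, w x * (f x * g₁ x))) := by
  obtain ⟨κ, hκ, h0, h1⟩ := exists_cutoff (isClosed_Ici (a := -(η / 3)))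
    (isClosed_Iic (a := -(2 * η / 3))) (Set.disjoint_left.2 fun x hx hx' => by
      rw [Set.mem_Ici] at hx; rw [Set.mem_Iic] at hx'; linarith)
  have hκ' : ContDiff ℝ ∞ fun x => 1 - κ x := contDiff_const.sub hκ
  have hκ0 : ∀ x ∈ Set.Ioi (-(η / 3)), κ x = 0 := fun x hx =>
    (h0 x (Set.mem_Ici.2 (le_of_lt (Set.mem_Ioi.1 hx)))).self_of_nhds
  have hF₁ : AgreeOn (mul (fun x => 1 - κ x) F) (regular fun x => (1 - κ x) * f x) (Set.Iio 0) :=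
    agreeOn_mul_regular hf hκ' (V := Set.Ioi (-η)) (by rwa [Set.Iio_inter_Ioi]) fun x hx => by
      filter_upwards [h1 x (by
        rw [Set.mem_Iic]; rw [Set.mem_Ioi, not_lt] at hx; linarith)] with y hy
      simp [hy]
  have hF₂ : AgreeOn (mul κ F) 0 (Set.Ioi (-(η / 3))) := fun w hw hs => by
    rw [ev_mul hκ _ hw, ev_zero, ev_eq_zero]
    intro x
    by_cases hx : x ∈ tsupport w
    · rw [hκ0 x (hs hx), zero_mul]
    · rw [image_eq_zero_of_notMem_tsupport hx, mul_zero]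
  have hs := (isStarProduct_of_right_singular (hκ'.mul hf) hg₁ hg₂ (by positivity) hF₁ hF₂ hG₁
    hG₂).star_eq
  rw [mul_add_mul_one_sub hκ] at hs
  exact ev_localized_product hg₁ hg₂ hf hκ hG₁ hG₂ hF₁ hκ0
    (Set.Ioi_subset_Ioi (by linarith)) hs hw

theorem D_iterate_add (i k : ℕ) (F : Dist) : D^[i] (D^[k] F) = D^[k + i] F := by
  rw [← Function.iterate_add_apply, add_comm]

namespace Coeffs

variable {n : ℕ} (E : Coeffs n)

/-- How `L ψ` acts on test functions, when near `0` the distribution `ψ` is the derivative of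
order `k` of a function with a jump. -/
theorem ev_L {ψ : Dist} {k : ℕ} {u v : ℝ → ℂ} (hu : ContDiff ℝ ∞ u) (hv : ContDiff ℝ ∞ v) {η : ℝ}
    (hη : 0 < η) (hψ : AgreeOn ψ (D^[k] (regular (glueAt 0 u v))) (Set.Ioo (-η) η)) {w : ℝ → ℂ}
    (hw : IsTest w) :
    (tsupport w ⊆ Set.Iio 0 → ev (E.L ψ) w = ∑ i : Fin (n + 1),
      ev (D^[i] ψ) fun x => (E.aNeg i x + E.bNeg i x) * w x) ∧
    (tsupport w ⊆ Set.Ioi 0 → ev (E.L ψ) w = ∑ i : Fin (n + 1),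
      ev (D^[i] ψ) fun x => (E.aPos i x + E.bPos i x) * w x) ∧
    (tsupport w ⊆ Set.Ioo (-(η / 3)) (η / 3) → ev (E.L ψ) w =
      (∑ i : Fin (n + 1), ev (D^[i] ψ) fun x => (E.aNeg i x + E.bPos i x) * w x) +
      ∑ i : Fin (n + 1), (((ev (E.a i) fun x => iteratedDeriv (k + i) v x * w x) -
          ∫ x, w x * (iteratedDeriv (k + i) v x * E.aNeg i x)) +
        ((ev (E.b i) fun x => iteratedDeriv (k + i) u x * w x) -
          ∫ x, w x * (iteratedDeriv (k + i) u x * E.bPos i x)))) := by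
  -- Near `0` but off it, the derivatives of `ψ` are those of the branches; the products need the
  -- right branch for `aᵢ` and the left one for `bᵢ`.
  have hr : ∀ i, AgreeOn (D^[i] ψ) (regular (iteratedDeriv (k + i) v)) (Set.Ioo 0 η) := fun i =>
    (((hψ.D_iterate i).mono (Set.Ioo_subset_Ioo_left (by linarith))).trans (by
      rw [D_iterate_add]
      exact (agreeOn_D_glueAt hu hv (k + i)).2.mono Set.Ioo_subset_Ioi_self))
  have hl : ∀ i, AgreeOn (D^[i] ψ) (regular (iteratedDeriv (k + i) u)) (Set.Ioo (-η) 0) := fun i =>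
    (((hψ.D_iterate i).mono (Set.Ioo_subset_Ioo_right hη.le)).trans (by
      rw [D_iterate_add]
      exact (agreeOn_D_glueAt hu hv (k + i)).1.mono Set.Ioo_subset_Iio_self))
  have ha := fun i : Fin (n + 1) => ev_star_left (E.smooth_aNeg i) (E.smooth_aPos i)
    (contDiff_iteratedDeriv hv (k + i)) hη (E.agreeOn_a_neg i) (E.agreeOn_a_pos i) (hr i) hw
  have hb := fun i : Fin (n + 1) => ev_star_right (contDiff_iteratedDeriv hu (k + i))
    (E.smooth_bPos i) (E.smooth_bNeg i) hη (E.agreeOn_b_pos i) (E.agreeOn_b_neg i) (hl i) hw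
  have hadd : ∀ (F : Dist) {f g : ℝ → ℂ}, ContDiff ℝ ∞ f → ContDiff ℝ ∞ g →
      ev F (fun x => (f x + g x) * w x) = ev F (fun x => f x * w x) + ev F (fun x => g x * w x) :=
    fun F f g hf hg => by
      rw [← ev_add_right _ (hw.mul_left hf) (hw.mul_left hg)]
      exact congrArg _ (funext fun x => by ring)
  rw [L, ev_sum]
  refine ⟨fun hs => Finset.sum_congr rfl fun i _ => ?_,
    fun hs => Finset.sum_congr rfl fun i _ => ?_, fun hs => ?_⟩
  · rw [ev_add, (ha i).1 hs, (hb i).2.1 hs, hadd _ (E.smooth_aNeg i) (E.smooth_bNeg i)]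
  · rw [ev_add, (ha i).2.1 hs, (hb i).1 hs, hadd _ (E.smooth_aPos i) (E.smooth_bPos i)]
  · rw [← Finset.sum_add_distrib]
    refine Finset.sum_congr rfl fun i _ => ?_
    rw [ev_add, (ha i).2.2 (hs.trans Set.Ioo_subset_Iio_self),
      (hb i).2.2 (hs.trans Set.Ioo_subset_Ioi_self), hadd _ (E.smooth_aNeg i) (E.smooth_bPos i)]
    ring

end Coeffs

/-! ### Delta orders and the vanishing of jumps. -/

/-- On test functions, `T` is the sum of a locally integrable function and of derivatives of order
less than `r` of the Dirac measure at `p`. -/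
def HasDeltaOrder (r : ℕ) (p : ℝ) (T : (ℝ → ℂ) → ℂ) : Prop :=
  ∃ (e : ℕ → ℂ) (h : ℝ → ℂ), LocallyIntegrable h ∧ ∀ w, IsTest w →
    T w = (∫ x, w x * h x) + ∑ l ∈ Finset.range r, e l * iteratedDeriv l w p

namespace HasDeltaOrder

variable {r : ℕ} {p : ℝ} {T T' : (ℝ → ℂ) → ℂ}

theorem congr (h : HasDeltaOrder r p T) (e : ∀ w, IsTest w → T' w = T w) :
    HasDeltaOrder r p T' := by
  obtain ⟨c, g, hg, h⟩ := h
  exact ⟨c, g, hg, fun w hw => (e w hw).trans (h w hw)⟩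

theorem integral {h : ℝ → ℂ} (hh : LocallyIntegrable h) :
    HasDeltaOrder r p fun w => ∫ x, w x * h x :=
  ⟨0, h, hh, fun w _ => by simp⟩

theorem add (h : HasDeltaOrder r p T) (h' : HasDeltaOrder r p T') :
    HasDeltaOrder r p fun w => T w + T' w := by
  obtain ⟨c, g, hg, h⟩ := h
  obtain ⟨c', g', hg', h'⟩ := h'
  refine ⟨c + c', g + g', hg.add hg', fun w hw => ?_⟩
  simp only [h w hw, h' w hw, Pi.add_apply, mul_add, add_mul, Finset.sum_add_distrib]
  rw [integral_add (hw.integrable_mul hg) (hw.integrable_mul hg')]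
  ring

theorem const_mul (h : HasDeltaOrder r p T) (z : ℂ) : HasDeltaOrder r p fun w => z * T w := by
  obtain ⟨c, g, hg, h⟩ := h
  refine ⟨fun l => z * c l, fun x => z * g x, hg.smul z, fun w hw => ?_⟩
  beta_reduce
  rw [h w hw, mul_add, ← integral_const_mul, Finset.mul_sum]
  congr 1
  · exact congrArg _ (funext fun x => by ring)
  · exact Finset.sum_congr rfl fun l _ => by ring

theorem sub (h : HasDeltaOrder r p T) (h' : HasDeltaOrder r p T') :
    HasDeltaOrder r p fun w => T w - T' w :=
  (h.add (h'.const_mul (-1))).congr fun w _ => by ring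

theorem zero : HasDeltaOrder r p fun _ => 0 :=
  (integral (h := fun _ => 0) continuous_const.locallyIntegrable).congr fun w _ => by simp

theorem sum {ι : Type*} (s : Finset ι) {T : ι → (ℝ → ℂ) → ℂ}
    (h : ∀ i ∈ s, HasDeltaOrder r p (T i)) : HasDeltaOrder r p fun w => ∑ i ∈ s, T i w := by
  classical
  induction s using Finset.induction_on with
  | empty => simpa using zero
  | insert a s ha ih =>
    simp only [Finset.sum_insert ha]
    exact (h a (by simp)).add (ih fun i hi => h i (Finset.mem_insert_of_mem hi))

theorem eval {l : ℕ} (hl : l < r) : HasDeltaOrder r p fun w => iteratedDeriv l w p :=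
  ⟨Pi.single l 1, 0, continuous_const.locallyIntegrable, fun w _ => by
    simp [Pi.single_apply, hl]⟩

theorem mono {r' : ℕ} (h : HasDeltaOrder r p T) (hr : r ≤ r') : HasDeltaOrder r' p T := by
  obtain ⟨c, g, hg, h⟩ := h
  exact ((integral hg).add (sum (Finset.range r) fun l hl =>
    (eval (lt_of_lt_of_le (Finset.mem_range.1 hl) hr)).const_mul (c l))).congr h

theorem eval_mul {q : ℕ} (hq : q < r) {g : ℝ → ℂ} (hg : ContDiff ℝ ∞ g) :
    HasDeltaOrder r p fun w => iteratedDeriv q (fun x => g x * w x) p := by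
  refine (sum (Finset.range (q + 1)) (T := fun j w =>
    ((q.choose j : ℂ) * iteratedDeriv j g p) * iteratedDeriv (q - j) w p) fun j _ =>
      (eval (by omega)).const_mul _).congr fun w hw => iteratedDeriv_fun_mul hg hw.1 q p

/-- The leading part of a derivative of a Dirac measure multiplied by a function. -/
theorem eval_mul_sub {g : ℝ → ℂ} (hg : ContDiff ℝ ∞ g) :
    HasDeltaOrder r p fun w =>
      iteratedDeriv r (fun x => g x * w x) p - g p * iteratedDeriv r w p := by
  refine (sum (Finset.range r) (T := fun j w =>
    ((r.choose (j + 1) : ℂ) * iteratedDeriv (j + 1) g p) * iteratedDeriv (r - (j + 1)) w p)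
      fun j hj => (eval (by have := Finset.mem_range.1 hj; omega)).const_mul _).congr
        fun w hw => ?_
  rw [iteratedDeriv_fun_mul hg hw.1 r p, Finset.sum_range_succ']
  simp

/-- Neither a locally integrable function nor lower derivatives of the Dirac measure can reproduce
the derivative of order `r`, even on a small neighbourhood; this is the scaling lemma with `m = 0`.
-/
theorem eq_zero (h : HasDeltaOrder r p T) {z : ℂ} {η : ℝ} (hη : 0 < η)
    (hz : ∀ w, IsTest w → tsupport w ⊆ Set.Ioo (p - η) (p + η) → T w = z * iteratedDeriv r w p) :
    z = 0 := by
  obtain ⟨c, g, hg, h⟩ := h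
  have := coeff_eq_zero_of_integral hη (e := fun l => if l = r then z else -c l) (N := r + 1)
    (m := 0) (c := 1) hg (fun w hw hs => by
      have h1 := h w hw
      rw [hz w hw hs] at h1
      rw [Finset.sum_range_succ, if_pos rfl, h1, Finset.sum_congr rfl fun l hl => by
        rw [if_neg (Finset.mem_range.1 hl).ne, neg_mul], Finset.sum_neg_distrib]
      simp) (l := r) (by omega) (Nat.zero_le _)
  simpa using this

theorem ev_coeff_mul {f₁ f₂ g : ℝ → ℂ} (hf₁ : ContDiff ℝ ∞ f₁) (hf₂ : ContDiff ℝ ∞ f₂)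
    (hg : ContDiff ℝ ∞ g) {c : ℕ →₀ ℂ} (hc : ∀ k, r ≤ k → c k = 0) :
    HasDeltaOrder r 0 fun w => ev (regular (glue f₁ f₂) + deltaSum c) fun x => g x * w x := by
  have hi : LocallyIntegrable (glue f₁ f₂) volume :=
    locallyIntegrable_glueAt 0 hf₁.continuous hf₂.continuous
  refine ((integral (h := fun x => g x * glue f₁ f₂ x) ?_).add
    (sum (Finset.range r) fun k hk => ((eval_mul (Finset.mem_range.1 hk) hg).const_mul
      (c k * (-1) ^ k)))).congr fun w hw => ?_
  · have : (fun x => g x * glue f₁ f₂ x) = glueAt 0 (fun x => g x * f₁ x) fun x => g x * f₂ x := by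
      ext x
      simp only [glue, glueAt]
      split_ifs <;> rfl
    rw [this]
    exact locallyIntegrable_glueAt 0 (hg.mul hf₁).continuous (hg.mul hf₂).continuous
  · rw [ev_coeff hf₁ hf₂ hc (hw.mul_left hg)]
    congr 1
    · exact congrArg _ (funext fun x => by ring)
    · exact Finset.sum_congr rfl fun l _ => by ring

end HasDeltaOrder

theorem locallyIntegrable_mul_glueAt {p : ℝ} {c u v : ℝ → ℂ} (hc : Continuous c)
    (hu : Continuous u) (hv : Continuous v) : LocallyIntegrable fun x => c x * glueAt p u v x := by
  have : (fun x => c x * glueAt p u v x) = glueAt p (fun x => c x * u x) fun x => c x * v x := by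
    ext x
    simp only [glueAt]
    split_ifs <;> rfl
  rw [this]
  exact locallyIntegrable_glueAt p (hc.mul hu) (hc.mul hv)

/-- If the jumps of order less than `m` vanish, the singular part of the `N`-th derivative has its
leading term in order `N - 1 - m`. -/
theorem hasDeltaOrder_ev_D_glueAt {p : ℝ} {c u v : ℝ → ℂ} (hc : ContDiff ℝ ∞ c)
    (hu : ContDiff ℝ ∞ u) (hv : ContDiff ℝ ∞ v) {m N r : ℕ}
    (hJ : ∀ q < m, iteratedDeriv q v p = iteratedDeriv q u p) (hr : N ≤ m + 1 + r) :
    HasDeltaOrder r p fun w => ev (D^[N] (regular (glueAt p u v))) (fun x => c x * w x) -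
      (if N = m + 1 + r then (-1) ^ r * (iteratedDeriv m v p - iteratedDeriv m u p) * c p else 0) *
        iteratedDeriv r w p := by
  set J : ℕ → ℂ := fun q => iteratedDeriv q v p - iteratedDeriv q u p with hJdef
  have hJ0 : ∀ q < m, J q = 0 := fun q hq => by rw [hJdef]; exact sub_eq_zero.2 (hJ q hq)
  have hi : HasDeltaOrder r p fun w =>
      ∫ x, w x * (c x * glueAt p (iteratedDeriv N u) (iteratedDeriv N v) x) :=
    .integral (locallyIntegrable_mul_glueAt hc.continuous
      (contDiff_iteratedDeriv hu N).continuous (contDiff_iteratedDeriv hv N).continuous)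
  have hs : HasDeltaOrder r p fun w => ∑ j ∈ Finset.range N,
      ((-1) ^ j * J (N - 1 - j) * iteratedDeriv j (fun x => c x * w x) p -
        if j = r then (-1) ^ r * J (N - 1 - r) * c p * iteratedDeriv r w p else 0) := by
    refine .sum _ fun j hj => ?_
    have hj := Finset.mem_range.1 hj
    -- Terms `j < r` already have low order, `j = r` is the leading one, and for `j > r` the jump
    -- has order below `m` and vanishes.
    rcases lt_trichotomy j r with h | rfl | h
    · simp only [if_neg h.ne, sub_zero]
      exact (HasDeltaOrder.eval_mul h hc).const_mul _
    · exact ((HasDeltaOrder.eval_mul_sub hc).const_mul ((-1) ^ j * J (N - 1 - j))).congr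
        fun w _ => by simp only [if_true]; ring
    · simp only [if_neg h.ne', sub_zero, hJ0 (N - 1 - j) (by omega), mul_zero, zero_mul]
      exact .zero
  refine (hi.add hs).congr fun w hw => ?_
  have h1 : ∫ x, w x * (c x * glueAt p (iteratedDeriv N u) (iteratedDeriv N v) x) =
      ∫ x, c x * w x * glueAt p (iteratedDeriv N u) (iteratedDeriv N v) x :=
    congrArg _ (funext fun x => by ring)
  rw [ev_D_regular_glueAt p hu hv (hw.mul_left hc), Finset.sum_sub_distrib, h1,
    Finset.sum_ite_eq' (Finset.range N) r]
  have h2 : (if r ∈ Finset.range N then (-1) ^ r * J (N - 1 - r) * c p * iteratedDeriv r w p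
      else 0) = (if N = m + 1 + r then (-1) ^ r * J m * c p else 0) * iteratedDeriv r w p := by
    by_cases hN : N = m + 1 + r
    · rw [if_pos hN, if_pos (Finset.mem_range.2 (by omega)), show N - 1 - r = m by omega]
    -- If `N < m + 1 + r`, the jump in the term `j = r` also has order below `m`.
    · rw [if_neg hN, zero_mul]
      split_ifs with h
      · rw [hJ0 _ (by have := Finset.mem_range.1 h; omega)]
        ring
      · rfl
  rw [h2]
  ring

/-- The jumps of low order vanish, if the derivatives of the function with a jump satisfy near `p`
a differential equation of order `n` with a right-hand side of low delta order. -/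
theorem jump_eq_zero {n : ℕ} {c : Fin (n + 1) → ℝ → ℂ} (hc : ∀ i, ContDiff ℝ ∞ (c i)) {p : ℝ}
    (hp : c (Fin.last n) p ≠ 0) {u v : ℝ → ℂ} (hu : ContDiff ℝ ∞ u) (hv : ContDiff ℝ ∞ v)
    {k r : ℕ} {T : (ℝ → ℂ) → ℂ} (hT : HasDeltaOrder r p T) {η : ℝ} (hη : 0 < η)
    (h : ∀ w, IsTest w → tsupport w ⊆ Set.Ioo (p - η) (p + η) →
      ∑ i : Fin (n + 1), ev (D^[k + i] (regular (glueAt p u v))) (fun x => c i x * w x) = T w)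
    (m : ℕ) (hm : m + r + 1 ≤ k + n) : iteratedDeriv m v p = iteratedDeriv m u p := by
  induction m using Nat.strong_induction_on with
  | _ m ih =>
    have hJ : ∀ q < m, iteratedDeriv q v p = iteratedDeriv q u p := fun q hq => ih q hq (by omega)
    -- In the top term the `m`-th jump is the coefficient of the derivative of order `s` of the
    -- Dirac measure; the bound on `m` says `r ≤ s`, so `T` cannot compensate it.
    obtain ⟨s, hs⟩ : ∃ s, k + n = m + 1 + s := ⟨k + n - (m + 1), by omega⟩
    have h1 := HasDeltaOrder.sum Finset.univ fun (i : Fin (n + 1)) _ =>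
      hasDeltaOrder_ev_D_glueAt (hc i) hu hv hJ (N := k + i) (r := s)
        (by have := i.2; omega)
    have h2 := ((hT.mono (show r ≤ s by omega)).sub h1).eq_zero
      (z := (-1) ^ s * (iteratedDeriv m v p - iteratedDeriv m u p) * c (Fin.last n) p) hη
      fun w hw hsw => by
        rw [Finset.sum_sub_distrib, h w hw hsw, sub_sub_cancel, ← Finset.sum_mul,
          Finset.sum_eq_single (Fin.last n)]
        · rw [if_pos (by simpa using hs)]
        -- For `i < n` the order `k + i` is too small for the `m`-th jump to reach order `s`.
        · intro i _ hi
          rw [if_neg]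
          have : (i : ℕ) ≠ n := fun h => hi (Fin.ext h)
          omega
        · simp
    have h3 : ((-1 : ℂ)) ^ s ≠ 0 := pow_ne_zero _ (by norm_num)
    simpa [h3, hp, sub_eq_zero] using h2

/-! ### Local smoothness of solutions. -/

/-- The difference `v - u` is flat at `p`, so it stays smooth when replaced by zero to the left of
`p`. -/
theorem contDiff_glueAt {p : ℝ} {u v : ℝ → ℂ} (hu : ContDiff ℝ ∞ u) (hv : ContDiff ℝ ∞ v)
    (h : ∀ m, iteratedDeriv m v p = iteratedDeriv m u p) : ContDiff ℝ ∞ (glueAt p u v) := by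
  have hd : ContDiff ℝ ∞ fun x => v x - u x := hv.sub hu
  have hd0 : ∀ m, iteratedDeriv m (fun x => v x - u x) p = 0 := fun m => by
    have := iteratedDeriv_fun_sub (n := m) (x := p) (hv.of_le (by exact_mod_cast le_top)).contDiffAt
      (hu.of_le (by exact_mod_cast le_top)).contDiffAt
    rw [this, h m, sub_self]
  have hl : Set.EqOn (glueAt p (fun _ => 0) fun x => v x - u x) (fun _ => 0) (Set.Iio p) :=
    fun x hx => if_pos hx
  have hr : Set.EqOn (glueAt p (fun _ => 0) fun x => v x - u x) (fun x => v x - u x) (Set.Ioi p) :=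
    fun x hx => if_neg (not_lt.2 (le_of_lt hx))
  have hG : ContDiff ℝ ∞ (glueAt p (fun _ => 0) fun x => v x - u x) := by
    refine contDiff_of_flat (p := p) ?_ (fun x hx => ?_) fun j => tendsto_punctured ?_ ?_
    · simpa [glueAt] using hd0 0
    · rcases lt_or_gt_of_ne hx with h | h
      · exact (contDiffAt_const.congr_of_eventuallyEq
          (hl.eventuallyEq_of_mem (isOpen_Iio.mem_nhds h))).contDiffWithinAt
      · exact (hd.contDiffAt.congr_of_eventuallyEq
          (hr.eventuallyEq_of_mem (isOpen_Ioi.mem_nhds h))).contDiffWithinAt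
    · exact tendsto_const_nhds.congr' (((hl.iteratedDeriv_of_isOpen isOpen_Iio j).trans
        fun x _ => by simp).symm.eventuallyEq_of_mem self_mem_nhdsWithin)
    · have ht := (contDiff_iteratedDeriv hd j).continuous.tendsto p
      rw [hd0 j] at ht
      exact (ht.mono_left
        nhdsWithin_le_nhds).congr' ((hr.iteratedDeriv_of_isOpen isOpen_Ioi
          j).symm.eventuallyEq_of_mem self_mem_nhdsWithin)
  have e : glueAt p u v = fun x => u x + glueAt p (fun _ => 0) (fun x => v x - u x) x := by
    ext x
    simp only [glueAt]
    split_ifs <;> ring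
  rw [e]
  exact hu.add hG

theorem D_iterate_regular_glueAt {p : ℝ} {u v : ℝ → ℂ} (hu : ContDiff ℝ ∞ u) (hv : ContDiff ℝ ∞ v)
    {k : ℕ} (h : ∀ m < k, iteratedDeriv m v p = iteratedDeriv m u p) :
    D^[k] (regular (glueAt p u v)) =
      regular (glueAt p (iteratedDeriv k u) (iteratedDeriv k v)) := by
  refine dist_ext_ev fun t => ?_
  rw [ev_D_regular_glueAt p hu hv t.isTest, ev_regular (locallyIntegrable_glueAt p
    (contDiff_iteratedDeriv hu k).continuous (contDiff_iteratedDeriv hv k).continuous) t.isTest,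
    Finset.sum_eq_zero, add_zero]
  intro j hj
  have := Finset.mem_range.1 hj
  rw [h _ (by omega), sub_self, mul_zero, zero_mul]

theorem eqOn_diffOp {n : ℕ} {c : Fin (n + 1) → ℝ → ℂ} (hc : ∀ i, ContDiff ℝ ∞ (c i)) {ψ : Dist}
    {f u : ℝ → ℂ} (hf : ContDiff ℝ ∞ f) (hu : ContDiff ℝ ∞ u) {O : Set ℝ} (hO : IsOpen O)
    (hψ : AgreeOn ψ (regular u) O)
    (h : ∀ w, IsTest w → tsupport w ⊆ O →
      ∑ i : Fin (n + 1), ev (D^[i] ψ) (fun x => c i x * w x) = ev (regular f) w) :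
    Set.EqOn (fun x => ∑ i : Fin (n + 1), c i x * iteratedDeriv i u x) f O := by
  have hd := contDiff_diffOp Finset.univ hc (fun i : Fin (n + 1) => (i : ℕ)) hu
  refine eqOn_of_agreeOn (F := regular f) hO hd.continuous hf.continuous (fun w hw hs => ?_)
    fun w _ _ => rfl
  rw [← h w hw hs, ev_regular hd.continuous.locallyIntegrable hw,
    Finset.sum_congr rfl fun (i : Fin (n + 1)) _ => hψ.D_iterate i _ (hw.mul_left (hc i))
      (tsupport_mul_subset_of hs)]
  have hi : ∀ i : Fin (n + 1), Integrable fun x => c i x * w x * iteratedDeriv i u x := fun i =>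
    (hw.mul_left (hc i)).integrable_mul (contDiff_iteratedDeriv hu i).continuous.locallyIntegrable
  rw [Finset.sum_congr rfl fun (i : Fin (n + 1)) _ => by
    rw [D_iterate_regular hu, ev_regular (contDiff_iteratedDeriv hu
      i).continuous.locallyIntegrable (hw.mul_left (hc i))], ← integral_finsetSum _ fun i _ => hi i]
  congr 1
  ext x
  rw [Finset.mul_sum]
  exact Finset.sum_congr rfl fun i _ => by ring

/-- A derivative of a function with a jump that satisfies near `p` a differential equation with
smooth coefficients, and with nonzero leading coefficient at `p`, is smooth near `p`. -/
theorem exists_agreeOn_smooth {n : ℕ} {c : Fin (n + 1) → ℝ → ℂ} (hc : ∀ i, ContDiff ℝ ∞ (c i))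
    {p : ℝ} (hp : c (Fin.last n) p ≠ 0) {u v f : ℝ → ℂ} (hu : ContDiff ℝ ∞ u)
    (hv : ContDiff ℝ ∞ v) (hf : ContDiff ℝ ∞ f) {ψ : Dist} {k : ℕ} {η : ℝ} (hη : 0 < η)
    (hψ : AgreeOn ψ (D^[k] (regular (glueAt p u v))) (Set.Ioo (p - η) (p + η)))
    (h : ∀ w, IsTest w → tsupport w ⊆ Set.Ioo (p - η) (p + η) →
      ∑ i : Fin (n + 1), ev (D^[i] ψ) (fun x => c i x * w x) = ev (regular f) w) :
    ∃ s, ContDiff ℝ ∞ s ∧ ∃ V, IsOpen V ∧ p ∈ V ∧ AgreeOn ψ (regular s) V := by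
  -- The right-hand side is a function, so `r = 0` and all jumps of order below `k + n` vanish.
  have hJ := jump_eq_zero hc hp hu hv (k := k) (HasDeltaOrder.integral (r := 0) (p := p)
    hf.continuous.locallyIntegrable) hη fun w hw hs => by
      rw [← ev_regular hf.continuous.locallyIntegrable hw, ← h w hw hs]
      refine Finset.sum_congr rfl fun i _ => ?_
      rw [← D_iterate_add, hψ.D_iterate i _ (hw.mul_left (hc i)) (tsupport_mul_subset_of hs)]
  have hl := eqOn_diffOp hc hf (contDiff_iteratedDeriv hu k) (isOpen_Ioo (a := p - η) (b := p))
    ((hψ.mono (Set.Ioo_subset_Ioo_right (by linarith))).trans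
      ((agreeOn_D_glueAt hu hv k).1.mono Set.Ioo_subset_Iio_self))
    fun w hw hs => h w hw (hs.trans (Set.Ioo_subset_Ioo_right (by linarith)))
  have hr := eqOn_diffOp hc hf (contDiff_iteratedDeriv hv k) (isOpen_Ioo (a := p) (b := p + η))
    ((hψ.mono (Set.Ioo_subset_Ioo_left (by linarith))).trans
      ((agreeOn_D_glueAt hu hv k).2.mono Set.Ioo_subset_Ioi_self))
    fun w hw hs => h w hw (hs.trans (Set.Ioo_subset_Ioo_left (by linarith)))
  have hall : ∀ m, iteratedDeriv m v p = iteratedDeriv m u p := fun m => by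
    rcases lt_or_ge m (k + n) with hm | hm
    · exact hJ m hm
    -- For higher orders: the `k`-th derivatives of `u` and `v` solve the same equation on their
    -- sides of `p` and share the jet of length `n` there, so the recursion makes all their
    -- derivatives agree.
    obtain ⟨q, rfl⟩ : ∃ q, m = q + k := ⟨m - k, by omega⟩
    obtain ⟨R, hR⟩ := exists_jet_recursion hc hp (q + 1) q
    have hq : q < n + (q + 1) := by omega
    rw [← iteratedDeriv_iteratedDeriv, ← iteratedDeriv_iteratedDeriv,
      hR hq _ f (contDiff_iteratedDeriv hu k) fun q => iteratedDeriv_eq_of_eqOn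
        (contDiff_diffOp _ hc _ (contDiff_iteratedDeriv hu k)) hf isOpen_Ioo hl q
        (by rw [closure_Ioo (by linarith)]; exact Set.right_mem_Icc.2 (by linarith)),
      hR hq _ f (contDiff_iteratedDeriv hv k) fun q => iteratedDeriv_eq_of_eqOn
        (contDiff_diffOp _ hc _ (contDiff_iteratedDeriv hv k)) hf isOpen_Ioo hr q
        (by rw [closure_Ioo (by linarith)]; exact Set.left_mem_Icc.2 (by linarith))]
    congr 3
    ext j
    rw [iteratedDeriv_iteratedDeriv, iteratedDeriv_iteratedDeriv, hJ _ (by have := j.2; omega)]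
  have hs := contDiff_glueAt hu hv hall
  rw [D_iterate_regular hs] at hψ
  exact ⟨_, contDiff_iteratedDeriv hs k, _, isOpen_Ioo, ⟨by linarith, by linarith⟩, hψ⟩

/-- A distribution that is locally a smooth function on `O`, and equal to `u₀` on `O ∩ N`, where
`O` and `N` cover the line, is on `O` a smooth function that extends `u₀`. -/
theorem exists_contDiff_agreeOn {ψ : Dist} {O N : Set ℝ} (hO : IsOpen O) (hN : IsOpen N)
    (hON : ∀ x, x ∈ O ∨ x ∈ N)
    (h : ∀ p ∈ O, ∃ s, ContDiff ℝ ∞ s ∧ ∃ V, IsOpen V ∧ p ∈ V ∧ AgreeOn ψ (regular s) V)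
    {u₀ : ℝ → ℂ} (hu₀ : ContDiff ℝ ∞ u₀) (h₀ : AgreeOn ψ (regular u₀) (O ∩ N)) :
    ∃ u, ContDiff ℝ ∞ u ∧ AgreeOn ψ (regular u) O ∧ Set.EqOn u u₀ N := by
  classical
  choose! s hs V hV hpV hψ using h
  -- At each point of `O` the value comes from the representative chosen for that point; uniqueness
  -- of continuous representatives makes the choices consistent.
  let u : ℝ → ℂ := fun x => if x ∈ O then s x x else u₀ x
  have huN : Set.EqOn u u₀ N := fun x hx => by
    by_cases hxO : x ∈ O
    · exact (if_pos hxO).trans (eqOn_of_agreeOn ((hV x hxO).inter (hO.inter hN))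
        (hs x hxO).continuous hu₀.continuous ((hψ x hxO).mono Set.inter_subset_left)
        (h₀.mono Set.inter_subset_right) ⟨hpV x hxO, hxO, hx⟩)
    · exact if_neg hxO
  have huO : ∀ p ∈ O, Set.EqOn u (s p) (V p ∩ O) := fun p hp x hx =>
    (if_pos hx.2).trans (eqOn_of_agreeOn ((hV x hx.2).inter (hV p hp))
      (hs x hx.2).continuous (hs p hp).continuous ((hψ x hx.2).mono Set.inter_subset_left)
      ((hψ p hp).mono Set.inter_subset_right) ⟨hpV x hx.2, hx.1⟩)
  have hu : ContDiff ℝ ∞ u := contDiff_iff_contDiffAt.2 fun x => by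
    rcases hON x with hx | hx
    · exact (hs x hx).contDiffAt.congr_of_eventuallyEq
        ((huO x hx).eventuallyEq_of_mem (((hV x hx).inter hO).mem_nhds ⟨hpV x hx, hx⟩))
    · exact hu₀.contDiffAt.congr_of_eventuallyEq (huN.eventuallyEq_of_mem (hN.mem_nhds hx))
  refine ⟨u, hu, agreeOn_of_local fun p hp => ⟨V p ∩ O, (hV p hp).inter hO,
    ⟨hpV p hp, hp⟩, ?_⟩, huN⟩
  exact ((hψ p hp).mono Set.inter_subset_left).trans (agreeOn_regular_of_eqOn
    (hs p hp).continuous.locallyIntegrable hu.continuous.locallyIntegrable (huO p hp).symm)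

/-! ### Every solution is glued from two smooth branches. -/

namespace Coeffs

variable {n : ℕ} {E : Coeffs n}

/-- Sectional regularity excludes zeros of the leading coefficient, where not all the coefficients
vanish. -/
theorem SectionallyRegular.leading_ne_zero {f : ℝ → ℂ} (h : E.SectionallyRegular f) {U : Set ℝ}
    (hU : IsOpen U) (hc : U.OrdConnected) {α β : Fin (n + 1) → ℝ → ℂ}
    (hα : ∀ i, ContDiff ℝ ∞ (α i)) (hβ : ∀ i, ContDiff ℝ ∞ (β i))
    (ha : ∀ i, AgreeOn (E.a i) (regular (α i)) U) (hb : ∀ i, AgreeOn (E.b i) (regular (β i)) U)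
    {x : ℝ} (hx : x ∈ U) (hz : ∃ i, α i x + β i x ≠ 0) :
    α (Fin.last n) x + β (Fin.last n) x ≠ 0 := fun h0 => by
  -- At a zero of the leading coefficient the equation involves only the initial values, and a
  -- solution exists for all of them. So the relation holds for every `C`, which makes the remaining
  -- coefficients vanish too.
  have key : ∀ C : Fin n → ℂ,
      ∑ i : Fin n, (α i.castSucc x + β i.castSucc x) * C i = f x := fun C => by
    obtain ⟨⟨φ, -, hφ, hC⟩, -⟩ := h U hU hc ⟨x, hx⟩ α β
      (fun i => ⟨(hα i).contDiffOn,
        (eqFunOn_iff_agreeOn (hα i).continuous.locallyIntegrable).2 (ha i)⟩)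
      (fun i => ⟨(hβ i).contDiffOn,
        (eqFunOn_iff_agreeOn (hβ i).continuous.locallyIntegrable).2 (hb i)⟩) x
      (subset_closure hx) C
    have := hφ x (subset_closure hx)
    rw [Fin.sum_univ_castSucc, h0, zero_mul, add_zero] at this
    rw [← this]
    exact Finset.sum_congr rfl fun i _ => by rw [← hC i]; rfl
  have hf : f x = 0 := by simpa using (key 0).symm
  obtain ⟨i, hi⟩ := hz
  induction i using Fin.lastCases with
  | last => exact hi h0
  | cast i =>
    have := key (Pi.single i 1)
    rw [hf] at this
    simp only [Pi.single_apply, mul_ite, mul_one, mul_zero, Finset.sum_ite_eq',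
      Finset.mem_univ, if_true] at this
    exact hi this

/-- Comparing delta orders removes the singular part at `0`, where the mixed leading coefficient
counts, and gives smoothness on each half-line; the branches known near `0` are then continued over
the half-lines. -/
theorem IsSolution.exists_glue {f : ℝ → ℂ} (hf : ContDiff ℝ ∞ f) (hM : E.M ≤ n)
    (h0 : E.aNeg (Fin.last n) 0 + E.bPos (Fin.last n) 0 ≠ 0)
    (hneg : ∀ x < 0, E.aNeg (Fin.last n) x + E.bNeg (Fin.last n) x ≠ 0)
    (hpos : ∀ x > 0, E.aPos (Fin.last n) x + E.bPos (Fin.last n) x ≠ 0) {ψ : Dist}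
    (hψ : E.IsSolution f ψ) :
    ∃ u v : ℝ → ℂ, ContDiff ℝ ∞ u ∧ ContDiff ℝ ∞ v ∧ E.SolvesNeg f u ∧ E.SolvesPos f v ∧
      ψ = regular (glue u v) := by
  obtain ⟨hA, hL⟩ := hψ
  obtain ⟨k, hk⟩ := exists_agreeOn_of_mem_spaceA hA
  obtain ⟨u, v, hu, hv, η, hη, hψ⟩ := hk 0
  rw [zero_sub, zero_add] at hψ
  have hev := fun (w : ℝ → ℂ) (hw : IsTest w) => E.ev_L hu hv hη hψ hw
  rw [hL] at hev
  have hcn : ∀ i, ContDiff ℝ ∞ fun x => E.aNeg i x + E.bNeg i x := fun i =>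
    (E.smooth_aNeg i).add (E.smooth_bNeg i)
  have hcp : ∀ i, ContDiff ℝ ∞ fun x => E.aPos i x + E.bPos i x := fun i =>
    (E.smooth_aPos i).add (E.smooth_bPos i)
  -- All deltas here come from coefficients multiplied by smooth branches, and `M ≤ n` keeps their
  -- order below `n`.
  have hT : HasDeltaOrder n 0 fun w => (∫ x, w x * f x) -
      ∑ i : Fin (n + 1), (((ev (E.a i) fun x => iteratedDeriv (k + i) v x * w x) -
          ∫ x, w x * (iteratedDeriv (k + i) v x * E.aNeg i x)) +
        ((ev (E.b i) fun x => iteratedDeriv (k + i) u x * w x) -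
          ∫ x, w x * (iteratedDeriv (k + i) u x * E.bPos i x))) :=
    (HasDeltaOrder.integral hf.continuous.locallyIntegrable).sub (.sum _ fun i _ =>
      ((HasDeltaOrder.ev_coeff_mul (E.smooth_aNeg i) (E.smooth_aPos i)
        (contDiff_iteratedDeriv hv (k + i)) fun _ => A_eq_zero hM i).sub
      (.integral ((contDiff_iteratedDeriv hv (k + i)).mul
        (E.smooth_aNeg i)).continuous.locallyIntegrable)).add
      ((HasDeltaOrder.ev_coeff_mul (E.smooth_bNeg i) (E.smooth_bPos i)
        (contDiff_iteratedDeriv hu (k + i)) fun _ => B_eq_zero hM i).sub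
      (.integral ((contDiff_iteratedDeriv hu (k + i)).mul
        (E.smooth_bPos i)).continuous.locallyIntegrable)))
  have hJ := jump_eq_zero (c := fun i x => E.aNeg i x + E.bPos i x)
    (fun i => (E.smooth_aNeg i).add (E.smooth_bPos i)) h0 hu hv (k := k) hT
    (η := η / 3) (by positivity) fun w hw hs => by
      rw [zero_sub, zero_add] at hs
      rw [← ev_regular hf.continuous.locallyIntegrable hw, (hev w hw).2.2 hs, add_sub_cancel_right]
      refine Finset.sum_congr rfl fun i _ => ?_
      rw [← D_iterate_add, hψ.D_iterate i _ (hw.mul_left ((E.smooth_aNeg i).add (E.smooth_bPos i)))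
        (tsupport_mul_subset_of (hs.trans (Set.Ioo_subset_Ioo (by linarith) (by linarith))))]
  -- With `r = n` the orders covered are exactly `m < k`, the ones that contribute deltas to
  -- `D^[k]`.
  rw [D_iterate_regular_glueAt hu hv fun m hm => hJ m (by omega)] at hψ
  have hu₀ := contDiff_iteratedDeriv hu k
  have hv₀ := contDiff_iteratedDeriv hv k
  obtain ⟨U, hU, hψU, hUu⟩ := exists_contDiff_agreeOn (ψ := ψ) (O := Set.Iio 0) (N := Set.Ioi (-η))
    isOpen_Iio isOpen_Ioi (fun x => by
      rcases lt_or_ge x 0 with h | h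
      · exact Or.inl h
      · exact Or.inr (by rw [Set.mem_Ioi]; linarith))
    (fun p hp => by
      obtain ⟨u', v', hu', hv', δ, hδ, hψ'⟩ := hk p
      have hp' : 0 < -p := by rw [Set.mem_Iio] at hp; linarith
      -- The radius `min δ (-p)` keeps the interval in the negative half-line, where the
      -- coefficients are smooth.
      have hs : Set.Ioo (p - min δ (-p)) (p + min δ (-p)) ⊆ Set.Ioo (p - δ) (p + δ) :=
        Set.Ioo_subset_Ioo (by linarith [min_le_left δ (-p)]) (by linarith [min_le_left δ (-p)])
      have hs' : Set.Ioo (p - min δ (-p)) (p + min δ (-p)) ⊆ Set.Iio 0 := fun x hx => by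
        rw [Set.mem_Iio]; linarith [hx.2, min_le_right δ (-p)]
      exact exists_agreeOn_smooth hcn (hneg p hp) hu' hv' hf (lt_min hδ hp') (hψ'.mono hs)
        fun w hw hsw => ((hev w hw).1 (hsw.trans hs')).symm) hu₀
    (by
      rw [Set.Iio_inter_Ioi]
      exact (hψ.mono (Set.Ioo_subset_Ioo_right hη.le)).trans
        ((agreeOn_D_glueAt hu₀ hv₀ 0).1.mono Set.Ioo_subset_Iio_self))
  obtain ⟨V, hV, hψV, hVv⟩ := exists_contDiff_agreeOn (ψ := ψ) (O := Set.Ioi 0) (N := Set.Iio η)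
    isOpen_Ioi isOpen_Iio (fun x => by
      rcases lt_or_ge 0 x with h | h
      · exact Or.inl h
      · exact Or.inr (by rw [Set.mem_Iio]; linarith))
    (fun p hp => by
      obtain ⟨u', v', hu', hv', δ, hδ, hψ'⟩ := hk p
      have hs : Set.Ioo (p - min δ p) (p + min δ p) ⊆ Set.Ioo (p - δ) (p + δ) :=
        Set.Ioo_subset_Ioo (by linarith [min_le_left δ p]) (by linarith [min_le_left δ p])
      have hs' : Set.Ioo (p - min δ p) (p + min δ p) ⊆ Set.Ioi 0 := fun x hx => by
        rw [Set.mem_Ioi]; linarith [hx.1, min_le_right δ p]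
      exact exists_agreeOn_smooth hcp (hpos p hp) hu' hv' hf (lt_min hδ hp) (hψ'.mono hs)
        fun w hw hsw => ((hev w hw).2.1 (hsw.trans hs')).symm) hv₀
    (by
      rw [Set.Ioi_inter_Iio]
      exact (hψ.mono (Set.Ioo_subset_Ioo_left (by linarith))).trans
        ((agreeOn_D_glueAt hu₀ hv₀ 0).2.mono Set.Ioo_subset_Ioi_self))
  refine ⟨U, V, hU, hV, fun x hx => ?_, fun x hx => ?_, ?_⟩
  -- The case of order `0` extends the equation to the end point `0`.
  · have := iteratedDeriv_eq_of_eqOn (contDiff_diffOp _ hcn _ hU) hf isOpen_Iio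
      (eqOn_diffOp hcn hf hU isOpen_Iio hψU fun w hw hs => ((hev w hw).1 hs).symm) 0
      (x := x) (by rwa [closure_Iio])
    simpa using this
  · have := iteratedDeriv_eq_of_eqOn (contDiff_diffOp _ hcp _ hV) hf isOpen_Ioi
      (eqOn_diffOp hcp hf hV isOpen_Ioi hψV fun w hw hs => ((hev w hw).2.1 hs).symm) 0
      (x := x) (by rwa [closure_Ioi])
    simpa using this
  · refine AgreeOn.eq (agreeOn_of_local fun p _ => ?_)
    have hUV := agreeOn_D_glueAt (p := 0) hU hV 0
    rcases lt_trichotomy p 0 with hp | rfl | hp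
    · exact ⟨_, isOpen_Iio, hp, hψU.trans hUV.1.symm⟩
    · refine ⟨_, isOpen_Ioo, ⟨neg_lt_zero.2 hη, hη⟩, hψ.trans (agreeOn_regular_of_eqOn
        (locallyIntegrable_glueAt 0 hu₀.continuous hv₀.continuous)
        (locallyIntegrable_glueAt 0 hU.continuous hV.continuous) fun x hx => ?_)⟩
      simp only [glueAt]
      rw [hUu hx.1, hVv hx.2]
    · exact ⟨_, isOpen_Ioi, hp, hψV.trans hUV.2.symm⟩

end Coeffs

end SingODE

/-! ### Assembly of the theorem. -/

open SingODE in
open scoped ContDiff in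
theorem theorem3p8 (n : ℕ) (E : Coeffs n)
    (h0 : E.aNeg (Fin.last n) 0 + E.bPos (Fin.last n) 0 ≠ 0)
    (hneg : E.aNeg (Fin.last n) 0 + E.bNeg (Fin.last n) 0 ≠ 0)
    (hpos : E.aPos (Fin.last n) 0 + E.bPos (Fin.last n) 0 ≠ 0)
    (hM : E.M ≤ n)
    (hnegz : ∀ x < 0, ∃ i, E.aNeg i x + E.bNeg i x ≠ 0)
    (hposz : ∀ x > 0, ∃ i, E.aPos i x + E.bPos i x ≠ 0) :
    ∃ (F : Fin n → ((Fin n → ℂ) × (Fin n → ℂ)) →ₗ[ℂ] ℂ)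
      (g : (Fin n → ℂ) →ₗ[ℂ] (Fin n → ℂ))
      (A B : Matrix (Fin n) (Fin n) ℂ),
      (∀ (X Y : Fin n → ℂ) (i : Fin n), F i (X, Y) = (B.mulVec Y) i - (A.mulVec X) i) ∧
      ∀ f : ℝ → ℂ, ContDiff ℝ ∞ f → E.SectionallyRegular f →
        (∀ ψ : Dist, E.IsSolution f ψ → ∃ u v : ℝ → ℂ,
          ContDiff ℝ ∞ u ∧ ContDiff ℝ ∞ v ∧ E.SolvesNeg f u ∧ E.SolvesPos f v ∧
          ψ = regular (glue u v) ∧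
          deltaComb (fun i => F i (jet n u, jet n v) + g (jet n f) i) = 0 ∧
          A.mulVec (jet n u) = B.mulVec (jet n v) + g (jet n f)) ∧
        (∀ u v : ℝ → ℂ, ContDiff ℝ ∞ u → ContDiff ℝ ∞ v → E.SolvesNeg f u → E.SolvesPos f v →
          E.L (regular (glue u v)) - regular f =
            deltaComb (fun i => F i (jet n u, jet n v) + g (jet n f) i) ∧
          (E.IsSolution f (regular (glue u v)) ↔
            deltaComb (fun i => F i (jet n u, jet n v) + g (jet n f) i) = 0) ∧
          (deltaComb (fun i => F i (jet n u, jet n v) + g (jet n f) i) = 0 ↔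
            A.mulVec (jet n u) = B.mulVec (jet n v) + g (jet n f))) := by
  obtain ⟨F, g, hF⟩ := Coeffs.exists_interface hM hneg hpos
  obtain ⟨A, B, hAB⟩ := exists_matrices F
  -- Independence of the derivatives of the Dirac measure allows comparison coefficient by
  -- coefficient.
  have hcond : ∀ X Y Z : Fin n → ℂ, deltaComb (fun i => F (X, Y) i + g Z i) = 0 ↔
      A.mulVec X = B.mulVec Y + g Z := fun X Y Z => by
    rw [deltaComb_eq_zero_iff, hAB, funext_iff]
    refine forall_congr' fun i => ?_
    simp only [Pi.sub_apply, Pi.add_apply]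
    constructor <;> intro h <;> linear_combination -h
  refine ⟨fun i => LinearMap.proj i ∘ₗ F, g, A, B, fun X Y i => congrFun (hAB X Y) i,
    fun f hf hreg => ⟨fun ψ hψ => ?_, fun u v hu hv hu' hv' => ?_⟩⟩
  -- Sectional regularity is applied on the two open half-lines, where the deltas at `0` are not
  -- seen and the coefficients are their smooth branches.
  · obtain ⟨u, v, hu, hv, hu', hv', rfl⟩ := hψ.exists_glue hf hM h0
      (fun x hx => hreg.leading_ne_zero isOpen_Iio Set.ordConnected_Iio E.smooth_aNeg E.smooth_bNeg
        E.agreeOn_a_neg E.agreeOn_b_neg hx (hnegz x hx))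
      fun x hx => hreg.leading_ne_zero isOpen_Ioi Set.ordConnected_Ioi E.smooth_aPos E.smooth_bPos
        E.agreeOn_a_pos E.agreeOn_b_pos hx (hposz x hx)
    have h := (Coeffs.isSolution_iff hu hv (hF f u v hf hu hv hu' hv')).1 hψ
    exact ⟨u, v, hu, hv, hu', hv', rfl, h, (hcond _ _ _).1 h⟩
  · have h := hF f u v hf hu hv hu' hv'
    exact ⟨h, Coeffs.isSolution_iff hu hv h, hcond _ _ _⟩
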